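/- \textbf{Theorem (existence of the Larson--Penston solution).} Let $\gamma=1$. There exist a point $y_*\in[2,3]$ and functions $\rho,\omega$, real-analytic on $[0,\infty)$ (that is, at each point of $[0,\infty)$, the end point $0$ included, given by a convergent power series), with $\rho>0$ on $[0,\infty)$, such that: (i) (sonic point) $y_*$ is the only sonic point of the solution: for $y\ge 0$, one has $1-y^2\omega(y)^2=0$ if and only if $y=y_*$; (ii) (equations) at every $y>0$ with $y\neq y_*$, the pair $(\rho,\omega)$ satisfies the isothermal self-similar Euler--Poisson system $$\rho'=\frac{2y\rho\,\omega(\omega-2\pi\rho)}{1-y^2\omega^2},\qquad \omega'=\frac{1-3\omega}{y}-\frac{2y\,\omega^2(\omega-2\pi\rho)}{1-y^2\omega^2}$$ (hence, by continuity, after clearing denominators it holds at all $y\ge0$); (iii) (Larson--Penston type) at the sonic point $2\pi\rho(y_*)=\omega(y_*)=\frac1{y_*}$, $\;2\pi\rho'(y_*)=-\frac1{y_*^2}$, $\;\omega'(y_*)=\frac1{y_*}\bigl(1-\frac2{y_*}\bigr)$, and the flow is strictly inflowing: the radial velocity $u(y)=y(\omega(y)-1)$ is negative for all $y>0$; (iv)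 (boundary conditions) $\rho(0)>0$ and $\omega(0)=\frac13$, while as $y\to\infty$ the quantity $y^2\rho(y)$ converges to a finite positive limit and $\omega(y)\to1$. -/

import Mathlib

open Filter Topology

/-- `y` is a sonic point of the isothermal flow with relative velocity `ω`: the denominator
`1 - y² ω(y)²` of the self-similar system vanishes at `y ≥ 0`. -/
def IsSonicPoint (ω : ℝ → ℝ) (y : ℝ) : Prop :=
  0 ≤ y ∧ 1 - y ^ 2 * ω y ^ 2 = 0

/-- `(ρ, ω)` satisfies the isothermal (`γ = 1`) self-similar Euler-Poisson system
`ρ' = 2yρω(ω - 2πρ) / (1 - y²ω²)`,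
`ω' = (1 - 3ω)/y - 2yω²(ω - 2πρ) / (1 - y²ω²)`
at every `y > 0` that is not a sonic point, i.e. at every `y ≥ 0` at which the right-hand sides
are defined. For continuously differentiable `ρ, ω` with isolated sonic points, the system
extends by continuity (after clearing denominators) to all `y ≥ 0`. -/
def SolvesIsothermalSystem (ρ ω : ℝ → ℝ) : Prop :=
  ∀ y : ℝ, 0 < y → ¬ IsSonicPoint ω y →
    HasDerivAt ρ
      (2 * y * ρ y * ω y * (ω y - 2 * Real.pi * ρ y) / (1 - y ^ 2 * ω y ^ 2)) y ∧
    HasDerivAt ω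
      ((1 - 3 * ω y) / y
        - 2 * y * ω y ^ 2 * (ω y - 2 * Real.pi * ρ y) / (1 - y ^ 2 * ω y ^ 2)) y

/-- The boundary condition at the centre `y = 0` (for `γ = 1`). -/
def FriedmanCondition (ρ ω : ℝ → ℝ) : Prop :=
  0 < ρ 0 ∧ ω 0 = 1 / 3

/-- The boundary condition `ρ ∼ y⁻²`, `ω ∼ 1` as `y → ∞` (for `γ = 1`). The first relation is up
to a positive factor: `y² ρ(y)` has a positive finite limit. -/
def FarFieldCondition (ρ ω : ℝ → ℝ) : Prop :=
  (∃ k : ℝ, 0 < k ∧ Tendsto (fun y : ℝ => y ^ 2 * ρ y) atTop (𝓝 k)) ∧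
    Tendsto ω atTop (𝓝 1)

/-- The first-order Taylor expansion at `z` is of Type 1 (the Larson-Penston branch):
`2πρ = 1/z - (y - z)/z² + …`, `ω = 1/z + (1/z)(1 - 2/z)(y - z) + …`. -/
def IsTypeOneAt (ρ ω : ℝ → ℝ) (z : ℝ) : Prop :=
  2 * Real.pi * ρ z = 1 / z ∧ ω z = 1 / z ∧
    HasDerivAt (fun y => 2 * Real.pi * ρ y) (-(1 / z ^ 2)) z ∧
    HasDerivAt ω (1 / z * (1 - 2 / z)) z

/-- The self-similar radial velocity `u` recovered from `ω = (u + y) / y`. -/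
def radialVelocity (ω : ℝ → ℝ) (y : ℝ) : ℝ := y * (ω y - 1)

/-- `(ρ, ω)` is a real-analytic Larson-Penston solution on `[0, ∞)` with sonic point `z`: it has
positive density, solves the isothermal self-similar system, passes through exactly one sonic
point `z` on the Larson-Penston branch (Type 1), and is strictly inflowing. `AnalyticOnNhd`
asks for a convergent power series at each `y ≥ 0`, the end point `0` included. -/
structure IsLarsonPenstonSolution (ρ ω : ℝ → ℝ) (z : ℝ) : Prop where
  analytic_density : AnalyticOnNhd ℝ ρ (Set.Ici 0)
  analytic_velocity : AnalyticOnNhd ℝ ω (Set.Ici 0)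
  density_pos : ∀ y : ℝ, 0 ≤ y → 0 < ρ y
  solves : SolvesIsothermalSystem ρ ω
  sonic : ∀ y : ℝ, IsSonicPoint ω y ↔ y = z
  typeOne : IsTypeOneAt ρ ω z
  inflowing : ∀ y : ℝ, 0 < y → radialVelocity ω y < 0

/-! Put `R = 2πρ` and take `q = y²ω²` as independent variable, with unknowns `a = 1/ω` and `h = a -
1 - 2θ`, where `θ = (1 - y²Rω)/(1 - q)`. One has `h = d log ω / d log y`, and in the logarithm of
`q` the equation for `a` is autonomous. Since `y² = a²q` and `d(y²)/dq = a²/(1 + h)`, the change of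
variables is legitimate as long as `h > -1`. The sonic point becomes `q = 1`, the centre `q = 0` and
infinity `q = ∞`. Keeping `a > 1` gives `ω < 1`, that is, inflow.

Both `q = 1` and `q = 0` are singular points of Briot-Bouquet type, `x w' + μ w = x g(x, w)` with `μ
≥ 0`. For these, `BriotBouquet.exists_analytic_solution` produces an analytic solution on an
interval uniform in a parameter, by Picard iteration of the operator `eulerIntegral` on a complex
disc. `BriotBouquet.eq_zero_of_bounded`, applied to a difference of two solutions, shows that a
bounded solution (convergent to the right value where `μ = 0`) is that analytic one. At the sonic
point this yields a family with `a = z`, `h = z - 2` at `q = 1`, continuous in `z ∈ [2, 3]`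
(`Sonic.exists_family`).

Towards the centre, `z` is found by shooting in `s = -log q`. A trajectory may enter `{a > 3, h >
0}` or `{a < 3, h < 0}`; the first set is invariant and so is `h < 0`, hence no trajectory visits
both. Both events are open in `z`; the first occurs at `z = 3`, the second at `z = 2`. As `[2, 3]`
is connected, some `z` avoids both, and its trajectory stays in `{3/2 < a < 3, 0 < h < a - 1}`
(`Inner.Trajectory.critical`, `Inner.exists_solution`). There `R/ω` is monotone and bounded as `q →
0`, so the remainders are bounded and the uniqueness statement gives analyticity at the centre with
`a = 3`, i.e. `ω = 1/3` (`Center.exists_analytic_extension`).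

Towards infinity no choice is needed: `{1 < a < 3, 0 < h < a - 1, θ < 1/2}` traps every solution
that enters it (`Outer.trapping`), and monotone quantities give the limits of `a` and of `y²R`
(`Outer.asymptotics`). Finally `q ↦ a²q` is inverted analytically on `[0, ∞)`
(`AnalyticOnNhd.exists_inverse_Ici`), and everything is composed with `y²`. -/

/-- The solution operator of `x w' + μ w = x G(x)`, `w(0) = 0`. -/
noncomputable def eulerIntegral (μ : ℝ) (G : ℂ → ℂ) (x : ℂ) : ℂ :=
  x * ∫ τ in (0 : ℝ)..1, ((τ ^ μ : ℝ) : ℂ) * G (τ * x)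

/-! ### The model operator for `x w' + μ w = x G` on a complex disc. -/

namespace eulerIntegral

open Set Metric MeasureTheory

theorem mul_mem_ball {r : ℝ} {x : ℂ} (hx : x ∈ ball (0 : ℂ) r) {τ : ℝ} (hτ : τ ∈ Icc (0 : ℝ) 1) :
    (τ * x : ℂ) ∈ ball (0 : ℂ) r := by
  simp only [mem_ball_zero_iff, norm_mul, Complex.norm_real, Real.norm_eq_abs] at hx ⊢
  rw [abs_of_nonneg hτ.1]
  nlinarith [norm_nonneg x, hτ.1, hτ.2]

theorem norm_rpow_le_one {μ : ℝ} (hμ : 0 ≤ μ) {τ : ℝ} (hτ : τ ∈ Icc (0 : ℝ) 1) :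
    ‖((τ ^ μ : ℝ) : ℂ)‖ ≤ 1 := by
  rw [Complex.norm_real, Real.norm_eq_abs, abs_of_nonneg (Real.rpow_nonneg hτ.1 _)]
  exact Real.rpow_le_one hτ.1 hτ.2 hμ

theorem norm_le {μ : ℝ} (hμ : 0 ≤ μ) {G : ℂ → ℂ} {r M : ℝ} (hG : ∀ y ∈ ball (0 : ℂ) r, ‖G y‖ ≤ M)
    {x : ℂ} (hx : x ∈ ball (0 : ℂ) r) : ‖eulerIntegral μ G x‖ ≤ ‖x‖ * M := by
  rw [eulerIntegral, norm_mul]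
  refine mul_le_mul_of_nonneg_left ?_ (norm_nonneg _)
  have := intervalIntegral.norm_integral_le_of_norm_le_const (a := 0) (b := 1) (C := M)
    (f := fun τ : ℝ => ((τ ^ μ : ℝ) : ℂ) * G (τ * x)) ?_
  · simpa using this
  · intro τ hτ
    rw [uIoc_of_le zero_le_one] at hτ
    have h1 := norm_rpow_le_one hμ (Ioc_subset_Icc_self hτ)
    have h2 := hG _ (mul_mem_ball hx (Ioc_subset_Icc_self hτ))
    rw [norm_mul]
    nlinarith [norm_nonneg ((τ ^ μ : ℝ) : ℂ), norm_nonneg (G (τ * x))]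

theorem continuousOn_comp {G : ℂ → ℂ} {r : ℝ} (hG : ContinuousOn G (ball 0 r))
    {x : ℂ} (hx : x ∈ ball (0 : ℂ) r) : ContinuousOn (fun τ : ℝ => G (τ * x)) (Icc 0 1) :=
  hG.comp (by fun_prop) fun _ hτ => mul_mem_ball hx hτ

theorem continuous_rpow {μ : ℝ} (hμ : 0 ≤ μ) : Continuous fun τ : ℝ => ((τ ^ μ : ℝ) : ℂ) :=
  Complex.continuous_ofReal.comp (Real.continuous_rpow_const hμ)

theorem intervalIntegrable {μ : ℝ} (hμ : 0 ≤ μ) {G : ℂ → ℂ} {r : ℝ}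
    (hG : ContinuousOn G (ball 0 r)) {x : ℂ} (hx : x ∈ ball (0 : ℂ) r) :
    IntervalIntegrable (fun τ : ℝ => ((τ ^ μ : ℝ) : ℂ) * G (τ * x)) volume 0 1 := by
  apply ContinuousOn.intervalIntegrable
  rw [uIcc_of_le zero_le_one]
  exact (continuous_rpow hμ).continuousOn.mul (continuousOn_comp hG hx)

theorem norm_sub_le {μ : ℝ} (hμ : 0 ≤ μ) {G H : ℂ → ℂ} {r M : ℝ}
    (hG : ContinuousOn G (ball 0 r)) (hH : ContinuousOn H (ball 0 r))
    (hGH : ∀ y ∈ ball (0 : ℂ) r, ‖G y - H y‖ ≤ M)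
    {x : ℂ} (hx : x ∈ ball (0 : ℂ) r) :
    ‖eulerIntegral μ G x - eulerIntegral μ H x‖ ≤ ‖x‖ * M := by
  have : eulerIntegral μ G x - eulerIntegral μ H x = eulerIntegral μ (fun y => G y - H y) x := by
    simp only [eulerIntegral]
    rw [← mul_sub, ← intervalIntegral.integral_sub (intervalIntegrable hμ hG hx)
      (intervalIntegrable hμ hH hx)]
    simp only [mul_sub]
  rw [this]
  exact norm_le hμ hGH hx

/-- Differentiation under the integral sign brings out `τ · G'(τx)`, and integrating the derivative
of `τ^(μ+1) G(τx)` over `[0, 1]` converts that term back into `G(x)` and the original integral. -/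
theorem exists_hasDerivAt {μ : ℝ} (hμ : 0 ≤ μ) {G : ℂ → ℂ} {r : ℝ}
    (hG : DifferentiableOn ℂ G (ball 0 r)) {x : ℂ} (hx : x ∈ ball (0 : ℂ) r) :
    ∃ d, HasDerivAt (eulerIntegral μ G) d x ∧ x * d + μ * eulerIntegral μ G x = x * G x := by
  -- On a slightly smaller closed disc `G'` is bounded, which supplies the dominating constant.
  obtain ⟨r', hxr, hr'⟩ := exists_between (mem_ball_zero_iff.1 hx)
  have hG' : ContinuousOn (deriv G) (ball 0 r) := (hG.deriv isOpen_ball).continuousOn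
  have hsub : closedBall (0 : ℂ) r' ⊆ ball 0 r := closedBall_subset_ball hr'
  obtain ⟨C, hC⟩ := (isCompact_closedBall (0 : ℂ) r').exists_bound_of_continuousOn
    (hG'.mono hsub)
  have hx' : x ∈ ball (0 : ℂ) r' := mem_ball_zero_iff.2 hxr
  have hder : ∀ y ∈ ball (0 : ℂ) r, HasDerivAt G (deriv G y) y := fun y hy =>
    ((hG y hy).differentiableAt (isOpen_ball.mem_nhds hy)).hasDerivAt
  have hr0 : 0 ≤ r' := (norm_nonneg x).trans hxr.le
  have hC0 : 0 ≤ C := (norm_nonneg _).trans (hC 0 (by simpa using hr0))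
  have key := intervalIntegral.hasDerivAt_integral_of_dominated_loc_of_deriv_le
    (μ := volume) (a := 0) (b := 1) (x₀ := x) (s := ball (0 : ℂ) r')
    (F := fun (y : ℂ) (τ : ℝ) => ((τ ^ μ : ℝ) : ℂ) * G (τ * y))
    (F' := fun (y : ℂ) (τ : ℝ) => ((τ ^ μ : ℝ) : ℂ) * (deriv G (τ * y) * τ))
    (bound := fun _ => C) (isOpen_ball.mem_nhds hx') ?_
    (intervalIntegrable hμ hG.continuousOn hx) ?_ ?_ (by simp) ?_
  · have hparts := intervalIntegral.integral_deriv_mul_eq_sub (a := 0) (b := 1)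
      (u := fun τ : ℝ => ((τ ^ (μ + 1) : ℝ) : ℂ)) (u' := fun τ : ℝ => (((μ + 1) * τ ^ μ : ℝ) : ℂ))
      (v := fun τ : ℝ => G (τ * x)) (v' := fun τ : ℝ => deriv G (τ * x) * x) ?_ ?_ ?_ ?_
    · refine ⟨_, (hasDerivAt_id x).mul key.2, ?_⟩
      have e1 : (∫ τ in (0 : ℝ)..1, (((μ + 1) * τ ^ μ : ℝ) : ℂ) * G (τ * x) +
          ((τ ^ (μ + 1) : ℝ) : ℂ) * (deriv G (τ * x) * x)) =
          (μ + 1) * (∫ τ in (0 : ℝ)..1, ((τ ^ μ : ℝ) : ℂ) * G (τ * x)) +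
          x * ∫ τ in (0 : ℝ)..1, ((τ ^ μ : ℝ) : ℂ) * (deriv G (τ * x) * τ) := by
        rw [← intervalIntegral.integral_const_mul, ← intervalIntegral.integral_const_mul,
          ← intervalIntegral.integral_add]
        · apply intervalIntegral.integral_congr
          intro τ hτ
          rw [uIcc_of_le zero_le_one] at hτ
          have : τ ^ (μ + 1) = τ ^ μ * τ := by
            rw [Real.rpow_add_one' hτ.1 (by linarith)]
          simp only [this]
          push_cast
          ring
        · exact (intervalIntegrable hμ hG.continuousOn hx).const_mul _
        · exact key.1.const_mul _
      rw [e1] at hparts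
      simp only [Complex.ofReal_one, one_mul, Real.one_rpow, Complex.ofReal_zero, zero_mul] at hparts
      rw [Real.zero_rpow (by linarith)] at hparts
      simp only [Complex.ofReal_zero, zero_mul, sub_zero] at hparts
      simp only [id, eulerIntegral]
      linear_combination x * hparts
    · intro τ hτ
      have := (Real.hasDerivAt_rpow_const (x := τ) (p := μ + 1) (Or.inr (by linarith))).ofReal_comp
      simpa using this
    · intro τ hτ
      rw [uIcc_of_le zero_le_one] at hτ
      have h1 := hder _ (mul_mem_ball hx hτ)
      have h2 : HasDerivAt (fun τ : ℝ => (τ * x : ℂ)) x τ := by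
        simpa using (Complex.ofRealCLM.hasDerivAt (x := τ)).mul_const x
      exact h1.comp τ h2
    · apply Continuous.intervalIntegrable
      have := (continuous_rpow hμ)
      push_cast
      fun_prop
    · apply ContinuousOn.intervalIntegrable
      rw [uIcc_of_le zero_le_one]
      exact (continuousOn_comp hG' hx).mul continuousOn_const
  · filter_upwards [isOpen_ball.mem_nhds hx] with y hy
    exact (intervalIntegrable_iff.1 (intervalIntegrable hμ hG.continuousOn hy)).aestronglyMeasurable
  · have : IntervalIntegrable (fun τ : ℝ => ((τ ^ μ : ℝ) : ℂ) * (deriv G (τ * x) * τ)) volume 0 1 := by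
      apply ContinuousOn.intervalIntegrable
      rw [uIcc_of_le zero_le_one]
      exact (continuous_rpow hμ).continuousOn.mul ((continuousOn_comp hG' hx).mul (by fun_prop))
    exact (intervalIntegrable_iff.1 this).aestronglyMeasurable
  · refine Eventually.of_forall fun τ hτ y hy => ?_
    rw [uIoc_of_le zero_le_one] at hτ
    have hτ' := Ioc_subset_Icc_self hτ
    have h1 := norm_rpow_le_one hμ hτ'
    have h2 := hC _ (ball_subset_closedBall (mul_mem_ball hy hτ'))
    have h3 : ‖(τ : ℂ)‖ ≤ 1 := by
      rw [Complex.norm_real, Real.norm_eq_abs, abs_of_nonneg hτ'.1]; exact hτ'.2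
    rw [norm_mul, norm_mul]
    calc _ ≤ 1 * (C * 1) := by gcongr
      _ = C := by ring
  · refine Eventually.of_forall fun τ hτ y hy => ?_
    rw [uIoc_of_le zero_le_one] at hτ
    have h1 := hder _ (hsub (ball_subset_closedBall (mul_mem_ball hy (Ioc_subset_Icc_self hτ))))
    have h2 : HasDerivAt (fun y : ℂ => (τ * y : ℂ)) τ y := by
      simpa using (hasDerivAt_id y).const_mul (τ : ℂ)
    exact (h1.comp y h2).const_mul _

theorem im_eq_zero {μ : ℝ} {G : ℂ → ℂ} {r : ℝ}
    (hG : ∀ y : ℝ, (y : ℂ) ∈ ball (0 : ℂ) r → (G y).im = 0) {x : ℝ}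
    (hx : (x : ℂ) ∈ ball (0 : ℂ) r) : (eulerIntegral μ G x).im = 0 := by
  have : eulerIntegral μ G x = ((x * ∫ τ in (0 : ℝ)..1, τ ^ μ * (G (τ * x)).re : ℝ) : ℂ) := by
    rw [eulerIntegral, Complex.ofReal_mul, ← intervalIntegral.integral_ofReal]
    congr 1
    apply intervalIntegral.integral_congr
    intro τ hτ
    rw [uIcc_of_le zero_le_one] at hτ
    have := hG (τ * x) (by push_cast; exact mul_mem_ball hx hτ)
    push_cast at this
    apply Complex.ext <;> simp [this]
  rw [this, Complex.ofReal_im]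

/-- Continuity in the parameter is what later makes the shooting sets open. Dominated convergence
suffices: for fixed `τ > 0` the weight `τ^μ` is continuous in `μ`. -/
theorem continuousOn_param {S : Set ℝ} {μ : ℝ → ℝ} (hμ : ∀ z ∈ S, 0 ≤ μ z)
    (hμc : ContinuousOn μ S) {G : ℝ → ℂ → ℂ} {r M : ℝ}
    (hG : ContinuousOn (fun p : ℝ × ℂ => G p.1 p.2) (S ×ˢ ball 0 r))
    (hM : ∀ z ∈ S, ∀ y ∈ ball (0 : ℂ) r, ‖G z y‖ ≤ M) :
    ContinuousOn (fun p : ℝ × ℂ => eulerIntegral (μ p.1) (G p.1) p.2) (S ×ˢ ball 0 r) := by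
  have hGz : ∀ z ∈ S, ContinuousOn (G z) (ball 0 r) := fun z hz =>
    hG.comp (f := fun y => (z, y)) (by fun_prop) fun y hy => ⟨hz, hy⟩
  refine ContinuousOn.mul (by fun_prop) ?_
  rintro ⟨z, x⟩ ⟨hz, hx⟩
  refine intervalIntegral.continuousWithinAt_of_dominated_interval (bound := fun _ => M) ?_ ?_
    (by simp) ?_
  · filter_upwards [self_mem_nhdsWithin] with p hp
    exact (intervalIntegrable_iff.1
      (intervalIntegrable (hμ _ hp.1) (hGz _ hp.1) hp.2)).aestronglyMeasurable
  · filter_upwards [self_mem_nhdsWithin] with p hp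
    refine Eventually.of_forall fun τ hτ => ?_
    rw [uIoc_of_le zero_le_one] at hτ
    have h1 := norm_rpow_le_one (hμ _ hp.1) (Ioc_subset_Icc_self hτ)
    have h2 := hM _ hp.1 _ (mul_mem_ball hp.2 (Ioc_subset_Icc_self hτ))
    rw [norm_mul]
    nlinarith [norm_nonneg ((τ ^ μ p.1 : ℝ) : ℂ), norm_nonneg (G p.1 (τ * p.2))]
  · refine Eventually.of_forall fun τ hτ => ?_
    rw [uIoc_of_le zero_le_one] at hτ
    have hc : ContinuousOn (fun p : ℝ × ℂ => ((τ ^ μ p.1 : ℝ) : ℂ) * G p.1 (τ * p.2))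
        (S ×ˢ ball 0 r) := by
      refine ContinuousOn.mul ?_ ?_
      · refine Complex.continuous_ofReal.comp_continuousOn ?_
        refine ContinuousOn.rpow continuousOn_const ?_ fun _ _ => Or.inl hτ.1.ne'
        exact hμc.comp continuousOn_fst fun p hp => hp.1
      · exact hG.comp (f := fun p : ℝ × ℂ => (p.1, (τ * p.2 : ℂ))) (by fun_prop)
          fun p hp => ⟨hp.1, mul_mem_ball hp.2 (Ioc_subset_Icc_self hτ)⟩
    exact hc _ ⟨hz, hx⟩

end eulerIntegral

/-! ### Picard iteration for singular systems with a parameter. -/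

namespace BriotBouquet

open Set Metric

/-- Smallness hypotheses on the holomorphic nonlinearity `g` that make
`x w' + μ w = x g(z, x, w)`, `w(0) = 0` solvable by Picard iteration on the disc of radius `r`. -/
structure Data {ι : Type*} [Fintype ι] (S : Set ℝ) (r ρ M L : ℝ) (μ : ℝ → ι → ℝ)
    (g : ℝ → ℂ → (ι → ℂ) → ι → ℂ) : Prop where
  r_pos : 0 < r
  M_nonneg : 0 ≤ M
  L_nonneg : 0 ≤ L
  rM : r * M < ρ
  rL : r * L ≤ 1 / 2
  exponent_nonneg : ∀ z ∈ S, ∀ i, 0 ≤ μ z i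
  exponent_cont : ∀ i, ContinuousOn (fun z => μ z i) S
  cont : ContinuousOn (fun p : ℝ × ℂ × (ι → ℂ) => g p.1 p.2.1 p.2.2) (S ×ˢ ball 0 r ×ˢ ball 0 ρ)
  diff : ∀ z ∈ S, DifferentiableOn ℂ (fun p : ℂ × (ι → ℂ) => g z p.1 p.2) (ball 0 r ×ˢ ball 0 ρ)
  bound : ∀ z ∈ S, ∀ x ∈ ball (0 : ℂ) r, ∀ w ∈ ball (0 : ι → ℂ) ρ, ‖g z x w‖ ≤ M
  lip : ∀ z ∈ S, ∀ x ∈ ball (0 : ℂ) r, ∀ w ∈ ball (0 : ι → ℂ) ρ, ∀ w' ∈ ball (0 : ι → ℂ) ρ,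
    ‖g z x w - g z x w'‖ ≤ L * ‖w - w'‖
  real : ∀ z ∈ S, ∀ x : ℝ, (x : ℂ) ∈ ball (0 : ℂ) r → ∀ w ∈ ball (0 : ι → ℂ) ρ,
    (∀ i, (w i).im = 0) → ∀ i, (g z x w i).im = 0

/-- Functions among which the Picard iteration takes place. -/
structure Admissible {ι : Type*} [Fintype ι] (S : Set ℝ) (r M : ℝ) (w : ℝ → ℂ → ι → ℂ) :
    Prop where
  cont : ContinuousOn (fun p : ℝ × ℂ => w p.1 p.2) (S ×ˢ ball 0 r)
  diff : ∀ z ∈ S, DifferentiableOn ℂ (w z) (ball 0 r)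
  bound : ∀ z ∈ S, ∀ x ∈ ball (0 : ℂ) r, ‖w z x‖ ≤ ‖x‖ * M
  real : ∀ z ∈ S, ∀ x : ℝ, (x : ℂ) ∈ ball (0 : ℂ) r → ∀ i, (w z x i).im = 0

/-- One step of the Picard iteration. -/
noncomputable def step {ι : Type*} (μ : ℝ → ι → ℝ) (g : ℝ → ℂ → (ι → ℂ) → ι → ℂ)
    (w : ℝ → ℂ → ι → ℂ) (z : ℝ) (x : ℂ) (i : ι) : ℂ :=
  eulerIntegral (μ z i) (fun y => g z y (w z y) i) x

variable {ι : Type*} [Fintype ι] {S : Set ℝ} {r ρ M L : ℝ} {μ : ℝ → ι → ℝ}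
  {g : ℝ → ℂ → (ι → ℂ) → ι → ℂ} {w w' : ℝ → ℂ → ι → ℂ}

theorem Admissible.mem_ball (hD : Data S r ρ M L μ g) (hw : Admissible S r M w) {z : ℝ}
    (hz : z ∈ S) {x : ℂ} (hx : x ∈ ball (0 : ℂ) r) : w z x ∈ ball (0 : ι → ℂ) ρ := by
  rw [mem_ball_zero_iff]
  have h1 := hw.bound z hz x hx
  have h2 := mem_ball_zero_iff.1 hx
  nlinarith [hD.rM, hD.M_nonneg]

theorem Admissible.continuousOn_comp (hD : Data S r ρ M L μ g) (hw : Admissible S r M w) :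
    ContinuousOn (fun p : ℝ × ℂ => g p.1 p.2 (w p.1 p.2)) (S ×ˢ ball 0 r) :=
  hD.cont.comp (f := fun p : ℝ × ℂ => (p.1, p.2, w p.1 p.2))
    (continuousOn_fst.prodMk (continuousOn_snd.prodMk hw.cont))
    fun _ hp => ⟨hp.1, hp.2, hw.mem_ball hD hp.1 hp.2⟩

theorem Admissible.differentiableOn_comp (hD : Data S r ρ M L μ g) (hw : Admissible S r M w)
    {z : ℝ} (hz : z ∈ S) : DifferentiableOn ℂ (fun x => g z x (w z x)) (ball 0 r) :=
  (hD.diff z hz).comp (f := fun x : ℂ => (x, w z x))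
    (differentiableOn_id.prodMk (hw.diff z hz)) fun _ hx => ⟨hx, hw.mem_ball hD hz hx⟩

theorem Admissible.step (hD : Data S r ρ M L μ g) (hw : Admissible S r M w) :
    Admissible S r M (step μ g w) where
  cont := by
    refine continuousOn_pi.2 fun i => ?_
    refine eulerIntegral.continuousOn_param (μ := fun z => μ z i)
      (G := fun z y => g z y (w z y) i) (M := M) (fun z hz => hD.exponent_nonneg z hz i)
      (hD.exponent_cont i) (continuousOn_pi.1 (hw.continuousOn_comp hD) i) ?_
    exact fun z hz y hy => (norm_le_pi_norm _ i).trans (hD.bound z hz y hy _ (hw.mem_ball hD hz hy))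
  diff z hz := by
    refine differentiableOn_pi.2 fun i x hx => ?_
    obtain ⟨d, hd, -⟩ := eulerIntegral.exists_hasDerivAt (hD.exponent_nonneg z hz i)
      (differentiableOn_pi.1 (hw.differentiableOn_comp hD hz) i) hx
    exact hd.differentiableAt.differentiableWithinAt
  bound z hz x hx := by
    refine (pi_norm_le_iff_of_nonneg (mul_nonneg (norm_nonneg _) hD.M_nonneg)).2 fun i => ?_
    exact eulerIntegral.norm_le (hD.exponent_nonneg z hz i) (fun y hy =>
      (norm_le_pi_norm _ i).trans (hD.bound z hz y hy _ (hw.mem_ball hD hz hy))) hx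
  real z hz x hx i := eulerIntegral.im_eq_zero
    (fun y hy => hD.real z hz y hy _ (hw.mem_ball hD hz hy) (hw.real z hz y hy) i) hx

/-- The prefactor `x` of `eulerIntegral` is smaller than `r`, so one step has Lipschitz constant at
most `r L ≤ 1/2`; this replaces the short time interval of the regular Picard theorem. -/
theorem Admissible.norm_step_sub_le (hD : Data S r ρ M L μ g) (hw : Admissible S r M w)
    (hw' : Admissible S r M w') {ε : ℝ} (hε : 0 ≤ ε)
    (h : ∀ z ∈ S, ∀ x ∈ ball (0 : ℂ) r, ‖w z x - w' z x‖ ≤ ε) :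
    ∀ z ∈ S, ∀ x ∈ ball (0 : ℂ) r,
      ‖BriotBouquet.step μ g w z x - BriotBouquet.step μ g w' z x‖ ≤ ε / 2 := by
  intro z hz x hx
  refine (pi_norm_le_iff_of_nonneg (by positivity)).2 fun i => ?_
  have := eulerIntegral.norm_sub_le (hD.exponent_nonneg z hz i) (M := L * ε)
    (continuousOn_pi.1 (hw.differentiableOn_comp hD hz).continuousOn i)
    (continuousOn_pi.1 (hw'.differentiableOn_comp hD hz).continuousOn i) (fun y hy => by
      have h1 := norm_le_pi_norm (g z y (w z y) - g z y (w' z y)) i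
      have h2 := hD.lip z hz y hy _ (hw.mem_ball hD hz hy) _ (hw'.mem_ball hD hz hy)
      exact h1.trans (h2.trans (mul_le_mul_of_nonneg_left (h z hz y hy) hD.L_nonneg))) hx
  refine this.trans ?_
  have h2 := (mem_ball_zero_iff.1 hx).le
  have : ‖x‖ * (L * ε) ≤ r * (L * ε) :=
    mul_le_mul_of_nonneg_right h2 (mul_nonneg hD.L_nonneg hε)
  nlinarith [hD.rL]

/-- Uniform limits preserve joint continuity and, by Weierstrass, holomorphy in `x`; the bound and
reality on the real axis pass to the limit pointwise. -/
theorem Admissible.of_tendstoUniformlyOn {W : ℕ → ℝ → ℂ → ι → ℂ}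
    (hW : ∀ n, Admissible S r M (W n))
    (h : TendstoUniformlyOn (fun n (p : ℝ × ℂ) => W n p.1 p.2) (fun p => w p.1 p.2) atTop
      (S ×ˢ ball 0 r)) : Admissible S r M w where
  cont := h.continuousOn (Frequently.of_forall fun n => (hW n).cont)
  diff z hz := by
    have hz' : TendstoUniformlyOn (fun n => W n z) (w z) atTop (ball 0 r) := by
      have := h.comp (fun x : ℂ => (z, x))
      exact this.mono fun x hx => ⟨hz, hx⟩
    exact hz'.tendstoLocallyUniformlyOn.differentiableOn
      (Eventually.of_forall fun n => (hW n).diff z hz) isOpen_ball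
  bound z hz x hx :=
    le_of_tendsto (h.tendsto_at (x := (z, x)) ⟨hz, hx⟩).norm
      (Eventually.of_forall fun n => (hW n).bound z hz x hx)
  real z hz x hx i := by
    have h1 := tendsto_pi_nhds.1 (h.tendsto_at (x := (z, (x : ℂ))) ⟨hz, hx⟩) i
    have h2 := (Complex.continuous_im.tendsto _).comp h1
    refine tendsto_nhds_unique h2 ?_
    refine tendsto_const_nhds.congr fun n => ?_
    exact ((hW n).real z hz x hx i).symm

theorem Data.exists_fixedPoint (hD : Data S r ρ M L μ g) :
    ∃ w, Admissible S r M w ∧ ∀ z ∈ S, ∀ x ∈ ball (0 : ℂ) r, step μ g w z x = w z x := by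
  let W : ℕ → ℝ → ℂ → ι → ℂ := fun n => (step μ g)^[n] 0
  have hWs : ∀ n, W (n + 1) = step μ g (W n) := fun n => Function.iterate_succ_apply' _ _ _
  have hW : ∀ n, Admissible S r M (W n) := by
    intro n
    induction n with
    | zero => exact
        { cont := continuousOn_const
          diff := fun z hz => differentiableOn_const _
          bound := fun z hz x hx => by
            simpa [W] using mul_nonneg (norm_nonneg x) hD.M_nonneg
          real := fun z hz x hx i => by simp [W] }
    | succ n ih => rw [hWs]; exact ih.step hD
  have hrM : 0 ≤ r * M := mul_nonneg hD.r_pos.le hD.M_nonneg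
  have hdist : ∀ n, ∀ z ∈ S, ∀ x ∈ ball (0 : ℂ) r,
      ‖W n z x - W (n + 1) z x‖ ≤ (r * M) / 2 ^ n := by
    intro n
    induction n with
    | zero =>
      intro z hz x hx
      have h1 := (hW 1).bound z hz x hx
      have h2 := mul_le_mul_of_nonneg_right (mem_ball_zero_iff.1 hx).le hD.M_nonneg
      have : W 0 z x = 0 := rfl
      rw [this, zero_sub, norm_neg]
      simpa using h1.trans h2
    | succ n ih =>
      intro z hz x hx
      rw [hWs, hWs (n + 1)]
      have := (hW n).norm_step_sub_le hD (hW (n + 1)) (by positivity) ih z hz x hx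
      rw [pow_succ, ← div_div]
      exact this
  have hlim : ∀ p ∈ S ×ˢ ball (0 : ℂ) r, ∃ l, Tendsto (fun n => W n p.1 p.2) atTop (𝓝 l) := by
    rintro p ⟨hz, hx⟩
    refine cauchySeq_tendsto_of_complete (cauchySeq_of_le_geometric_two (C := 2 * (r * M)) ?_)
    intro n
    rw [dist_eq_norm]
    simpa using hdist n _ hz _ hx
  choose! l hl using hlim
  let w : ℝ → ℂ → ι → ℂ := fun z x => l (z, x)
  have hle : ∀ n, ∀ z ∈ S, ∀ x ∈ ball (0 : ℂ) r, ‖W n z x - w z x‖ ≤ 2 * (r * M) / 2 ^ n := by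
    intro n z hz x hx
    have := dist_le_of_le_geometric_two_of_tendsto (C := 2 * (r * M))
      (f := fun n => W n z x) (fun n => by
        rw [dist_eq_norm]; simpa using hdist n _ hz _ hx) (hl (z, x) ⟨hz, hx⟩) n
    rwa [dist_eq_norm] at this
  have h0 : Tendsto (fun n : ℕ => 2 * (r * M) / 2 ^ n) atTop (𝓝 0) := by
    have := (tendsto_pow_atTop_nhds_zero_of_lt_one (r := (1 / 2 : ℝ)) (by norm_num)
      (by norm_num)).const_mul (2 * (r * M))
    simpa [div_eq_mul_inv] using this
  have hunif : TendstoUniformlyOn (fun n (p : ℝ × ℂ) => W n p.1 p.2) (fun p => w p.1 p.2) atTop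
      (S ×ˢ ball 0 r) := by
    rw [Metric.tendstoUniformlyOn_iff]
    intro ε hε
    filter_upwards [h0.eventually (gt_mem_nhds hε)] with n hn p hp
    rw [dist_comm, dist_eq_norm]
    exact (hle n _ hp.1 _ hp.2).trans_lt hn
  have hw := Admissible.of_tendstoUniformlyOn hW hunif
  refine ⟨w, hw, fun z hz x hx => ?_⟩
  have h1 : Tendsto (fun n => W (n + 1) z x) atTop (𝓝 (w z x)) :=
    (hl (z, x) ⟨hz, hx⟩).comp (tendsto_add_atTop_nat 1)
  have h2 : Tendsto (fun n => W (n + 1) z x) atTop (𝓝 (step μ g w z x)) := by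
    rw [tendsto_iff_norm_sub_tendsto_zero]
    refine squeeze_zero (fun _ => norm_nonneg _) (fun n => ?_) (by simpa using h0.div_const 2)
    rw [hWs]
    exact (hW n).norm_step_sub_le hD hw (by positivity) (hle n) z hz x hx
  exact tendsto_nhds_unique h2 h1

/-- Real form of the solution. -/
theorem Data.exists_real_solution (hD : Data S r ρ M L μ g) (gR : ℝ → ℝ → (ι → ℝ) → ι → ℝ)
    (hgR : ∀ z ∈ S, ∀ x : ℝ, |x| < r → ∀ v : ι → ℝ, ‖v‖ < ρ → ∀ i,
      g z x (fun j => (v j : ℂ)) i = gR z x v i) :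
    ∃ v : ℝ → ℝ → ι → ℝ,
      ContinuousOn (fun p : ℝ × ℝ => v p.1 p.2) (S ×ˢ Ioo (-r) r) ∧
      ∀ z ∈ S, v z 0 = 0 ∧ AnalyticOnNhd ℝ (v z) (Ioo (-r) r) ∧
        ∀ x ∈ Ioo (-r) r, ‖v z x‖ < ρ ∧ ‖v z x‖ ≤ |x| * M ∧ ∀ i, ∃ d,
          HasDerivAt (fun y => v z y i) d x ∧
          x * d + μ z i * v z x i = x * gR z x (v z x) i := by
  obtain ⟨w, hw, hfix⟩ := hD.exists_fixedPoint
  have hball : ∀ x : ℝ, x ∈ Ioo (-r) r ↔ (x : ℂ) ∈ ball (0 : ℂ) r := fun x => by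
    rw [mem_ball_zero_iff, Complex.norm_real, Real.norm_eq_abs, abs_lt, mem_Ioo]
  let v : ℝ → ℝ → ι → ℝ := fun z x i => (w z x i).re
  have hvw : ∀ z ∈ S, ∀ x ∈ Ioo (-r) r, w z x = fun j => (v z x j : ℂ) := by
    intro z hz x hx
    funext j
    apply Complex.ext
    · simp [v]
    · simpa using hw.real z hz x ((hball x).1 hx) j
  have hnorm : ∀ z ∈ S, ∀ x ∈ Ioo (-r) r, ‖v z x‖ ≤ ‖w z x‖ := by
    intro z hz x hx
    refine (pi_norm_le_iff_of_nonneg (norm_nonneg _)).2 fun i => ?_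
    exact (Complex.abs_re_le_norm _).trans (norm_le_pi_norm (w z x) i)
  have hvlt : ∀ z ∈ S, ∀ x ∈ Ioo (-r) r, ‖v z x‖ < ρ := fun z hz x hx =>
    (hnorm z hz x hx).trans_lt (mem_ball_zero_iff.1 (hw.mem_ball hD hz ((hball x).1 hx)))
  refine ⟨v, ?_, fun z hz => ⟨?_, ?_, fun x hx => ⟨hvlt z hz x hx, ?_, fun i => ?_⟩⟩⟩
  · refine continuousOn_pi.2 fun i => Complex.continuous_re.comp_continuousOn ?_
    refine (continuousOn_pi.1 hw.cont i).comp (f := fun p : ℝ × ℝ => (p.1, (p.2 : ℂ)))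
      (by fun_prop) fun p hp => ⟨hp.1, (hball _).1 hp.2⟩
  · have h0 : w z ((0 : ℝ) : ℂ) = 0 := by
      have := hw.bound z hz 0 (mem_ball_self hD.r_pos)
      simpa using this
    funext i
    simpa [v] using congrArg Complex.re (congrFun h0 i)
  · intro x hx
    have h1 : AnalyticAt ℂ (w z) (x : ℂ) :=
      ((hw.diff z hz).analyticOnNhd isOpen_ball) _ ((hball x).1 hx)
    refine AnalyticAt.pi fun i => ?_
    have h2 : AnalyticAt ℂ (fun y => w z y i) (x : ℂ) := analyticAt_pi_iff.1 h1 i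
    exact h2.re_ofReal
  · refine (hnorm z hz x hx).trans ?_
    simpa using hw.bound z hz x ((hball x).1 hx)
  · obtain ⟨d, hd, hd'⟩ := eulerIntegral.exists_hasDerivAt (hD.exponent_nonneg z hz i)
      (differentiableOn_pi.1 (hw.differentiableOn_comp hD hz) i) ((hball x).1 hx)
    have heq : (fun y => w z y i) =ᶠ[𝓝 (x : ℂ)]
        eulerIntegral (μ z i) (fun y => g z y (w z y) i) := by
      filter_upwards [isOpen_ball.mem_nhds ((hball x).1 hx)] with y hy
      exact (congrFun (hfix z hz y hy) i).symm
    refine ⟨d.re, (hd.congr_of_eventuallyEq heq).real_of_complex, ?_⟩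
    have e : eulerIntegral (μ z i) (fun y => g z y (w z y) i) x = w z x i :=
      congrFun (hfix z hz x ((hball x).1 hx)) i
    rw [e, hvw z hz x hx, hgR z hz x (abs_lt.2 hx) _ (hvlt z hz x hx) i] at hd'
    have := congrArg Complex.re hd'
    simpa using this

end BriotBouquet

/-! ### Existence with uniform radius, and uniqueness among bounded solutions. -/

namespace BriotBouquet

open Set Metric

/-- A singular system `x w' + μ w = x g(z, x, w)` with holomorphic right-hand side has an analytic
solution with `w(0) = 0` on an interval that does not depend on the parameter `z`, and this solution
depends continuously on the parameter. -/
theorem exists_analytic_solution {ι : Type*} [Fintype ι] {c d R ρ : ℝ} (hR : 0 < R) (hρ : 0 < ρ)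
    (μ : ℝ → ι → ℝ) (hμ : ∀ z ∈ Icc c d, ∀ i, 0 ≤ μ z i)
    (hμc : ∀ i, ContinuousOn (fun z => μ z i) (Icc c d))
    (G : ℂ → ℂ → (ι → ℂ) → ι → ℂ) (gR : ℝ → ℝ → (ι → ℝ) → ι → ℝ)
    (hG : ∀ z ∈ Icc c d, ∀ x ∈ closedBall (0 : ℂ) R, ∀ w ∈ closedBall (0 : ι → ℂ) ρ,
      ContDiffAt ℂ 1 (fun p : ℂ × ℂ × (ι → ℂ) => G p.1 p.2.1 p.2.2) ((z : ℂ), x, w))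
    (hgR : ∀ z ∈ Icc c d, ∀ x : ℝ, |x| ≤ R → ∀ v : ι → ℝ, ‖v‖ ≤ ρ → ∀ i,
      G z x (fun j => (v j : ℂ)) i = gR z x v i) :
    ∃ r M L : ℝ, 0 < r ∧ r ≤ R ∧ 0 ≤ L ∧ r * L ≤ 1 / 2 ∧
      (∀ z ∈ Icc c d, ∀ x : ℝ, |x| ≤ R → ∀ v : ι → ℝ, ‖v‖ ≤ ρ → ∀ v' : ι → ℝ, ‖v'‖ ≤ ρ →
        ∀ i, |gR z x v i| ≤ M ∧ |gR z x v i - gR z x v' i| ≤ L * ‖v - v'‖) ∧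
      ∃ v : ℝ → ℝ → ι → ℝ,
        ContinuousOn (fun p : ℝ × ℝ => v p.1 p.2) (Icc c d ×ˢ Ioo (-r) r) ∧
        ∀ z ∈ Icc c d, v z 0 = 0 ∧ AnalyticOnNhd ℝ (v z) (Ioo (-r) r) ∧
          ∀ x ∈ Ioo (-r) r, ‖v z x‖ < ρ ∧ ‖v z x‖ ≤ |x| * M ∧ ∀ i, ∃ d,
            HasDerivAt (fun y => v z y i) d x ∧
            x * d + μ z i * v z x i = x * gR z x (v z x) i := by
  let K : Set (ℝ × ℂ × (ι → ℂ)) := Icc c d ×ˢ closedBall (0 : ℂ) R ×ˢ closedBall (0 : ι → ℂ) ρ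
  let g : ℝ → ℂ → (ι → ℂ) → ι → ℂ := fun z x w => G z x w
  let gg : ℝ × ℂ × (ι → ℂ) → ι → ℂ := fun p => G p.1 p.2.1 p.2.2
  have hKc : IsCompact K :=
    isCompact_Icc.prod ((isCompact_closedBall _ _).prod (isCompact_closedBall _ _))
  have hKv : Convex ℝ K := (convex_Icc _ _).prod ((convex_closedBall _ _).prod
    (convex_closedBall _ _))
  have hgg : ContDiffOn ℝ 1 gg K := by
    rintro ⟨z, x, w⟩ ⟨hz, hx, hw⟩
    have h1 := (hG z hz x hx w hw).restrict_scalars ℝ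
    have h2 : ContDiffAt ℝ 1 (fun p : ℝ × ℂ × (ι → ℂ) => ((p.1 : ℂ), p.2)) (z, x, w) :=
      (Complex.ofRealCLM.contDiff.comp contDiff_fst).prodMk contDiff_snd |>.contDiffAt
    exact (ContDiffAt.comp (z, x, w) (f := fun p : ℝ × ℂ × (ι → ℂ) => ((p.1 : ℂ), p.2)) h1
      h2).contDiffWithinAt
  -- Compactness of the closed box gives one bound and, with convexity, one Lipschitz constant for
  -- all parameters at once, hence a radius independent of `z`.
  obtain ⟨M, hM⟩ := hKc.exists_bound_of_continuousOn hgg.continuousOn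
  obtain ⟨L, hL⟩ := hgg.exists_lipschitzOnWith one_ne_zero hKv hKc
  have hlip : ∀ z ∈ Icc c d, ∀ x ∈ closedBall (0 : ℂ) R, ∀ w ∈ closedBall (0 : ι → ℂ) ρ,
      ∀ w' ∈ closedBall (0 : ι → ℂ) ρ, ‖g z x w - g z x w'‖ ≤ L * ‖w - w'‖ := by
    intro z hz x hx w hw w' hw'
    have := hL.dist_le_mul (z, x, w) ⟨hz, hx, hw⟩ (z, x, w') ⟨hz, hx, hw'⟩
    simpa [gg, g, dist_eq_norm, Prod.dist_eq] using this
  have hMx : 0 ≤ max M 0 := le_max_right _ _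
  have hMb : ∀ z ∈ Icc c d, ∀ x ∈ closedBall (0 : ℂ) R, ∀ w ∈ closedBall (0 : ι → ℂ) ρ,
      ‖G z x w‖ ≤ max M 0 := fun z hz x hx w hw =>
    (hM (z, x, w) ⟨hz, hx, hw⟩).trans (le_max_left _ _)
  set r := min R (min (ρ / (2 * (max M 0 + 1))) (1 / (2 * (L + 1)))) with hr
  have hr0 : 0 < r := by
    refine lt_min hR (lt_min ?_ ?_) <;> positivity
  have hrR : r ≤ R := min_le_left _ _
  have hrM : r * max M 0 < ρ := by
    have h1 : r ≤ ρ / (2 * (max M 0 + 1)) := (min_le_right _ _).trans (min_le_left _ _)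
    rw [le_div_iff₀ (by positivity)] at h1
    nlinarith
  have hrL : r * (L : ℝ) ≤ 1 / 2 := by
    have h1 : r ≤ 1 / (2 * ((L : ℝ) + 1)) := (min_le_right _ _).trans (min_le_right _ _)
    rw [le_div_iff₀ (by positivity)] at h1
    nlinarith
  have hxR : ∀ x ∈ ball (0 : ℂ) r, x ∈ closedBall (0 : ℂ) R := fun x hx =>
    closedBall_subset_closedBall hrR (ball_subset_closedBall hx)
  have hxr : ∀ x : ℝ, |x| ≤ R → (x : ℂ) ∈ closedBall (0 : ℂ) R := fun x hx => by
    rw [mem_closedBall_zero_iff, Complex.norm_real]; exact hx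
  have hofReal : ∀ v : ι → ℝ, ‖(fun j => (v j : ℂ))‖ = ‖v‖ := fun v => by
    simp [Pi.norm_def]
  have hvρ : ∀ v : ι → ℝ, ‖v‖ ≤ ρ → (fun j => (v j : ℂ)) ∈ closedBall (0 : ι → ℂ) ρ :=
    fun v hv => by rw [mem_closedBall_zero_iff, hofReal]; exact hv
  have hD : Data (Icc c d) r ρ (max M 0) L μ g :=
    { r_pos := hr0
      M_nonneg := hMx
      L_nonneg := L.2
      rM := hrM
      rL := hrL
      exponent_nonneg := hμ
      exponent_cont := hμc
      cont := hgg.continuousOn.mono (prod_mono le_rfl (prod_mono hxR ball_subset_closedBall))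
      diff := fun z hz p hp => by
        have h1 := (hG z hz p.1 (hxR _ hp.1) p.2 (ball_subset_closedBall hp.2)).differentiableAt
          one_ne_zero
        have h2 : DifferentiableAt ℂ (fun p : ℂ × (ι → ℂ) => ((z : ℂ), p)) p := by fun_prop
        exact (DifferentiableAt.comp p (f := fun p : ℂ × (ι → ℂ) => ((z : ℂ), p)) h1
          h2).differentiableWithinAt
      bound := fun z hz x hx w hw =>
        hMb z hz x (hxR x hx) w (ball_subset_closedBall hw)
      lip := fun z hz x hx w hw w' hw' => hlip z hz x (hxR x hx) w (ball_subset_closedBall hw) w'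
        (ball_subset_closedBall hw')
      real := fun z hz x hx w hw hwr i => by
        have hw' : w = fun j => ((w j).re : ℂ) := by
          funext j
          apply Complex.ext <;> simp [hwr j]
        have hx' := mem_closedBall_zero_iff.1 (hxR x hx)
        rw [Complex.norm_real, Real.norm_eq_abs] at hx'
        have hn := hofReal (fun j => (w j).re)
        rw [← hw'] at hn
        rw [hw']
        have := hgR z hz x hx' (fun j => (w j).re)
          (hn ▸ (mem_ball_zero_iff.1 hw).le) i
        change (G z x _ i).im = 0
        rw [this, Complex.ofReal_im] }
  obtain ⟨v, hv, hv'⟩ := hD.exists_real_solution gR fun z hz x hx v hv i =>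
    hgR z hz x (hx.le.trans hrR) v hv.le i
  refine ⟨r, max M 0, L, hr0, hrR, L.2, hrL, ?_, v, hv, hv'⟩
  intro z hz x hx v hv v' hv' i
  have e := hgR z hz x hx v hv i
  have e' := hgR z hz x hx v' hv' i
  constructor
  · rw [← Real.norm_eq_abs, ← Complex.norm_real, ← e]
    exact (norm_le_pi_norm (G z x (fun j => (v j : ℂ))) i).trans
      (hMb z hz x (hxr x hx) _ (hvρ v hv))
  · rw [← Real.norm_eq_abs, ← Complex.norm_real, Complex.ofReal_sub, ← e, ← e']
    have h1 := hlip z hz x (hxr x hx) _ (hvρ v hv) _ (hvρ v' hv')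
    have h2 : ‖G z x (fun j => (v j : ℂ)) i - G z x (fun j => (v' j : ℂ)) i‖ ≤
        ‖g z x (fun j => (v j : ℂ)) - g z x (fun j => (v' j : ℂ))‖ :=
      norm_le_pi_norm (g z x (fun j => (v j : ℂ)) - g z x (fun j => (v' j : ℂ))) i
    have h3 : (fun j => (v j : ℂ)) - (fun j => (v' j : ℂ)) = fun j => (((v - v') j : ℝ) : ℂ) := by
      funext j
      simp only [Pi.sub_apply, Complex.ofReal_sub]
    rw [h3, hofReal] at h1
    exact h2.trans h1

/-- Solutions of `x d' + μ d = x e` with `‖e‖ ≤ L ‖d‖`, bounded near `0` and vanishing there in the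
components with `μ = 0`, vanish. -/
theorem eq_zero_of_bounded {ι : Type*} [Fintype ι] {r L B : ℝ} {μ : ι → ℝ} {f : ℝ → ι → ℝ}
    {e : ℝ → ι → ℝ} (hL : 0 ≤ L) (hrL : r * L ≤ 1 / 2) (hμ : ∀ i, 0 ≤ μ i)
    (hB : ∀ x ∈ Ioo 0 r, ‖f x‖ ≤ B)
    (hf : ∀ x ∈ Ioo 0 r, ∀ i, ∃ d, HasDerivAt (fun y => f y i) d x ∧
      x * d + μ i * f x i = x * e x i)
    (he : ∀ x ∈ Ioo 0 r, ∀ i, |e x i| ≤ L * ‖f x‖)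
    (h0 : ∀ i, 0 < μ i ∨ Tendsto (fun x => f x i) (𝓝[>] 0) (𝓝 0)) :
    ∀ x ∈ Ioo 0 r, f x = 0 := by
  -- Halving: any bound `C` improves to `L C x ≤ C/2`, because `(x^μ f)' = x^μ e` with `|e| ≤ L C`
  -- integrates from `0` without a boundary term.
  have hstep : ∀ C, 0 ≤ C → (∀ x ∈ Ioo 0 r, ‖f x‖ ≤ C) → ∀ x ∈ Ioo 0 r, ‖f x‖ ≤ C / 2 := by
    intro C hC0 hC x hx
    refine (pi_norm_le_iff_of_nonneg (by positivity)).2 fun i => ?_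
    -- The boundary term vanishes because of the weight when `μ > 0`, and because of the assumed
    -- limit of `f` when `μ = 0`.
    have hlim : Tendsto (fun y : ℝ => y ^ (μ i) * f y i) (𝓝[>] 0) (𝓝 0) := by
      rcases h0 i with h | h
      · have h1 : Tendsto (fun y : ℝ => y ^ (μ i)) (𝓝[>] 0) (𝓝 0) := by
          have := (Real.continuousAt_rpow_const 0 (μ i) (Or.inr h.le)).tendsto
          rw [Real.zero_rpow h.ne'] at this
          exact this.mono_left nhdsWithin_le_nhds
        refine Tendsto.zero_mul_isBoundedUnder_le h1 ?_
        refine ⟨B, ?_⟩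
        simp only [eventually_map, Function.comp_def]
        filter_upwards [Ioo_mem_nhdsGT (hx.1.trans hx.2)] with y hy
        exact (norm_le_pi_norm _ i).trans (hB y hy)
      · have h1 : Tendsto (fun y : ℝ => y ^ (μ i)) (𝓝[>] 0) (𝓝 ((0 : ℝ) ^ (μ i))) :=
          (Real.continuousAt_rpow_const 0 (μ i) (Or.inr (hμ i))).tendsto.mono_left
            nhdsWithin_le_nhds
        simpa using h1.mul h
    have hlim2 : Tendsto (fun y : ℝ => L * C * y ^ (μ i + 1)) (𝓝[>] 0) (𝓝 0) := by
      have := (Real.continuousAt_rpow_const 0 (μ i + 1)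
        (Or.inr (by linarith [hμ i]))).tendsto.const_mul (L * C)
      rw [Real.zero_rpow (by linarith [hμ i])] at this
      simpa using this.mono_left nhdsWithin_le_nhds
    -- The integration is done by monotonicity of `±x^μ f + L C x^(μ+1)`; the two signs together
    -- bound `|f|`.
    have hmono : ∀ σ : ℝ, (σ = 1 ∨ σ = -1) →
        0 ≤ σ * (x ^ (μ i) * f x i) + L * C * x ^ (μ i + 1) := by
      intro σ hσ
      have hder : ∀ y ∈ Ioo 0 r, ∃ d, 0 ≤ d ∧ HasDerivAt
          (fun y => σ * (y ^ (μ i) * f y i) + L * C * y ^ (μ i + 1)) d y := by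
        intro y hy
        obtain ⟨d, hd, hde⟩ := hf y hy i
        have hp := (Real.hasDerivAt_rpow_const (x := y) (p := μ i) (Or.inl hy.1.ne'))
        have hp1 := (Real.hasDerivAt_rpow_const (x := y) (p := μ i + 1) (Or.inl hy.1.ne'))
        refine ⟨_, ?_, ((hp.mul hd).const_mul σ).add (hp1.const_mul (L * C))⟩
        have hy0 : 0 < y ^ (μ i) := Real.rpow_pos_of_pos hy.1 _
        have e1 : μ i * y ^ (μ i - 1) * f y i + y ^ (μ i) * d = y ^ (μ i) * e y i := by
          have hA : y ^ (μ i) = y ^ (μ i - 1) * y := by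
            rw [Real.rpow_sub_one hy.1.ne', div_mul_cancel₀ _ hy.1.ne']
          rw [hA]
          linear_combination y ^ (μ i - 1) * hde
        have e2 : (μ i + 1) * y ^ (μ i + 1 - 1) = (μ i + 1) * y ^ (μ i) := by ring_nf
        rw [e1, e2]
        have h3 := (he y hy i).trans (mul_le_mul_of_nonneg_left (hC y hy) hL)
        have h4 : 0 ≤ σ * e y i + L * C := by
          rcases hσ with rfl | rfl <;> linarith [abs_le.1 h3]
        have h5 : 0 ≤ L * C * μ i := mul_nonneg (mul_nonneg hL hC0) (hμ i)
        nlinarith [mul_nonneg hy0.le h4, mul_nonneg hy0.le h5]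
      have hm : MonotoneOn (fun y => σ * (y ^ (μ i) * f y i) + L * C * y ^ (μ i + 1))
          (Ioo 0 r) := by
        apply monotoneOn_of_deriv_nonneg (convex_Ioo _ _)
        · intro y hy
          obtain ⟨d, -, hd⟩ := hder y hy
          exact hd.continuousAt.continuousWithinAt
        · intro y hy
          rw [interior_Ioo] at hy
          obtain ⟨d, -, hd⟩ := hder y hy
          exact hd.differentiableAt.differentiableWithinAt
        · intro y hy
          rw [interior_Ioo] at hy
          obtain ⟨d, hd0, hd⟩ := hder y hy
          rw [hd.deriv]
          exact hd0
      have hl : Tendsto (fun y => σ * (y ^ (μ i) * f y i) + L * C * y ^ (μ i + 1)) (𝓝[>] 0)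
          (𝓝 0) := by simpa using (hlim.const_mul σ).add hlim2
      refine le_of_tendsto hl ?_
      filter_upwards [Ioo_mem_nhdsGT hx.1] with y hy
      exact hm ⟨hy.1, hy.2.trans hx.2⟩ hx hy.2.le
    have hx0 : 0 < x ^ (μ i) := Real.rpow_pos_of_pos hx.1 _
    have hx1 : x ^ (μ i + 1) = x ^ (μ i) * x := by rw [Real.rpow_add_one hx.1.ne']
    have h1 := hmono 1 (Or.inl rfl)
    have h2 := hmono (-1) (Or.inr rfl)
    rw [hx1] at h1 h2
    have h3 : 0 ≤ f x i + L * C * x := by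
      refine nonneg_of_mul_nonneg_right (a := x ^ μ i) ?_ hx0
      linarith
    have h4 : 0 ≤ -f x i + L * C * x := by
      refine nonneg_of_mul_nonneg_right (a := x ^ μ i) ?_ hx0
      linarith
    have h5 : L * C * x ≤ C / 2 := by
      have : x * L ≤ r * L := mul_le_mul_of_nonneg_right hx.2.le hL
      nlinarith
    rw [Real.norm_eq_abs, abs_le]
    constructor <;> linarith
  intro x hx
  have hB0 : 0 ≤ B := (norm_nonneg _).trans (hB x hx)
  have hn : ∀ n : ℕ, ∀ x ∈ Ioo 0 r, ‖f x‖ ≤ B / 2 ^ n := by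
    intro n
    induction n with
    | zero => simpa using hB
    | succ n ih =>
      have := hstep _ (by positivity) ih
      rwa [div_div, ← pow_succ] at this
  have hlim : Tendsto (fun n : ℕ => B / 2 ^ n) atTop (𝓝 0) := by
    have := (tendsto_pow_atTop_nhds_zero_of_lt_one (r := (1 / 2 : ℝ)) (by norm_num)
      (by norm_num)).const_mul B
    simpa [div_eq_mul_inv] using this
  exact norm_le_zero_iff.1 (ge_of_tendsto' hlim fun n => hn n x hx)

end BriotBouquet

/-! ### Tools for ordinary differential equations: barriers, truncated flows, analyticity. -/

section ShootingArgument

open Set Metric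

/-- Finitely many functions that start positive stay positive if each of them has positive
derivative whenever it vanishes while all are nonnegative. -/
theorem forall_pos_of_barrier {ι : Type*} [Finite ι] {g : ι → ℝ → ℝ} {t₀ t₁ : ℝ}
    (hc : ∀ i, ContinuousOn (g i) (Icc t₀ t₁)) (h0 : ∀ i, 0 < g i t₀)
    (hd : ∀ t ∈ Ioc t₀ t₁, (∀ j, 0 ≤ g j t) → ∀ i, g i t = 0 → ∃ d, 0 < d ∧ HasDerivAt (g i) d t) :
    ∀ t ∈ Icc t₀ t₁, ∀ i, 0 < g i t := by
  by_contra! hcon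
  obtain ⟨t, ht, i, hi⟩ := hcon
  let A : Set ℝ := ⋃ i, {t ∈ Icc t₀ t₁ | g i t ≤ 0}
  have hA : IsCompact A := by
    refine isCompact_iUnion fun i => ?_
    exact isCompact_Icc.of_isClosed_subset
      ((hc i).preimage_isClosed_of_isClosed isClosed_Icc isClosed_Iic) fun x hx => hx.1
  -- At the first time `m` when some function is nonpositive, all are nonnegative and one vanishes;
  -- its positive derivative would make it negative just before `m`.
  obtain ⟨m, hmA, hm⟩ := hA.exists_isLeast ⟨t, mem_iUnion.2 ⟨i, ht, hi⟩⟩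
  obtain ⟨k, hmI, hk⟩ := mem_iUnion.1 hmA
  have hm0 : t₀ < m := by
    refine lt_of_le_of_ne hmI.1 fun h => ?_
    rw [← h] at hk
    exact absurd (h0 k) (not_lt.2 hk)
  have hpos : ∀ s ∈ Ico t₀ m, ∀ j, 0 < g j s := by
    intro s hs j
    by_contra! hj
    exact absurd (hm (mem_iUnion.2 ⟨j, ⟨hs.1, hs.2.le.trans hmI.2⟩, hj⟩)) (not_le.2 hs.2)
  have hnn : ∀ j, 0 ≤ g j m := by
    intro j
    have h1 : Tendsto (g j) (𝓝[Ico t₀ m] m) (𝓝 (g j m)) :=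
      (hc j m hmI).mono fun s hs => ⟨hs.1, hs.2.le.trans hmI.2⟩
    have : (𝓝[Ico t₀ m] m).NeBot := by
      rw [← mem_closure_iff_nhdsWithin_neBot, closure_Ico hm0.ne]
      exact ⟨hm0.le, le_rfl⟩
    exact ge_of_tendsto h1 (by
      filter_upwards [self_mem_nhdsWithin] with s hs using (hpos s hs j).le)
  have hk0 : g k m = 0 := le_antisymm hk (hnn k)
  obtain ⟨d, hd0, hd⟩ := hd m ⟨hm0, hmI.2⟩ hnn k hk0
  have hs := (hasDerivAt_iff_tendsto_slope.1 hd).mono_left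
    (nhdsWithin_mono m (fun x (hx : x < m) => ne_of_lt hx) : 𝓝[<] m ≤ 𝓝[≠] m)
  obtain ⟨s, hs1, hs2⟩ := ((hs.eventually (lt_mem_nhds hd0)).and (Ioo_mem_nhdsLT hm0)).exists
  have h1 := hpos s ⟨hs2.1.le, hs2.2⟩ k
  rw [slope_def_field, hk0, sub_zero] at hs1
  have h2 : g k s / (s - m) ≤ 0 :=
    div_nonpos_of_nonneg_of_nonpos h1.le (by linarith [hs2.2])
  linarith

/-- A bounded, globally Lipschitz vector field has a global flow, continuous in the initial value. -/
theorem exists_global_flow {E : Type*} [NormedAddCommGroup E] [NormedSpace ℝ E] [CompleteSpace E]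
    {F : ℝ → E → E} {K M : NNReal} (hK : ∀ t, LipschitzWith K (F t)) (hM : ∀ t x, ‖F t x‖ ≤ M)
    (hc : ∀ x, Continuous fun t => F t x) (t₀ : ℝ) :
    ∃ Φ : E → ℝ → E, (∀ x, Φ x t₀ = x) ∧ (∀ x t, HasDerivAt (Φ x) (F t (Φ x t)) t) ∧
      ∀ t, t₀ ≤ t → Continuous fun x => Φ x t := by
  have hex : ∀ x : E, ∃ α : ℝ → E, α t₀ = x ∧ ∀ t, HasDerivAt α (F t (α t)) t := by
    intro x
    have hn : ∀ n : ℕ, ∃ α : ℝ → E, α t₀ = x ∧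
        ∀ t ∈ Ioo (t₀ - (n + 1)) (t₀ + (n + 1)), HasDerivAt α (F t (α t)) t := by
      intro n
      -- A field bounded by `M` cannot leave the ball of radius `M(n + 1)` within time `n + 1`, so
      -- Picard-Lindelöf applies on each such interval; uniqueness lets the pieces be glued.
      have hmem : t₀ ∈ Icc (t₀ - ((n : ℝ) + 1)) (t₀ + (n + 1)) := by
        constructor <;> linarith [(Nat.cast_nonneg n : (0 : ℝ) ≤ n)]
      have hPL : IsPicardLindelof F (⟨t₀, hmem⟩ : Icc (t₀ - ((n : ℝ) + 1)) (t₀ + (n + 1))) x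
          (M * (n + 1)) 0 M K :=
        { lipschitzOnWith := fun t _ => (hK t).lipschitzOnWith
          continuousOn := fun y _ => (hc y).continuousOn
          norm_le := fun t _ y _ => hM t y
          mul_max_le := by simp }
      obtain ⟨α, hα0, hα⟩ := hPL.exists_eq_forall_mem_Icc_hasDerivWithinAt₀
      exact ⟨α, hα0, fun t ht => (hα t (Ioo_subset_Icc_self ht)).hasDerivAt
        (Icc_mem_nhds ht.1 ht.2)⟩
    choose α hα0 hα using hn
    have hagree : ∀ n m : ℕ, n ≤ m → EqOn (α n) (α m) (Ioo (t₀ - (n + 1)) (t₀ + (n + 1))) := by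
      intro n m hnm
      have hnm' : (n : ℝ) ≤ m := by exact_mod_cast hnm
      refine ODE_solution_unique_of_mem_Ioo (v := F) (K := K) (s := fun _ => univ) (t₀ := t₀)
        (fun t _ => (hK t).lipschitzOnWith) ?_ (fun t ht => ⟨hα n t ht, trivial⟩)
        (fun t ht => ⟨hα m t ⟨?_, ?_⟩, trivial⟩) ?_
      · constructor <;> linarith [(Nat.cast_nonneg n : (0 : ℝ) ≤ n)]
      · linarith [ht.1]
      · linarith [ht.2]
      · rw [hα0, hα0]
    let β : ℝ → E := fun t => α ⌈|t - t₀|⌉₊ t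
    have hβ : ∀ n : ℕ, EqOn β (α n) (Ioo (t₀ - (n + 1)) (t₀ + (n + 1))) := by
      intro n t ht
      rcases le_total ⌈|t - t₀|⌉₊ n with h | h
      · refine hagree _ n h ?_
        have := Nat.le_ceil |t - t₀|
        rw [abs_le] at this
        constructor <;> linarith
      · exact (hagree n _ h ht).symm
    refine ⟨β, ?_, fun t => ?_⟩
    · simp [β, hα0]
    · have ht : t ∈ Ioo (t₀ - ((⌈|t - t₀|⌉₊ : ℝ) + 1)) (t₀ + (⌈|t - t₀|⌉₊ + 1)) := by
        have := Nat.le_ceil |t - t₀|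
        rw [abs_le] at this
        constructor <;> linarith
      rw [hβ _ ht]
      refine (hα _ t ht).congr_of_eventuallyEq ?_
      filter_upwards [isOpen_Ioo.mem_nhds ht] with s hs using hβ _ hs
  choose Φ hΦ0 hΦ using hex
  refine ⟨Φ, hΦ0, hΦ, fun t ht => ?_⟩
  -- Grönwall's inequality gives dependence on the initial value that is Lipschitz at each fixed
  -- later time.
  have hlip : ∀ x y, dist (Φ x t) (Φ y t) ≤ Real.exp (K * (t - t₀)) * dist x y := by
    intro x y
    have := dist_le_of_trajectories_ODE (v := F) (K := K) (f := Φ x) (g := Φ y) (a := t₀) (b := t)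
      (δ := dist x y) hK (fun s _ => (hΦ x s).continuousAt.continuousWithinAt)
      (fun s _ => (hΦ x s).hasDerivWithinAt)
      (fun s _ => (hΦ y s).continuousAt.continuousWithinAt)
      (fun s _ => (hΦ y s).hasDerivWithinAt) (by rw [hΦ0, hΦ0]) t ⟨ht, le_rfl⟩
    linarith
  exact (LipschitzWith.of_dist_le_mul (K := ⟨Real.exp (K * (t - t₀)), (Real.exp_pos _).le⟩)
    hlip).continuous

/-- Truncation of a real number to the interval `[l, u]`. -/
noncomputable def clamp (l u x : ℝ) : ℝ := max l (min u x)

theorem clamp_mem {l u : ℝ} (h : l ≤ u) (x : ℝ) : clamp l u x ∈ Icc l u :=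
  ⟨le_max_left _ _, max_le h (min_le_left _ _)⟩

theorem clamp_of_mem {l u x : ℝ} (h : x ∈ Icc l u) : clamp l u x = x := by
  rw [clamp, min_eq_right h.2, max_eq_right h.1]

theorem lipschitzWith_clamp (l u : ℝ) : LipschitzWith 1 (clamp l u) := by
  have : LipschitzWith 1 fun x : ℝ => max l (min u x) :=
    (LipschitzWith.id.const_min u).const_max l
  exact this

/-- A planar vector field that is `C¹` on a box has a global flow after truncation to the box. -/
theorem exists_clamped_flow {q₀ q₁ a₀ a₁ b₀ b₁ : ℝ} (hq : q₀ ≤ q₁) (ha : a₀ ≤ a₁) (hb : b₀ ≤ b₁)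
    {f₁ f₂ : ℝ → ℝ → ℝ → ℝ} {κ : ℝ → ℝ} (hκ : Continuous κ)
    (h₁ : ContDiffOn ℝ 1 (fun p : ℝ × ℝ × ℝ => f₁ p.1 p.2.1 p.2.2)
      (Icc q₀ q₁ ×ˢ Icc a₀ a₁ ×ˢ Icc b₀ b₁))
    (h₂ : ContDiffOn ℝ 1 (fun p : ℝ × ℝ × ℝ => f₂ p.1 p.2.1 p.2.2)
      (Icc q₀ q₁ ×ˢ Icc a₀ a₁ ×ˢ Icc b₀ b₁)) (t₀ : ℝ) :
    ∃ A B : ℝ × ℝ → ℝ → ℝ, (∀ u, A u t₀ = u.1 ∧ B u t₀ = u.2) ∧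
      (∀ u t, HasDerivAt (A u)
        (f₁ (clamp q₀ q₁ (κ t)) (clamp a₀ a₁ (A u t)) (clamp b₀ b₁ (B u t))) t) ∧
      (∀ u t, HasDerivAt (B u)
        (f₂ (clamp q₀ q₁ (κ t)) (clamp a₀ a₁ (A u t)) (clamp b₀ b₁ (B u t))) t) ∧
      ∀ t, t₀ ≤ t → Continuous (fun u => A u t) ∧ Continuous fun u => B u t := by
  set K : Set (ℝ × ℝ × ℝ) := Icc q₀ q₁ ×ˢ Icc a₀ a₁ ×ˢ Icc b₀ b₁ with hKdef
  have hKc : IsCompact K := isCompact_Icc.prod (isCompact_Icc.prod isCompact_Icc)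
  have hKv : Convex ℝ K := (convex_Icc _ _).prod ((convex_Icc _ _).prod (convex_Icc _ _))
  have hf : ContDiffOn ℝ 1 (fun p : ℝ × ℝ × ℝ => (f₁ p.1 p.2.1 p.2.2, f₂ p.1 p.2.1 p.2.2)) K :=
    h₁.prodMk h₂
  obtain ⟨L, hL⟩ := hf.exists_lipschitzOnWith one_ne_zero hKv hKc
  obtain ⟨M, hM⟩ := hKc.exists_bound_of_continuousOn hf.continuousOn
  let c : ℝ → ℝ × ℝ → ℝ × ℝ × ℝ := fun t u =>
    (clamp q₀ q₁ (κ t), clamp a₀ a₁ u.1, clamp b₀ b₁ u.2)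
  have hcK : ∀ t u, c t u ∈ K := fun t u => ⟨clamp_mem hq _, clamp_mem ha _, clamp_mem hb _⟩
  let F : ℝ → ℝ × ℝ → ℝ × ℝ := fun t u => (f₁ (c t u).1 (c t u).2.1 (c t u).2.2,
    f₂ (c t u).1 (c t u).2.1 (c t u).2.2)
  have hclip : ∀ t, LipschitzWith 1 (c t) := by
    intro t
    refine LipschitzWith.of_dist_le_mul fun u v => ?_
    have e1 := (lipschitzWith_clamp a₀ a₁).dist_le_mul u.1 v.1
    have e2 := (lipschitzWith_clamp b₀ b₁).dist_le_mul u.2 v.2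
    simp only [NNReal.coe_one, one_mul] at e1 e2 ⊢
    simp only [c, Prod.dist_eq, dist_self]
    exact max_le (le_max_of_le_left dist_nonneg) (max_le_max e1 e2)
  have hFK : ∀ t, LipschitzWith L (F t) := by
    intro t
    have := hL.comp ((hclip t).lipschitzOnWith (s := univ)) fun u _ => hcK t u
    rw [mul_one] at this
    exact lipschitzOnWith_univ.1 this
  have hFM : ∀ t u, ‖F t u‖ ≤ M.toNNReal := fun t u =>
    (hM _ (hcK t u)).trans (Real.le_coe_toNNReal M)
  have hFc : ∀ u, Continuous fun t => F t u := by
    intro u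
    have h1 : Continuous fun t => c t u :=
      ((lipschitzWith_clamp q₀ q₁).continuous.comp hκ).prodMk continuous_const
    exact hf.continuousOn.comp_continuous h1 fun t => hcK t u
  obtain ⟨Φ, h0, hd, hcont⟩ := exists_global_flow hFK hFM hFc t₀
  refine ⟨fun u t => (Φ u t).1, fun u t => (Φ u t).2, fun u => by simp [h0], fun u t => ?_,
    fun u t => ?_, fun t ht => ⟨continuous_fst.comp (hcont t ht), continuous_snd.comp (hcont t ht)⟩⟩
  · exact (hasFDerivAt_fst (p := Φ u t)).comp_hasDerivAt t (hd u t)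
  · exact (hasFDerivAt_snd (p := Φ u t)).comp_hasDerivAt t (hd u t)

/-- Solutions of a planar system with holomorphic right-hand side are analytic. -/
theorem analyticAt_of_planar_ode {F₁ F₂ : ℂ → ℂ → ℂ → ℂ} {f₁ f₂ : ℝ → ℝ → ℝ → ℝ} {a b : ℝ → ℝ}
    {x₀ : ℝ}
    (h₁ : ContDiffAt ℂ 1 (fun p : ℂ × ℂ × ℂ => F₁ p.1 p.2.1 p.2.2)
      ((x₀ : ℂ), (a x₀ : ℂ), (b x₀ : ℂ)))
    (h₂ : ContDiffAt ℂ 1 (fun p : ℂ × ℂ × ℂ => F₂ p.1 p.2.1 p.2.2)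
      ((x₀ : ℂ), (a x₀ : ℂ), (b x₀ : ℂ)))
    (e₁ : ∀ x u v : ℝ, F₁ x u v = f₁ x u v) (e₂ : ∀ x u v : ℝ, F₂ x u v = f₂ x u v)
    (ha : ∀ᶠ x in 𝓝 x₀, HasDerivAt a (f₁ x (a x) (b x)) x)
    (hb : ∀ᶠ x in 𝓝 x₀, HasDerivAt b (f₂ x (a x) (b x)) x) :
    AnalyticAt ℝ a x₀ ∧ AnalyticAt ℝ b x₀ := by
  let G : ℂ → ℂ → (Fin 2 → ℂ) → Fin 2 → ℂ := fun _ x w =>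
    ![F₁ (x₀ + x) (a x₀ + w 0) (b x₀ + w 1), F₂ (x₀ + x) (a x₀ + w 0) (b x₀ + w 1)]
  let gR : ℝ → ℝ → (Fin 2 → ℝ) → Fin 2 → ℝ := fun _ x w =>
    ![f₁ (x₀ + x) (a x₀ + w 0) (b x₀ + w 1), f₂ (x₀ + x) (a x₀ + w 0) (b x₀ + w 1)]
  let sh : ℂ × (Fin 2 → ℂ) → ℂ × ℂ × ℂ := fun p => (x₀ + p.1, a x₀ + p.2 0, b x₀ + p.2 1)
  have hsh : ContDiff ℂ 1 sh := by
    have c0 : ContDiff ℂ 1 fun p : ℂ × (Fin 2 → ℂ) => p.2 0 :=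
      (contDiff_apply ℂ ℂ (0 : Fin 2)).comp contDiff_snd
    have c1 : ContDiff ℂ 1 fun p : ℂ × (Fin 2 → ℂ) => p.2 1 :=
      (contDiff_apply ℂ ℂ (1 : Fin 2)).comp contDiff_snd
    exact (contDiff_const.add contDiff_fst).prodMk ((contDiff_const.add c0).prodMk
      (contDiff_const.add c1))
  have hsh0 : sh 0 = ((x₀ : ℂ), (a x₀ : ℂ), (b x₀ : ℂ)) := by simp [sh]
  have hev : ∀ᶠ p in 𝓝 (0 : ℂ × (Fin 2 → ℂ)),
      ContDiffAt ℂ 1 (fun p : ℂ × ℂ × ℂ => F₁ p.1 p.2.1 p.2.2) (sh p) ∧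
      ContDiffAt ℂ 1 (fun p : ℂ × ℂ × ℂ => F₂ p.1 p.2.1 p.2.2) (sh p) := by
    have ht : Tendsto sh (𝓝 0) (𝓝 ((x₀ : ℂ), (a x₀ : ℂ), (b x₀ : ℂ))) := by
      rw [← hsh0]; exact hsh.continuous.tendsto 0
    exact ht.eventually ((h₁.eventually (by simp)).and (h₂.eventually (by simp)))
  obtain ⟨ε, hε, hball⟩ := Metric.eventually_nhds_iff_ball.1 hev
  have hε2 : 0 < ε / 2 := half_pos hε
  have hG : ∀ z ∈ Icc (0 : ℝ) 0, ∀ x ∈ closedBall (0 : ℂ) (ε / 2),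
      ∀ w ∈ closedBall (0 : Fin 2 → ℂ) (ε / 2),
      ContDiffAt ℂ 1 (fun p : ℂ × ℂ × (Fin 2 → ℂ) => G p.1 p.2.1 p.2.2) ((z : ℂ), x, w) := by
    intro z _ x hx w hw
    have hm : (x, w) ∈ ball (0 : ℂ × (Fin 2 → ℂ)) ε := by
      rw [mem_ball_zero_iff, Prod.norm_def]
      rw [mem_closedBall_zero_iff] at hx hw
      exact max_lt (by linarith) (by linarith)
    obtain ⟨k1, k2⟩ := hball _ hm
    have hc : ContDiffAt ℂ 1 (fun p : ℂ × ℂ × (Fin 2 → ℂ) => sh p.2) ((z : ℂ), x, w) :=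
      (hsh.comp contDiff_snd).contDiffAt
    refine contDiffAt_pi.2 fun i => ?_
    fin_cases i
    · exact ContDiffAt.comp ((z : ℂ), x, w) (f := fun p : ℂ × ℂ × (Fin 2 → ℂ) => sh p.2) k1 hc
    · exact ContDiffAt.comp ((z : ℂ), x, w) (f := fun p : ℂ × ℂ × (Fin 2 → ℂ) => sh p.2) k2 hc
  -- With exponents `0` the singular system is just `x w' = x g`, and the one-point interval `[0,
  -- 0]` removes the parameter.
  obtain ⟨r, M, L, hr, hrR, hL0, -, hgb, v, -, hv⟩ := BriotBouquet.exists_analytic_solution hε2 hε2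
    (fun _ _ => 0) (fun _ _ _ => le_rfl) (fun _ => continuousOn_const) G gR hG (by
      intro z _ x _ w _ i
      fin_cases i
      · simp only [G, gR, Fin.zero_eta, Matrix.cons_val_zero, ← e₁]; push_cast; rfl
      · simp only [G, gR, Fin.mk_one, Matrix.cons_val_one, Matrix.cons_val_fin_one, ← e₂]
        push_cast; rfl)
  obtain ⟨hv0, hva, hvd⟩ := hv 0 ⟨le_rfl, le_rfl⟩
  let u : ℝ → Fin 2 → ℝ := fun x => ![a (x₀ + x) - a x₀, b (x₀ + x) - b x₀]
  have hderv : ∀ x ∈ Ioo (-r) r, x ≠ 0 → HasDerivAt (v 0) (gR 0 x (v 0 x)) x := by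
    intro x hx hx0
    refine hasDerivAt_pi.2 fun i => ?_
    obtain ⟨d, hd, hde⟩ := (hvd x hx).2.2 i
    have : d = gR 0 x (v 0 x) i := by
      rw [zero_mul, add_zero] at hde
      exact mul_left_cancel₀ hx0 hde
    rwa [← this]
  have hgRc : ContinuousAt (fun x => gR 0 x (v 0 x)) 0 := by
    have h0 : (0 : ℝ) ∈ Ioo (-r) r := ⟨by linarith, hr⟩
    have hvc : ContinuousAt (v 0) 0 := (hva 0 h0).continuousAt
    have hcs : ContinuousAt (fun x : ℝ => sh ((x : ℂ), fun j => (v 0 x j : ℂ))) 0 := by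
      refine hsh.continuous.continuousAt.comp (f := fun x : ℝ => ((x : ℂ), fun j => (v 0 x j : ℂ))) ?_
      refine Complex.continuous_ofReal.continuousAt.prodMk (continuousAt_pi.2 fun j => ?_)
      exact Complex.continuous_ofReal.continuousAt.comp (continuousAt_pi.1 hvc j)
    have hs0 : sh (((0 : ℝ) : ℂ), fun j => (v 0 0 j : ℂ)) =
        ((x₀ : ℂ), (a x₀ : ℂ), (b x₀ : ℂ)) := by simp [sh, hv0]
    refine continuousAt_pi.2 fun i => ?_
    fin_cases i
    · have := ContinuousAt.comp (f := fun x : ℝ => sh ((x : ℂ), fun j => (v 0 x j : ℂ)))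
        (x := 0) (by rw [hs0]; exact h₁.continuousAt) hcs
      have h2 := Complex.continuous_re.continuousAt.comp this
      refine h2.congr (Eventually.of_forall fun x => ?_)
      simp only [Function.comp, sh, gR, Fin.zero_eta, Matrix.cons_val_zero]
      rw [← Complex.ofReal_re (f₁ _ _ _), ← e₁]
      push_cast; rfl
    · have := ContinuousAt.comp (f := fun x : ℝ => sh ((x : ℂ), fun j => (v 0 x j : ℂ)))
        (x := 0) (by rw [hs0]; exact h₂.continuousAt) hcs
      have h2 := Complex.continuous_re.continuousAt.comp this
      refine h2.congr (Eventually.of_forall fun x => ?_)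
      simp only [Function.comp, sh, gR, Fin.mk_one, Matrix.cons_val_one, Matrix.cons_val_fin_one]
      rw [← Complex.ofReal_re (f₂ _ _ _), ← e₂]
      push_cast; rfl
  -- At `x = 0` the factor `x` makes the equation empty; the derivative there is recovered as a
  -- limit, both sides being continuous.
  have hderv0 : HasDerivAt (v 0) (gR 0 0 (v 0 0)) 0 := by
    have h0 : (0 : ℝ) ∈ Ioo (-r) r := ⟨by linarith, hr⟩
    obtain ⟨y, hy⟩ : ∃ y, HasDerivAt (v 0) y 0 := ⟨_, (hva 0 h0).differentiableAt.hasDerivAt⟩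
    have hcd : ContinuousAt (deriv (v 0)) 0 := (hva 0 h0).deriv.continuousAt
    have : deriv (v 0) 0 = gR 0 0 (v 0 0) := by
      have l1 : Tendsto (deriv (v 0)) (𝓝[≠] 0) (𝓝 (deriv (v 0) 0)) :=
        hcd.tendsto.mono_left nhdsWithin_le_nhds
      have l2 : Tendsto (fun x => gR 0 x (v 0 x)) (𝓝[≠] 0) (𝓝 (gR 0 0 (v 0 0))) :=
        hgRc.tendsto.mono_left nhdsWithin_le_nhds
      refine tendsto_nhds_unique l1 (l2.congr' ?_)
      filter_upwards [self_mem_nhdsWithin, nhdsWithin_le_nhds (isOpen_Ioo.mem_nhds h0)] with x hx hx'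
      exact (hderv x hx' hx).deriv.symm
    rw [← this]
    exact (hva 0 h0).differentiableAt.hasDerivAt
  have hue : v 0 =ᶠ[𝓝 0] u := by
    have hI : Ioo (-r) r ∈ 𝓝 (0 : ℝ) := isOpen_Ioo.mem_nhds ⟨by linarith, hr⟩
    have htr : Tendsto (fun x => x₀ + x) (𝓝 0) (𝓝 x₀) := by
      have : ContinuousAt (fun x : ℝ => x₀ + x) 0 := by fun_prop
      simpa [ContinuousAt] using this
    have hud : ∀ᶠ x in 𝓝 (0 : ℝ), HasDerivAt u (gR 0 x (u x)) x := by
      filter_upwards [htr.eventually ha, htr.eventually hb] with x hxa hxb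
      refine hasDerivAt_pi.2 fun i => ?_
      fin_cases i
      · have := (hxa.comp_const_add x₀ x).sub_const (a x₀)
        simpa [u, gR] using this
      · have := (hxb.comp_const_add x₀ x).sub_const (b x₀)
        simpa [u, gR] using this
    have hu0 : u 0 = 0 := by
      funext i; fin_cases i <;> simp [u]
    have hub : ∀ᶠ x in 𝓝 (0 : ℝ), u x ∈ closedBall (0 : Fin 2 → ℝ) (ε / 2) := by
      have : ContinuousAt u 0 := hud.self_of_nhds.continuousAt
      refine this.eventually_mem ?_
      rw [hu0]
      exact closedBall_mem_nhds _ hε2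
    refine ODE_solution_unique_of_eventually (v := fun x w => gR 0 x w) (K := L.toNNReal)
      (s := fun _ => closedBall (0 : Fin 2 → ℝ) (ε / 2)) ?_ ?_ ?_ ?_
    · filter_upwards [hI] with x hx
      refine LipschitzOnWith.of_dist_le_mul fun w hw w' hw' => ?_
      rw [Real.coe_toNNReal L hL0, dist_eq_norm, dist_eq_norm]
      refine (pi_norm_le_iff_of_nonneg (by positivity)).2 fun i => ?_
      exact (hgb 0 ⟨le_rfl, le_rfl⟩ x ((abs_lt.2 hx).le.trans hrR) w
        (mem_closedBall_zero_iff.1 hw) w' (mem_closedBall_zero_iff.1 hw') i).2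
    · filter_upwards [hI] with x hx
      refine ⟨?_, mem_closedBall_zero_iff.2 (hvd x hx).1.le⟩
      by_cases hx0 : x = 0
      · rw [hx0]; exact hderv0
      · exact hderv x hx hx0
    · filter_upwards [hud, hub] with x h1 h2 using ⟨h1, h2⟩
    · rw [hv0, hu0]
  have hua : AnalyticAt ℝ u 0 :=
    (hva 0 ⟨by linarith, hr⟩).congr hue
  have hback : AnalyticAt ℝ (fun x : ℝ => x - x₀) x₀ := by fun_prop
  have hu' : ∀ i, AnalyticAt ℝ (fun x => u (x - x₀) i) x₀ := fun i =>
    AnalyticAt.comp (g := fun y => u y i) (f := fun x : ℝ => x - x₀)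
      (by rw [sub_self]; exact analyticAt_pi_iff.1 hua i) hback
  constructor
  · refine ((hu' 0).add (analyticAt_const (v := a x₀))).congr (Eventually.of_forall fun x => ?_)
    simp [u]
  · refine ((hu' 1).add (analyticAt_const (v := b x₀))).congr (Eventually.of_forall fun x => ?_)
    simp [u]

/-! ### The profile system and its analytic solutions at the sonic point. -/

/-- `da/dq` for the profile in the variables `q = y²ω²`, `a = 1/ω`, `h = a - 1 - 2θ`, where
`θ = (1 - y²Rω)/(1 - q)` and `R = 2πρ`. -/
def slopeA {K : Type*} [Field K] (q a h : K) : K := -(a * h) / (2 * q * (1 + h))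

/-- `dh/dq` for the profile. -/
def slopeH {K : Type*} [Field K] (q a h : K) : K :=
  ((a - 1) * (3 - a) - h * (1 + q * (2 * a - 5 - 2 * h)) / (1 - q)) / (2 * q * (1 + h))

namespace Sonic

section Definitions

variable {K : Type*} [Field K]

/-- First Taylor coefficient of `a` at the sonic point, in powers of `1 - q`. -/
def α₀ (z : K) : K := z * (z - 2) / (2 * (z - 1))

/-- First Taylor coefficient of `2θ` at the sonic point, in powers of `1 - q`. -/
def φ₀ (z : K) : K := (z - 1) / (2 * (2 * z - 3))

/-- The factor `q (1 + h)` as a function of the Taylor remainders. -/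
def E (z x w v : K) : K := (1 - x) * (z - 1 + x * (α₀ z + w - (φ₀ z + v)))

/-- The difference quotient of `E`. -/
def E₁ (z x w v : K) : K :=
  (α₀ z + w - (φ₀ z + v)) - (z - 1) - x * (α₀ z + w - (φ₀ z + v))

/-- Nonlinearity for the Taylor remainder of `a`. -/
def g₁ (z x w v : K) : K :=
  (((α₀ z + w) * (z - 2) + z * (α₀ z + w - (φ₀ z + v)) +
    x * (α₀ z + w) * (α₀ z + w - (φ₀ z + v))) * (z - 1) - z * (z - 2) * E₁ z x w v) /
    (2 * E z x w v * (z - 1))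

/-- Nonlinearity for the Taylor remainder of `2θ`. -/
def g₂ (z x w v : K) : K :=
  ((((φ₀ z + v) * (z - 1) + (α₀ z + w - 2 * (φ₀ z + v)) +
      x * (φ₀ z + v) * (α₀ z + w - 2 * (φ₀ z + v))) / 2 -
      (φ₀ z + v) * (α₀ z + w - (φ₀ z + v))) * (z - 1) -
    ((z - 1) / 2 - (φ₀ z + v) * (z - 2)) * E₁ z x w v) / (E z x w v * (z - 1))

end Definitions

theorem α₀_mem {z : ℝ} (hz : z ∈ Icc (2 : ℝ) 3) : α₀ z ∈ Icc ((z - 2) / 2) (z - 2) := by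
  have h1 : 0 < 2 * (z - 1) := by linarith [hz.1]
  constructor
  · rw [α₀, le_div_iff₀ h1]; nlinarith [hz.1, hz.2]
  · rw [α₀, div_le_iff₀ h1]; nlinarith [hz.1, hz.2]

theorem φ₀_mem {z : ℝ} (hz : z ∈ Icc (2 : ℝ) 3) : φ₀ z ∈ Icc (1 / 3 : ℝ) (1 / 2) := by
  have h1 : 0 < 2 * (2 * z - 3) := by linarith [hz.1]
  constructor
  · rw [φ₀, le_div_iff₀ h1]; linarith [hz.2]
  · rw [φ₀, div_le_iff₀ h1]; linarith [hz.1]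

/-- `E` is `q (1 + h)`. In its second factor the perturbation has norm at most `1/4 · 3/2 = 3/8`,
while `z - 1 ≥ 1`. -/
theorem E_ne_zero {z : ℝ} (hz : z ∈ Icc (2 : ℝ) 3) {x w v : ℂ} (hx : ‖x‖ ≤ 1 / 4)
    (hw : ‖w‖ ≤ 1 / 8) (hv : ‖v‖ ≤ 1 / 8) : E (z : ℂ) x w v ≠ 0 := by
  have hα := α₀_mem hz
  have hφ := φ₀_mem hz
  have eα : α₀ (z : ℂ) = ((α₀ z : ℝ) : ℂ) := by simp [α₀]
  have eφ : φ₀ (z : ℂ) = ((φ₀ z : ℝ) : ℂ) := by simp [φ₀]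
  have n1 : ‖((α₀ z : ℝ) : ℂ) - ((φ₀ z : ℝ) : ℂ)‖ ≤ 1 := by
    rw [← Complex.ofReal_sub, Complex.norm_real, Real.norm_eq_abs, abs_le]
    constructor <;> linarith [hα.1, hα.2, hφ.1, hφ.2, hz.1, hz.2]
  have n2 : ‖α₀ (z : ℂ) + w - (φ₀ (z : ℂ) + v)‖ ≤ 3 / 2 := by
    rw [eα, eφ]
    have : ((α₀ z : ℝ) : ℂ) + w - (((φ₀ z : ℝ) : ℂ) + v) =
      (((α₀ z : ℝ) : ℂ) - ((φ₀ z : ℝ) : ℂ)) + (w - v) := by ring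
    rw [this]
    have := norm_add_le (((α₀ z : ℝ) : ℂ) - ((φ₀ z : ℝ) : ℂ)) (w - v)
    have := norm_sub_le w v
    linarith
  refine mul_ne_zero ?_ ?_
  · intro h
    have : x = 1 := (sub_eq_zero.1 h).symm
    rw [this, norm_one] at hx
    norm_num at hx
  · intro h
    have h1 : x * (α₀ (z : ℂ) + w - (φ₀ (z : ℂ) + v)) = ((1 - z : ℝ) : ℂ) := by
      push_cast
      linear_combination h
    have h2 := congrArg norm h1
    rw [norm_mul, Complex.norm_real, Real.norm_eq_abs, abs_of_nonpos (by linarith [hz.1])] at h2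
    nlinarith [norm_nonneg x, norm_nonneg (α₀ (z : ℂ) + w - (φ₀ (z : ℂ) + v)), hz.1]

theorem contDiffAt {z x w v : ℂ} (h1 : z - 1 ≠ 0) (h3 : 2 * z - 3 ≠ 0) (hE : E z x w v ≠ 0) :
    ContDiffAt ℂ 1 (fun p : ℂ × ℂ × ℂ × ℂ => g₁ p.1 p.2.1 p.2.2.1 p.2.2.2) (z, x, w, v) ∧
    ContDiffAt ℂ 1 (fun p : ℂ × ℂ × ℂ × ℂ => g₂ p.1 p.2.1 p.2.2.1 p.2.2.2) (z, x, w, v) := by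
  have hα : ContDiffAt ℂ 1 (fun p : ℂ × ℂ × ℂ × ℂ => α₀ p.1) (z, x, w, v) := by
    unfold α₀
    exact ContDiffAt.div (by fun_prop) (by fun_prop) (mul_ne_zero two_ne_zero h1)
  have hφ : ContDiffAt ℂ 1 (fun p : ℂ × ℂ × ℂ × ℂ => φ₀ p.1) (z, x, w, v) := by
    unfold φ₀
    exact ContDiffAt.div (by fun_prop) (by fun_prop) (mul_ne_zero two_ne_zero h3)
  have hEc : ContDiffAt ℂ 1 (fun p : ℂ × ℂ × ℂ × ℂ => E p.1 p.2.1 p.2.2.1 p.2.2.2)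
      (z, x, w, v) := by
    unfold E
    fun_prop
  have hE1 : ContDiffAt ℂ 1 (fun p : ℂ × ℂ × ℂ × ℂ => E₁ p.1 p.2.1 p.2.2.1 p.2.2.2)
      (z, x, w, v) := by
    unfold E₁
    fun_prop
  constructor
  · unfold g₁
    exact ContDiffAt.div (by fun_prop) (by fun_prop)
      (mul_ne_zero (mul_ne_zero two_ne_zero hE) h1)
  · unfold g₂
    exact ContDiffAt.div (by fun_prop) (by fun_prop) (mul_ne_zero hE h1)

/-- `α₀` is the value of `-da/dq` at `q = 1`. What is left is divisible by `x = 1 - q`, the only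
quotient needed being `E₁ = (E - (z - 1))/x`. -/
theorem slopeA_eq {z x w v : ℝ} (hz : z - 1 ≠ 0) (hE : E z x w v ≠ 0) :
    slopeA (1 - x) (z + x * (α₀ z + w)) (z - 2 + x * (α₀ z + w - (φ₀ z + v))) =
      -(α₀ z + x * g₁ z x w v) := by
  have e0 : α₀ z = z * (z - 2) / (2 * (z - 1)) := rfl
  have hden : 2 * (1 - x) * (1 + (z - 2 + x * (α₀ z + w - (φ₀ z + v)))) = 2 * E z x w v := by
    rw [E]; ring
  rw [slopeA, hden, g₁]
  have e1 : E₁ z x w v * x = E z x w v - (z - 1) := by rw [E, E₁]; ring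
  generalize hα : α₀ z + w = α at *
  generalize φ₀ z + v = φ at *
  generalize E z x w v = e at *
  generalize E₁ z x w v = f at *
  rw [e0]
  field_simp
  linear_combination (-z * (z - 2)) * e1

/-- The two sides are expressions for `-d(2θ)/dq`. At `x = 0` the right-hand side is affine in `v`:
`φ₀` is the coefficient for which the constant terms balance, and the linear part produces the
exponent `(2z - 3)/(z - 1)`. -/
theorem slopeT_eq {z x w v : ℝ} (hz : z - 1 ≠ 0) (hz3 : 2 * z - 3 ≠ 0) (hE : E z x w v ≠ 0) :
    φ₀ z + v + (x * g₂ z x w v - (2 * z - 3) / (z - 1) * v) =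
    ((1 + x * (φ₀ z + v)) / 2 * (z - 1 + x * (α₀ z + w - 2 * (φ₀ z + v))) -
      (φ₀ z + v) * (z - 2 + x * (α₀ z + w - (φ₀ z + v)))) / E z x w v := by
  have e0 : φ₀ z + v - (2 * z - 3) / (z - 1) * v =
      ((z - 1) / 2 - (φ₀ z + v) * (z - 2)) / (z - 1) := by
    have hφ : φ₀ z * (2 * (2 * z - 3)) = z - 1 :=
      div_mul_cancel₀ _ (mul_ne_zero two_ne_zero hz3)
    generalize φ₀ z = φ at *
    field_simp
    linear_combination hφ
  have e1 : E₁ z x w v * x = E z x w v - (z - 1) := by rw [E, E₁]; ring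
  have e2 : φ₀ z + v + (x * g₂ z x w v - (2 * z - 3) / (z - 1) * v) =
      (φ₀ z + v - (2 * z - 3) / (z - 1) * v) + x * g₂ z x w v := by ring
  rw [e2, e0, g₂]
  generalize α₀ z + w = α at *
  generalize φ₀ z + v = φ at *
  generalize E z x w v = e at *
  generalize E₁ z x w v = f at *
  field_simp
  linear_combination (-(z - 1) + 2 * φ * (z - 2)) * e1

/-- This is `h' = a' - (2θ)'`. The quotient by `1 - q` in `slopeH` appears on eliminating `φ = (a -
2 - h)/(1 - q)`. -/
theorem slopeH_identity {q z α φ : ℝ} (hq : q ≠ 0) (hq1 : 1 - q ≠ 0)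
    (hden : z - 1 + (1 - q) * (α - φ) ≠ 0) :
    -((z + (1 - q) * α) * (z - 2 + (1 - q) * (α - φ))) /
        (2 * q * (1 + (z - 2 + (1 - q) * (α - φ)))) -
      -(((1 + (1 - q) * φ) / 2 * (z - 1 + (1 - q) * (α - 2 * φ)) -
        φ * (z - 2 + (1 - q) * (α - φ))) / (q * (z - 1 + (1 - q) * (α - φ)))) =
      ((z + (1 - q) * α - 1) * (3 - (z + (1 - q) * α)) - (z - 2 + (1 - q) * (α - φ)) *
        (1 + q * (2 * (z + (1 - q) * α) - 5 - 2 * (z - 2 + (1 - q) * (α - φ)))) / (1 - q)) /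
        (2 * q * (1 + (z - 2 + (1 - q) * (α - φ)))) := by
  obtain ⟨a, ha⟩ : ∃ a, a = z + (1 - q) * α := ⟨_, rfl⟩
  obtain ⟨h, hh⟩ : ∃ h, h = z - 2 + (1 - q) * (α - φ) := ⟨_, rfl⟩
  have e1 : z - 1 + (1 - q) * (α - φ) = 1 + h := by rw [hh]; ring
  have e2 : z - 1 + (1 - q) * (α - 2 * φ) = 3 - a + 2 * h := by rw [ha, hh]; ring
  have e3 : φ = (a - 2 - h) / (1 - q) := by rw [ha, hh]; field_simp; ring
  rw [e1] at hden
  rw [e1, e2, ← ha, ← hh, e3]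
  field_simp
  ring

/-- The analytic solutions through the sonic points `q = 1`, `a = z`, with `z ∈ [2, 3]`. -/
theorem exists_family : ∃ r : ℝ, 0 < r ∧ r ≤ 1 / 4 ∧ ∃ A H : ℝ → ℝ → ℝ,
    (∀ q ∈ Ioo (1 - r) (1 + r), ContinuousOn (fun z => A z q) (Icc 2 3) ∧
      ContinuousOn (fun z => H z q) (Icc 2 3)) ∧
    ∀ z ∈ Icc (2 : ℝ) 3, A z 1 = z ∧ H z 1 = z - 2 ∧ ∀ q ∈ Ioo (1 - r) (1 + r),
      AnalyticAt ℝ (A z) q ∧ AnalyticAt ℝ (H z) q ∧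
      HasDerivAt (A z) (slopeA q (A z q) (H z q)) q ∧
      (q ≠ 1 → HasDerivAt (H z) (slopeH q (A z q) (H z q)) q) ∧
      ∃ w v : ℝ, |w| ≤ 1 / 8 ∧ |v| ≤ 1 / 8 ∧ A z q = z + (1 - q) * (α₀ z + w) ∧
        H z q = z - 2 + (1 - q) * (α₀ z + w - (φ₀ z + v)) := by
  -- Writing `a = z + x(α₀ + w)` and `2θ = 1 + x(φ₀ + v)` with `x = 1 - q`, the derivative of the
  -- product `x w` contributes the exponent `1` of the first component.
  let μ : ℝ → Fin 2 → ℝ := fun z => ![1, (2 * z - 3) / (z - 1)]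
  let G : ℂ → ℂ → (Fin 2 → ℂ) → Fin 2 → ℂ := fun z x w =>
    ![g₁ z x (w 0) (w 1), g₂ z x (w 0) (w 1)]
  let gR : ℝ → ℝ → (Fin 2 → ℝ) → Fin 2 → ℝ := fun z x w =>
    ![g₁ z x (w 0) (w 1), g₂ z x (w 0) (w 1)]
  obtain ⟨r, M, L, hr, hrR, -, -, -, u, huc, hu⟩ := BriotBouquet.exists_analytic_solution
    (c := 2) (d := 3) (R := 1 / 4) (ρ := 1 / 8) (by norm_num) (by norm_num) μ (by
      intro z hz i
      fin_cases i
      · simp [μ]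
      · simp only [μ, Fin.mk_one, Matrix.cons_val_one, Matrix.cons_val_fin_one]
        exact div_nonneg (by linarith [hz.1]) (by linarith [hz.1])) (by
      intro i
      fin_cases i
      · exact continuousOn_const
      · simp only [μ, Fin.mk_one, Matrix.cons_val_one, Matrix.cons_val_fin_one]
        refine ContinuousOn.div (by fun_prop) (by fun_prop) fun z hz => ?_
        have := hz.1
        intro h
        linarith) G gR (by
      intro z hz x hx w hw
      rw [mem_closedBall_zero_iff] at hx hw
      have hE := E_ne_zero hz hx ((norm_le_pi_norm w 0).trans hw) ((norm_le_pi_norm w 1).trans hw)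
      have hz1 : (z : ℂ) - 1 ≠ 0 := by
        have : z - 1 ≠ 0 := by linarith [hz.1]
        exact_mod_cast this
      have hz3 : 2 * (z : ℂ) - 3 ≠ 0 := by
        have : 2 * z - 3 ≠ 0 := by linarith [hz.1]
        exact_mod_cast this
      obtain ⟨c1, c2⟩ := contDiffAt hz1 hz3 hE
      have hs : ContDiffAt ℂ 1 (fun p : ℂ × ℂ × (Fin 2 → ℂ) => (p.1, p.2.1, p.2.2 0, p.2.2 1))
          ((z : ℂ), x, w) := by
        have k0 : ContDiff ℂ 1 fun p : ℂ × ℂ × (Fin 2 → ℂ) => p.2.2 0 :=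
          (contDiff_apply ℂ ℂ (0 : Fin 2)).comp (contDiff_snd.comp contDiff_snd)
        have k1 : ContDiff ℂ 1 fun p : ℂ × ℂ × (Fin 2 → ℂ) => p.2.2 1 :=
          (contDiff_apply ℂ ℂ (1 : Fin 2)).comp (contDiff_snd.comp contDiff_snd)
        exact (contDiff_fst.prodMk ((contDiff_fst.comp contDiff_snd).prodMk
          (k0.prodMk k1))).contDiffAt
      refine contDiffAt_pi.2 fun i => ?_
      fin_cases i
      · exact ContDiffAt.comp ((z : ℂ), x, w)
          (f := fun p : ℂ × ℂ × (Fin 2 → ℂ) => (p.1, p.2.1, p.2.2 0, p.2.2 1)) c1 hs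
      · exact ContDiffAt.comp ((z : ℂ), x, w)
          (f := fun p : ℂ × ℂ × (Fin 2 → ℂ) => (p.1, p.2.1, p.2.2 0, p.2.2 1)) c2 hs) (by
      intro z _ x _ w _ i
      fin_cases i
      · simp [G, gR, g₁, E, E₁, α₀, φ₀]
      · simp [G, gR, g₂, E, E₁, α₀, φ₀])
  have hxmem : ∀ q ∈ Ioo (1 - r) (1 + r), 1 - q ∈ Ioo (-r) r := fun q hq =>
    ⟨by linarith [hq.2], by linarith [hq.1]⟩
  have hα₀c : ContinuousOn (α₀ : ℝ → ℝ) (Icc 2 3) := by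
    unfold α₀
    refine ContinuousOn.div (by fun_prop) (by fun_prop) fun z hz => ?_
    have := hz.1
    intro h
    linarith
  have hφ₀c : ContinuousOn (φ₀ : ℝ → ℝ) (Icc 2 3) := by
    unfold φ₀
    refine ContinuousOn.div (by fun_prop) (by fun_prop) fun z hz => ?_
    have := hz.1
    intro h
    linarith
  refine ⟨r, hr, hrR, fun z q => z + (1 - q) * (α₀ z + u z (1 - q) 0),
    fun z q => z - 2 + (1 - q) * (α₀ z + u z (1 - q) 0 - (φ₀ z + u z (1 - q) 1)), ?_, ?_⟩
  · intro q hq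
    have hc : ∀ i, ContinuousOn (fun z => u z (1 - q) i) (Icc 2 3) := fun i =>
      (continuousOn_pi.1 huc i).comp (f := fun z : ℝ => (z, 1 - q)) (by fun_prop)
        fun z hz => ⟨hz, hxmem q hq⟩
    have h0 := hc 0
    have h1 := hc 1
    constructor <;> fun_prop
  · intro z hz
    obtain ⟨-, hua, hud⟩ := hu z hz
    refine ⟨by simp, by simp, fun q hq => ?_⟩
    have hx := hxmem q hq
    obtain ⟨hn, -, hd⟩ := hud _ hx
    have hz1 : z - 1 ≠ 0 := by linarith [hz.1]
    have hz3 : 2 * z - 3 ≠ 0 := by linarith [hz.1]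
    have hw : |u z (1 - q) 0| ≤ 1 / 8 := (norm_le_pi_norm (u z (1 - q)) 0).trans hn.le
    have hv : |u z (1 - q) 1| ≤ 1 / 8 := (norm_le_pi_norm (u z (1 - q)) 1).trans hn.le
    have hE : E z (1 - q) (u z (1 - q) 0) (u z (1 - q) 1) ≠ 0 := by
      have := E_ne_zero hz (x := ((1 - q : ℝ) : ℂ)) (w := (u z (1 - q) 0 : ℝ))
        (v := (u z (1 - q) 1 : ℝ)) (by
          rw [Complex.norm_real]; exact (abs_lt.2 hx).le.trans hrR)
        (by rw [Complex.norm_real]; exact hw) (by rw [Complex.norm_real]; exact hv)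
      intro h
      apply this
      rw [← Complex.ofReal_zero, ← h]
      simp [E, α₀, φ₀]
    have han : ∀ i, AnalyticAt ℝ (fun q => u z (1 - q) i) q := fun i =>
      AnalyticAt.comp (g := fun x => u z x i) (f := fun q : ℝ => 1 - q)
        (analyticAt_pi_iff.1 (hua _ hx) i) (by fun_prop)
    have ha0 := han 0
    have ha1 := han 1
    obtain ⟨d0, hd0, e0⟩ := hd 0
    obtain ⟨d1, hd1, e1⟩ := hd 1
    have hlin : HasDerivAt (fun q : ℝ => 1 - q) (-1) q := by
      simpa using (hasDerivAt_id q).const_sub 1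
    have hd0' : HasDerivAt (fun q => u z (1 - q) 0) (d0 * -1) q :=
      HasDerivAt.comp q (h := fun q : ℝ => 1 - q) hd0 hlin
    have hd1' : HasDerivAt (fun q => u z (1 - q) 1) (d1 * -1) q :=
      HasDerivAt.comp q (h := fun q : ℝ => 1 - q) hd1 hlin
    simp only [μ, gR, Matrix.cons_val_zero, Matrix.cons_val_one, Matrix.cons_val_fin_one,
      one_mul] at e0 e1
    have eA := slopeA_eq hz1 hE
    have eT := slopeT_eq hz1 hz3 hE
    rw [sub_sub_cancel] at eA
    have hA : HasDerivAt (fun q => z + (1 - q) * (α₀ z + u z (1 - q) 0))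
        (slopeA q (z + (1 - q) * (α₀ z + u z (1 - q) 0))
          (z - 2 + (1 - q) * (α₀ z + u z (1 - q) 0 - (φ₀ z + u z (1 - q) 1)))) q := by
      refine ((hlin.mul (hd0'.const_add (α₀ z))).const_add z).congr_deriv ?_
      rw [eA]
      linear_combination -e0
    have hlina : AnalyticAt ℝ (fun q : ℝ => 1 - q) q := analyticAt_const.sub analyticAt_id
    refine ⟨analyticAt_const.add (hlina.mul (analyticAt_const.add ha0)),
      analyticAt_const.add (hlina.mul ((analyticAt_const.add ha0).sub (analyticAt_const.add ha1))),
      hA, fun hq1 => ?_, _, _, hw, hv, rfl, rfl⟩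
    -- Only here is `q ≠ 1` used: `slopeH` divides by `1 - q`, so at `q = 1` its formal value
    -- carries no information.
    have hx0 : 1 - q ≠ 0 := sub_ne_zero.2 (Ne.symm hq1)
    have hT : HasDerivAt (fun q => 1 + (1 - q) * (φ₀ z + u z (1 - q) 1))
        (-(((1 + (1 - q) * (φ₀ z + u z (1 - q) 1)) / 2 *
          (z - 1 + (1 - q) * (α₀ z + u z (1 - q) 0 - 2 * (φ₀ z + u z (1 - q) 1))) -
          (φ₀ z + u z (1 - q) 1) * (z - 2 + (1 - q) *
            (α₀ z + u z (1 - q) 0 - (φ₀ z + u z (1 - q) 1)))) /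
            E z (1 - q) (u z (1 - q) 0) (u z (1 - q) 1))) q := by
      refine ((hlin.mul (hd1'.const_add (φ₀ z))).const_add 1).congr_deriv ?_
      rw [← eT]
      linear_combination -e1
    have hH := (hA.sub hT).sub_const 1
    refine (hH.congr_of_eventuallyEq (Eventually.of_forall fun y => ?_)).congr_deriv ?_
    · simp only [Pi.sub_apply]; ring
    · rw [slopeA, slopeH]
      rw [E] at hE ⊢
      rw [sub_sub_cancel] at hE ⊢
      obtain ⟨hq0, hden⟩ := mul_ne_zero_iff.1 hE
      exact slopeH_identity hq0 hx0 hden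

end Sonic

theorem HasDerivAt.eventually_lt_right {f : ℝ → ℝ} {d t : ℝ} (hf : HasDerivAt f d t) (hd : 0 < d) :
    ∀ᶠ s in 𝓝[>] t, f t < f s := by
  have hs := (hasDerivAt_iff_tendsto_slope.1 hf).mono_left
    (nhdsWithin_mono t (fun x (hx : t < x) => ne_of_gt hx) : 𝓝[>] t ≤ 𝓝[≠] t)
  filter_upwards [hs.eventually (lt_mem_nhds hd), self_mem_nhdsWithin] with s h1 h2
  rw [slope_def_field] at h1
  have h3 : 0 < s - t := sub_pos.2 h2
  have := (div_pos_iff_of_pos_right h3).1 h1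
  linarith

/-- Two solutions with the same value at the junction have the same slope there, since both slopes
come from the equation; the glued function then solves it across the junction. -/
theorem HasDerivAt.glue {f g : ℝ → ℝ} {d c : ℝ} (hf : HasDerivAt f d c) (hg : HasDerivAt g d c)
    (hfg : f c = g c) : HasDerivAt (fun x => if x ≤ c then f x else g x) d c := by
  have h1 : HasDerivWithinAt (fun x => if x ≤ c then f x else g x) d (Iic c) c :=
    hf.hasDerivWithinAt.congr (fun x hx => if_pos hx) (if_pos le_rfl)
  have h2 : HasDerivWithinAt (fun x => if x ≤ c then f x else g x) d (Ici c) c := by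
    refine hg.hasDerivWithinAt.congr (fun x hx => ?_) ?_
    · rcases eq_or_lt_of_le (show c ≤ x from hx) with h | h
      · rw [← h]; simpa using hfg
      · exact if_neg (not_le.2 h)
    · simpa using hfg
  have := h1.union h2
  rwa [Iic_union_Ici, hasDerivWithinAt_univ] at this

/-! ### The subsonic side: sign patterns of trajectories in `s = -log q`. -/

namespace Inner

/-- `da/ds` with `s = -log q`. -/
noncomputable def fieldA (a h : ℝ) : ℝ := a * h / (2 * (1 + h))

/-- `dh/ds` with `s = -log q`. -/
noncomputable def fieldH (q a h : ℝ) : ℝ :=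
  (-((a - 1) * (3 - a)) + h * ((1 + q * (2 * a - 5 - 2 * h)) / (1 - q))) / (2 * (1 + h))

/-- Trajectories of the truncated system, in the variable `s = -log q ≥ -log q₁`. -/
structure Trajectory (q₁ : ℝ) (a h : ℝ → ℝ) : Prop where
  pos : 0 < q₁
  lt_one : q₁ < 1
  derivA : ∀ s, HasDerivAt a (fieldA (clamp (3 / 2) 3 (a s)) (clamp (-1 / 2) 2 (h s))) s
  derivH : ∀ s, HasDerivAt h (fieldH (clamp 0 q₁ (Real.exp (-s))) (clamp (3 / 2) 3 (a s))
    (clamp (-1 / 2) 2 (h s))) s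

variable {q₁ : ℝ} {a h : ℝ → ℝ}

theorem abs_clamp_le (x : ℝ) : |clamp (-1 / 2) 2 x| ≤ |x| := by
  rw [clamp, abs_le]
  constructor
  · rcases le_total x 0 with hx | hx
    · rw [abs_of_nonpos hx]
      simp only [neg_neg]
      exact (le_min (by linarith) le_rfl).trans (le_max_right _ _)
    · rw [abs_of_nonneg hx]
      exact le_max_of_le_right (le_min (by linarith) (by linarith))
  · rcases le_total x 0 with hx | hx
    · exact max_le (by linarith [abs_nonneg x]) ((min_le_right _ _).trans (le_abs_self _))
    · exact max_le (by linarith [abs_nonneg x]) ((min_le_right _ _).trans (le_abs_self _))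

theorem clamp_pos {x : ℝ} (hx : 0 < x) : 0 < clamp (-1 / 2) 2 x :=
  lt_max_of_lt_right (lt_min two_pos hx)

theorem clamp_nonneg {x : ℝ} (hx : 0 ≤ x) : 0 ≤ clamp (-1 / 2) 2 x :=
  le_max_of_le_right (le_min zero_le_two hx)

/-- The constant bounding the linear growth rate of `h`. -/
noncomputable def rate (q₁ : ℝ) : ℝ := 7 / (1 - q₁)

theorem Trajectory.rate_pos (T : Trajectory q₁ a h) : 0 < rate q₁ :=
  div_pos (by norm_num) (by linarith [T.lt_one])

/-- The field splits into a source of fixed sign, vanishing at `a = 3`, and a term that is linear in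
`h` up to a bounded rate. Truncating `a` exactly at `3` makes the source vanish for every `a ≥ 3`.
-/
theorem fieldH_eq {q a h : ℝ} (hq : q ∈ Icc 0 q₁) (hq₁ : q₁ < 1) (ha : a ∈ Icc (3 / 2 : ℝ) 3)
    (hh : h ∈ Icc (-1 / 2 : ℝ) 2) :
    ∃ k, |k| ≤ rate q₁ ∧ fieldH q a h = -((a - 1) * (3 - a)) / (2 * (1 + h)) + h * k := by
  have h1 : 0 < 1 - q := by linarith [hq.2]
  have h2 : 1 ≤ 2 * (1 + h) := by linarith [hh.1]
  refine ⟨(1 + q * (2 * a - 5 - 2 * h)) / (1 - q) / (2 * (1 + h)), ?_, ?_⟩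
  · have hn : |1 + q * (2 * a - 5 - 2 * h)| ≤ 7 := by
      have e1 : -6 ≤ 2 * a - 5 - 2 * h := by linarith [ha.1, hh.2]
      have e2 : 2 * a - 5 - 2 * h ≤ 2 := by linarith [ha.2, hh.1]
      have e3 : q ≤ 1 := by linarith [hq.2]
      rw [abs_le]
      constructor <;> nlinarith [hq.1]
    rw [abs_div, abs_div, abs_of_pos h1, abs_of_pos (by linarith : 0 < 2 * (1 + h)), rate]
    refine (div_le_self (by positivity) h2).trans ?_
    exact div_le_div₀ (by norm_num) hn (by linarith) (by linarith [hq.2])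
  · rw [fieldH]
    field_simp

theorem Trajectory.derivH' (T : Trajectory q₁ a h) (s : ℝ) : ∃ k, |k| ≤ rate q₁ ∧
    HasDerivAt h (-((clamp (3 / 2) 3 (a s) - 1) * (3 - clamp (3 / 2) 3 (a s))) /
      (2 * (1 + clamp (-1 / 2) 2 (h s))) + clamp (-1 / 2) 2 (h s) * k) s := by
  obtain ⟨k, hk, e⟩ := fieldH_eq (clamp_mem T.pos.le (Real.exp (-s))) T.lt_one
    (clamp_mem (by norm_num : (3 / 2 : ℝ) ≤ 3) (a s)) (clamp_mem (by norm_num : (-1 / 2 : ℝ) ≤ 2)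
      (h s))
  exact ⟨k, hk, e ▸ T.derivH s⟩

theorem clampA_mem (x : ℝ) : clamp (3 / 2) 3 x ∈ Icc (3 / 2 : ℝ) 3 :=
  clamp_mem (by norm_num) _

theorem clampH_mem (x : ℝ) : clamp (-1 / 2) 2 x ∈ Icc (-1 / 2 : ℝ) 2 :=
  clamp_mem (by norm_num) _

theorem Trajectory.contA (T : Trajectory q₁ a h) : Continuous a :=
  continuous_iff_continuousAt.2 fun s => (T.derivA s).continuousAt

theorem Trajectory.contH (T : Trajectory q₁ a h) : Continuous h :=
  continuous_iff_continuousAt.2 fun s => (T.derivH s).continuousAt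

/-- Barriers require strict inequalities, whereas the equations only give `g' ≥ -C g`. Subtracting
`c exp(-D s)` from `g`, with `D > C`, gains the strictness at a zero of the difference. -/
theorem hasDerivAt_exp_weight (c D s : ℝ) :
    HasDerivAt (fun s => c * Real.exp (-D * s)) (-D * (c * Real.exp (-D * s))) s := by
  have h1 : HasDerivAt (fun s : ℝ => -D * s) (-D) s := by
    simpa using (hasDerivAt_id s).const_mul (-D)
  exact (h1.exp.const_mul c).congr_deriv (by ring)

theorem exp_weight_lt {x D t : ℝ} (hx : 0 < x) :
    x / 2 * Real.exp (D * t) * Real.exp (-D * t) < x := by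
  rw [mul_assoc, ← Real.exp_add]
  simp only [neg_mul, add_neg_cancel, Real.exp_zero]
  linarith

theorem abs_mul_le {u k C x : ℝ} (hu : |u| ≤ |x|) (hk : |k| ≤ C) : |u * k| ≤ C * |x| := by
  rw [abs_mul, mul_comm]
  exact mul_le_mul hk hu (abs_nonneg _) ((abs_nonneg _).trans hk)

/-- The source in the equation for `h` is never positive, so `-h` decays at most exponentially and
cannot reach zero. -/
theorem Trajectory.neg_of_neg (T : Trajectory q₁ a h) {t : ℝ} (ht : h t < 0) {s : ℝ} (hs : t ≤ s) :
    h s < 0 := by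
  have hC := T.rate_pos
  set c := -h t / 2 * Real.exp (2 * rate q₁ * t) with hc
  have hc0 : 0 < c := mul_pos (by linarith) (Real.exp_pos _)
  have key := forall_pos_of_barrier (ι := Unit)
    (g := fun _ s => -h s - c * Real.exp (-(2 * rate q₁) * s)) (t₀ := t) (t₁ := s)
    (fun _ => by have := T.contH; fun_prop) (fun _ => by
      have := exp_weight_lt (x := -h t) (D := 2 * rate q₁) (t := t) (by linarith)
      rw [hc]; linarith) (fun τ _ _ _ hτ => by
      obtain ⟨k, hk, hd⟩ := T.derivH' τ
      refine ⟨_, ?_, hd.neg.sub (hasDerivAt_exp_weight c (2 * rate q₁) τ)⟩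
      have hpos : 0 < c * Real.exp (-(2 * rate q₁) * τ) := mul_pos hc0 (Real.exp_pos _)
      have e : c * Real.exp (-(2 * rate q₁) * τ) = -h τ := by linarith
      have e2 : |h τ| = -h τ := abs_of_neg (by linarith)
      have h1 := abs_mul_le (abs_clamp_le (h τ)) hk
      have h2 : -((clamp (3 / 2) 3 (a τ) - 1) * (3 - clamp (3 / 2) 3 (a τ))) /
          (2 * (1 + clamp (-1 / 2) 2 (h τ))) ≤ 0 := by
        have k1 := clampA_mem (a τ)
        have k2 := clampH_mem (h τ)
        refine div_nonpos_of_nonpos_of_nonneg ?_ (by linarith [k2.1])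
        have := mul_nonneg (by linarith [k1.1] : 0 ≤ clamp (3 / 2) 3 (a τ) - 1)
          (by linarith [k1.2] : 0 ≤ 3 - clamp (3 / 2) 3 (a τ))
        linarith
      rw [e2] at h1
      have h3 := (abs_le.1 h1).2
      rw [e]
      have : 0 < rate q₁ * -h τ := mul_pos hC (by linarith)
      linarith)
  have h1 := key s ⟨hs, le_rfl⟩ ()
  have h2 : 0 < c * Real.exp (-(2 * rate q₁) * s) := mul_pos hc0 (Real.exp_pos _)
  linarith

/-- Above `a = 3` the truncated source is zero and `h` decays at most exponentially, while positive
`h` makes `a` increase: each condition protects the other. -/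
theorem Trajectory.pos_of_pos (T : Trajectory q₁ a h) {t : ℝ} (ht : 0 < h t) (hta : 3 < a t) {s : ℝ}
    (hs : t ≤ s) : 0 < h s ∧ 3 < a s := by
  have hC := T.rate_pos
  set c := h t / 2 * Real.exp (2 * rate q₁ * t) with hc
  have hc0 : 0 < c := mul_pos (by linarith) (Real.exp_pos _)
  have hw : ∀ τ, 0 < c * Real.exp (-(2 * rate q₁) * τ) := fun τ => mul_pos hc0 (Real.exp_pos _)
  have key := forall_pos_of_barrier (ι := Bool) (g := fun i => bif i then
    fun s => h s - c * Real.exp (-(2 * rate q₁) * s) else fun s => a s - 3) (t₀ := t) (t₁ := s)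
    (by
      have := T.contH
      have := T.contA
      rintro (_ | _) <;> simp only [cond_true, cond_false] <;> fun_prop) (by
      rintro (_ | _)
      · simpa using hta
      · have := exp_weight_lt (x := h t) (D := 2 * rate q₁) (t := t) ht
        simp only [cond_true, hc]; linarith) (by
      rintro τ - hnn (_ | _) hz
      · simp only [cond_false] at hz ⊢
        have hh := hnn true
        simp only [cond_true] at hh
        have hp := clamp_pos (x := h τ) (by linarith [hw τ])
        have k1 := clampA_mem (a τ)
        refine ⟨_, ?_, (T.derivA τ).sub_const 3⟩
        rw [fieldA]
        have : 0 < clamp (3 / 2) 3 (a τ) := by linarith [k1.1]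
        positivity
      · simp only [cond_true] at hz ⊢
        have ha := hnn false
        simp only [cond_false] at ha
        obtain ⟨k, hk, hd⟩ := T.derivH' τ
        refine ⟨_, ?_, hd.sub (hasDerivAt_exp_weight c (2 * rate q₁) τ)⟩
        have e : c * Real.exp (-(2 * rate q₁) * τ) = h τ := by linarith
        have e2 : |h τ| = h τ := abs_of_pos (by linarith [hw τ])
        have h1 := abs_mul_le (abs_clamp_le (h τ)) hk
        have h2 : clamp (3 / 2) 3 (a τ) = 3 := by
          rw [clamp, min_eq_left (by linarith), max_eq_right (by norm_num)]
        rw [e2] at h1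
        have h3 := (abs_le.1 h1).1
        rw [e, h2]
        have : 0 < rate q₁ * h τ := mul_pos hC (by linarith [hw τ])
        simp only [sub_self, mul_zero, neg_zero, zero_div, zero_add]
        linarith)
  have h1 := key s ⟨hs, le_rfl⟩ true
  have h2 := key s ⟨hs, le_rfl⟩ false
  simp only [cond_true, cond_false] at h1 h2
  exact ⟨by linarith [hw s], by linarith⟩

/-- A trajectory that never reaches `{a > 3, h > 0}` or `{a < 3, h < 0}` stays in
`{a < 3, 0 < h < a - 1}`. -/
theorem Trajectory.critical (T : Trajectory q₁ a h) {s₀ : ℝ} (hs₀ : Real.exp (-s₀) = q₁)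
    (ha₀ : 3 / 2 < a s₀)
    (hθ₀ : 0 < a s₀ - 1 - h s₀) (hcorner : 3 ≤ a s₀ → 0 < h s₀)
    (hA : ∀ s, s₀ ≤ s → ¬(3 < a s ∧ 0 < h s)) (hB : ∀ s, s₀ ≤ s → ¬(a s < 3 ∧ h s < 0)) {s : ℝ}
    (hs : s₀ ≤ s) : 3 / 2 < a s ∧ a s < 3 ∧ 0 < h s ∧ h s < a s - 1 := by
  have hC := T.rate_pos
  -- On `a = 3` with `h > 0` the function `a` is increasing, so the first forbidden set would be
  -- entered immediately afterwards.
  have no3 : ∀ τ, s₀ ≤ τ → a τ = 3 → ¬ 0 < h τ := by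
    intro τ hτ ha hh
    have hd := T.derivA τ
    have hpos : 0 < fieldA (clamp (3 / 2) 3 (a τ)) (clamp (-1 / 2) 2 (h τ)) := by
      have hp := clamp_pos hh
      have : 0 < clamp (3 / 2) 3 (a τ) := by linarith [(clampA_mem (a τ)).1]
      rw [fieldA]
      positivity
    have hc : ∀ᶠ σ in 𝓝[>] τ, 0 < h σ :=
      nhdsWithin_le_nhds (T.contH.continuousAt.eventually (lt_mem_nhds hh))
    obtain ⟨σ, h1, h2, h3⟩ :=
      ((hd.eventually_lt_right hpos).and (hc.and self_mem_nhdsWithin)).exists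
    exact hA σ (hτ.trans (le_of_lt h3)) ⟨by linarith, h2⟩
  -- On `h = 0` with `a < 3` the source is strictly negative, so the second forbidden set would be
  -- entered immediately afterwards.
  have no0 : ∀ τ, s₀ ≤ τ → h τ = 0 → ¬ a τ < 3 := by
    intro τ hτ hh ha
    obtain ⟨k, hk, hd⟩ := T.derivH' τ
    have hpos : 0 < -(-((clamp (3 / 2) 3 (a τ) - 1) * (3 - clamp (3 / 2) 3 (a τ))) /
      (2 * (1 + clamp (-1 / 2) 2 (h τ))) + clamp (-1 / 2) 2 (h τ) * k) := by
      have k1 := clampA_mem (a τ)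
      have k2 : clamp (3 / 2) 3 (a τ) < 3 := max_lt (by norm_num) (min_lt_of_right_lt ha)
      have k3 : clamp (-1 / 2) 2 (h τ) = 0 := by rw [hh]; exact clamp_of_mem (by norm_num)
      rw [k3]
      have := mul_pos (by linarith [k1.1] : 0 < clamp (3 / 2) 3 (a τ) - 1)
        (by linarith : 0 < 3 - clamp (3 / 2) 3 (a τ))
      norm_num
      linarith
    have hc : ∀ᶠ σ in 𝓝[>] τ, a σ < 3 :=
      nhdsWithin_le_nhds (T.contA.continuousAt.eventually (gt_mem_nhds ha))
    obtain ⟨σ, h1, h2, h3⟩ :=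
      ((hd.neg.eventually_lt_right hpos).and (hc.and self_mem_nhdsWithin)).exists
    simp only [Pi.neg_apply] at h1
    exact hB σ (hτ.trans (le_of_lt h3)) ⟨h2, by linarith⟩
  have ha3 : a s₀ < 3 := by
    by_contra! hcon
    have h1 := hcorner hcon
    rcases eq_or_lt_of_le hcon with h2 | h2
    · exact no3 s₀ le_rfl h2.symm h1
    · exact hA s₀ le_rfl ⟨h2, h1⟩
  have hh0 : 0 < h s₀ := by
    rcases lt_trichotomy (h s₀) 0 with h1 | h1 | h1
    · exact absurd ⟨ha3, h1⟩ (hB s₀ le_rfl)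
    · exact absurd ha3 (no0 s₀ le_rfl h1)
    · exact h1
  -- The equilibrium `(3, 0)` is the one remaining exit. It is not reached in finite `s`, since `g =
  -- 3 - a + h` satisfies `g' ≥ -(rate q₁ + 2) g` while `h` and `3 - a` are nonnegative.
  set D := 2 * (rate q₁ + 2) with hD
  set c := (3 - a s₀ + h s₀) / 2 * Real.exp (D * s₀) with hc
  have hc0 : 0 < c := mul_pos (by linarith) (Real.exp_pos _)
  have hw : ∀ τ, 0 < c * Real.exp (-D * τ) := fun τ => mul_pos hc0 (Real.exp_pos _)
  have key := forall_pos_of_barrier (ι := Fin 3) (g := ![h, fun s => 3 - a s,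
    fun s => 3 - a s + h s - c * Real.exp (-D * s)]) (t₀ := s₀) (t₁ := s)
    (by
      have := T.contH
      have := T.contA
      intro i
      fin_cases i <;> simp <;> fun_prop) (by
      intro i
      fin_cases i
      · simpa using hh0
      · simpa using ha3
      · have := exp_weight_lt (x := 3 - a s₀ + h s₀) (D := D) (t := s₀) (by linarith)
        simp [hc] at this ⊢
        linarith) (by
      intro τ hτ hnn i hz
      have n0 : 0 ≤ h τ := hnn 0
      have n1 : 0 ≤ 3 - a τ := hnn 1
      have n2 : 0 ≤ 3 - a τ + h τ - c * Real.exp (-D * τ) := hnn 2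
      have hwτ := hw τ
      fin_cases i
      · have hz : h τ = 0 := hz
        exact absurd (by linarith) (no0 τ hτ.1.le hz)
      · have hz : 3 - a τ = 0 := hz
        exact absurd (by linarith) (no3 τ hτ.1.le (by linarith))
      · have hz : 3 - a τ + h τ - c * Real.exp (-D * τ) = 0 := hz
        obtain ⟨k, hk, hd⟩ := T.derivH' τ
        refine ⟨_, ?_, (((T.derivA τ).const_sub 3).add hd).sub (hasDerivAt_exp_weight c D τ)⟩
        have e : c * Real.exp (-D * τ) = 3 - a τ + h τ := by linarith
        have k1 := clampA_mem (a τ)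
        have k2 := clampH_mem (h τ)
        have p0 := clamp_nonneg n0
        have h1 := abs_mul_le (abs_clamp_le (h τ)) hk
        have h2 : a τ ≤ clamp (3 / 2) 3 (a τ) :=
          le_max_of_le_right (le_min (by linarith) le_rfl)
        have h3 : clamp (-1 / 2) 2 (h τ) ≤ h τ := by
          have := abs_clamp_le (h τ)
          rwa [abs_of_nonneg p0, abs_of_nonneg n0] at this
        rw [abs_of_nonneg n0] at h1
        have h4 := (abs_le.1 h1).1
        have h5 : fieldA (clamp (3 / 2) 3 (a τ)) (clamp (-1 / 2) 2 (h τ)) ≤ 3 / 2 * h τ := by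
          rw [fieldA, div_le_iff₀ (by linarith)]
          nlinarith [mul_nonneg p0 n0, mul_le_mul_of_nonneg_right k1.2 p0]
        have h6 : -(3 - a τ) ≤ -((clamp (3 / 2) 3 (a τ) - 1) * (3 - clamp (3 / 2) 3 (a τ))) /
            (2 * (1 + clamp (-1 / 2) 2 (h τ))) := by
          rw [le_div_iff₀ (by linarith)]
          nlinarith [mul_nonneg p0 n1, mul_nonneg (by linarith [k1.2] :
            0 ≤ 3 - clamp (3 / 2) 3 (a τ)) (by linarith [k1.2] : 0 ≤ 3 - clamp (3 / 2) 3 (a τ))]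
        rw [e, hD]
        have : 0 < (rate q₁ + 2) * (3 - a τ + h τ) := mul_pos (by linarith) (by linarith)
        have : 0 ≤ rate q₁ * (3 - a τ) := mul_nonneg hC.le n1
        nlinarith)
  have hpos : ∀ τ ∈ Icc s₀ s, 0 < h τ ∧ a τ < 3 := fun τ hτ => by
    have h1 := key τ hτ 0
    have h2 := key τ hτ 1
    simp only [Matrix.cons_val_zero, Matrix.cons_val_one] at h1 h2
    exact ⟨h1, by linarith⟩
  -- Positive `h` makes `a` increase with `s`, so the lower bound `3/2` is inherited from the start.
  have hmono : MonotoneOn a (Icc s₀ s) := by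
    apply monotoneOn_of_deriv_nonneg (convex_Icc _ _) T.contA.continuousOn
      (fun τ _ => (T.derivA τ).differentiableAt.differentiableWithinAt)
    intro τ hτ
    rw [(T.derivA τ).deriv, fieldA]
    have k1 := clampA_mem (a τ)
    have hp := clamp_pos (hpos τ (interior_subset hτ)).1
    have : 0 < clamp (3 / 2) 3 (a τ) := by linarith [k1.1]
    positivity
  have ha' : ∀ τ ∈ Icc s₀ s, 3 / 2 < a τ := fun τ hτ =>
    ha₀.trans_le (hmono ⟨le_rfl, hs⟩ hτ hτ.1)
  -- On the face `θ = 0`, i.e. `h = a - 1`, the derivative of `2θ` in `s` is `(a - 1)/(a(1 - q)) >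
  -- 0`.
  have hθ := forall_pos_of_barrier (ι := Unit) (g := fun _ s => a s - 1 - h s) (t₀ := s₀) (t₁ := s)
    (fun _ => by have := T.contH; have := T.contA; fun_prop) (fun _ => hθ₀) (fun τ hτ _ _ hz => by
      have hI : τ ∈ Icc s₀ s := ⟨hτ.1.le, hτ.2⟩
      refine ⟨_, ?_, ((T.derivA τ).sub_const 1).sub (T.derivH τ)⟩
      have k1 := ha' τ hI
      have k2 := hpos τ hI
      have hq : Real.exp (-τ) ∈ Icc 0 q₁ := by
        refine ⟨(Real.exp_pos _).le, ?_⟩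
        rw [← hs₀]
        exact Real.exp_le_exp.2 (by linarith [hτ.1])
      have hh : h τ = a τ - 1 := by linarith
      rw [clamp_of_mem (x := a τ) ⟨k1.le, k2.2.le⟩,
        clamp_of_mem (x := h τ) ⟨by linarith, by linarith⟩, clamp_of_mem hq, hh, fieldA, fieldH]
      have hq1 : 0 < 1 - Real.exp (-τ) := by linarith [hq.2, T.lt_one]
      have e : a τ * (a τ - 1) / (2 * (1 + (a τ - 1))) -
          (-((a τ - 1) * (3 - a τ)) + (a τ - 1) *
          ((1 + Real.exp (-τ) * (2 * a τ - 5 - 2 * (a τ - 1))) / (1 - Real.exp (-τ)))) /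
          (2 * (1 + (a τ - 1))) = (a τ - 1) / (a τ * (1 - Real.exp (-τ))) := by
        have : a τ ≠ 0 := by linarith
        have e0 : 1 + (a τ - 1) = a τ := by ring
        rw [e0]
        field_simp
        ring
      rw [e]
      exact div_pos (by linarith) (mul_pos (by linarith) hq1))
  have hI : s ∈ Icc s₀ s := ⟨hs, le_rfl⟩
  have := hθ s hI ()
  exact ⟨ha' s hI, (hpos s hI).2, (hpos s hI).1, by linarith⟩

end Inner

/-! ### Analyticity away from `q = 0, 1`, and the shooting argument. -/

theorem contDiff_complex_slope {q a h : ℂ} (hq : q ≠ 0) (hq1 : 1 - q ≠ 0) (hh : 1 + h ≠ 0) :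
    ContDiffAt ℂ 1 (fun p : ℂ × ℂ × ℂ => slopeA p.1 p.2.1 p.2.2) (q, a, h) ∧
    ContDiffAt ℂ 1 (fun p : ℂ × ℂ × ℂ => slopeH p.1 p.2.1 p.2.2) (q, a, h) := by
  constructor
  · unfold slopeA
    exact ContDiffAt.div (by fun_prop) (by fun_prop) (mul_ne_zero (mul_ne_zero two_ne_zero hq) hh)
  · unfold slopeH
    refine ContDiffAt.div (ContDiffAt.sub (by fun_prop) (ContDiffAt.div (by fun_prop) (by fun_prop)
      hq1)) (by fun_prop) (mul_ne_zero (mul_ne_zero two_ne_zero hq) hh)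

/-- Solutions of the profile system are analytic away from `q = 0, 1`. -/
theorem analyticAt_of_slope {A H : ℝ → ℝ} {q : ℝ} (hq : q ≠ 0) (hq1 : q ≠ 1) (hh : 1 + H q ≠ 0)
    (hA : ∀ᶠ x in 𝓝 q, HasDerivAt A (slopeA x (A x) (H x)) x)
    (hH : ∀ᶠ x in 𝓝 q, HasDerivAt H (slopeH x (A x) (H x)) x) :
    AnalyticAt ℝ A q ∧ AnalyticAt ℝ H q := by
  have h1 : (1 : ℂ) - q ≠ 0 := by
    have : 1 - q ≠ 0 := sub_ne_zero.2 (Ne.symm hq1)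
    exact_mod_cast this
  obtain ⟨c1, c2⟩ := contDiff_complex_slope (q := (q : ℂ)) (a := (A q : ℂ)) (h := (H q : ℂ))
    (by exact_mod_cast hq) h1 (by exact_mod_cast hh)
  exact analyticAt_of_planar_ode (F₁ := slopeA) (F₂ := slopeH) c1 c2
    (fun x u v => by simp [slopeA]) (fun x u v => by simp [slopeH]) hA hH

namespace Inner

theorem contDiffOn_fieldA {q₁ : ℝ} :
    ContDiffOn ℝ 1 (fun p : ℝ × ℝ × ℝ => fieldA p.2.1 p.2.2)
      (Icc 0 q₁ ×ˢ Icc (3 / 2) 3 ×ˢ Icc (-1 / 2) 2) := by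
  unfold fieldA
  refine ContDiffOn.div (by fun_prop) (by fun_prop) fun p hp => ?_
  have := hp.2.2.1
  intro h
  linarith

theorem contDiffOn_fieldH {q₁ : ℝ} (hq₁ : q₁ < 1) :
    ContDiffOn ℝ 1 (fun p : ℝ × ℝ × ℝ => fieldH p.1 p.2.1 p.2.2)
      (Icc 0 q₁ ×ˢ Icc (3 / 2) 3 ×ˢ Icc (-1 / 2) 2) := by
  unfold fieldH
  refine ContDiffOn.div (ContDiffOn.add (by fun_prop) (ContDiffOn.mul (by fun_prop)
    (ContDiffOn.div (by fun_prop) (by fun_prop) fun p hp => ?_))) (by fun_prop) fun p hp => ?_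
  · have := hp.1.2
    intro h
    linarith
  · have := hp.2.2.1
    intro h
    linarith

/-- Shooting: there is a sonic point for which the inner solution exists down to `q = 0`. -/
theorem exists_solution : ∃ z ∈ Ioo (2 : ℝ) 3, ∃ r : ℝ, 0 < r ∧ ∃ A H : ℝ → ℝ,
    A 1 = z ∧ H 1 = z - 2 ∧
    (∀ q ∈ Ioo 0 (1 + r), AnalyticAt ℝ A q ∧ AnalyticAt ℝ H q ∧
      HasDerivAt A (slopeA q (A q) (H q)) q ∧
      (q ≠ 1 → HasDerivAt H (slopeH q (A q) (H q)) q)) ∧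
    (∀ q ∈ Ioc (0 : ℝ) 1, 3 / 2 < A q ∧ A q < 3 ∧ 0 < H q ∧ H q < A q - 1) ∧
    ∀ q ∈ Ioo 1 (1 + r), 3 / 2 < A q ∧ A q < 3 ∧ 0 < H q ∧ H q < A q - 1 ∧ A q - 2 < H q := by
  obtain ⟨r, hr, hr4, A₀, H₀, hcont, hfam⟩ := Sonic.exists_family
  -- The flow starts inside the domain of the local family, strictly below `q = 1`, where the field
  -- for `h` is regular.
  set q₁ := 1 - r / 2 with hq₁
  have hq₁0 : 0 < q₁ := by linarith
  have hq₁1 : q₁ < 1 := by linarith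
  have hmem : q₁ ∈ Ioo (1 - r) (1 + r) := ⟨by linarith, by linarith⟩
  obtain ⟨Φ, Ψ, hΦ0, hΦ, hΨ, hΦc⟩ := exists_clamped_flow (q₀ := 0) (q₁ := q₁) (a₀ := 3 / 2)
    (a₁ := 3) (b₀ := -1 / 2) (b₁ := 2) hq₁0.le (by norm_num) (by norm_num)
    (f₁ := fun _ a h => fieldA a h) (f₂ := fieldH) (κ := fun s => Real.exp (-s)) (by fun_prop)
    contDiffOn_fieldA (contDiffOn_fieldH hq₁1) (-Real.log q₁)
  set s₀ := -Real.log q₁ with hs₀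
  have hes₀ : Real.exp (-s₀) = q₁ := by rw [hs₀, neg_neg, Real.exp_log hq₁0]
  -- Clamping the parameter makes the initial data continuous on all of `ℝ`, so the two shooting
  -- sets are genuinely open.
  let ζ : ℝ → ℝ := clamp 2 3
  have hζ : ∀ z, ζ z ∈ Icc (2 : ℝ) 3 := fun z => clamp_mem (by norm_num) z
  have hζc : Continuous ζ := (lipschitzWith_clamp 2 3).continuous
  let u : ℝ → ℝ × ℝ := fun z => (A₀ (ζ z) q₁, H₀ (ζ z) q₁)
  have huc : Continuous u :=
    ((hcont q₁ hmem).1.comp_continuous hζc hζ).prodMk ((hcont q₁ hmem).2.comp_continuous hζc hζ)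
  have hT : ∀ z, Trajectory q₁ (Φ (u z)) (Ψ (u z)) := fun z =>
    { pos := hq₁0, lt_one := hq₁1, derivA := hΦ (u z), derivH := hΨ (u z) }
  let UA : Set ℝ := ⋃ s ∈ Ici s₀, {z | 3 < Φ (u z) s ∧ 0 < Ψ (u z) s}
  let UB : Set ℝ := ⋃ s ∈ Ici s₀, {z | Φ (u z) s < 3 ∧ Ψ (u z) s < 0}
  have hUA : IsOpen UA := isOpen_biUnion fun s hs =>
    (isOpen_lt continuous_const ((hΦc s hs).1.comp huc)).inter
      (isOpen_lt continuous_const ((hΦc s hs).2.comp huc))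
  have hUB : IsOpen UB := isOpen_biUnion fun s hs =>
    (isOpen_lt ((hΦc s hs).1.comp huc) continuous_const).inter
      (isOpen_lt ((hΦc s hs).2.comp huc) continuous_const)
  have hdisj : ¬ ((Icc (2 : ℝ) 3) ∩ (UA ∩ UB)).Nonempty := by
    rintro ⟨z, -, hzA, hzB⟩
    simp only [UA, UB, mem_iUnion, mem_ofPred_eq] at hzA hzB
    obtain ⟨s, -, h1, h2⟩ := hzA
    obtain ⟨t, -, h3, h4⟩ := hzB
    rcases le_total s t with hst | hst
    · have := ((hT z).pos_of_pos h2 h1 hst).1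
      linarith
    · have := (hT z).neg_of_neg h4 hst
      linarith
  have hz₀ : ∀ z, Φ (u z) s₀ = A₀ (ζ z) q₁ ∧ Ψ (u z) s₀ = H₀ (ζ z) q₁ := fun z => hΦ0 (u z)
  -- At `z = 2` one has `α₀ = 0` and `φ₀ = 1/2`, so `h = x(w - 1/2 - v) < 0` already at `q₁`. At `z
  -- = 3`, treated next, `α₀ = 3/4` pushes `a` above `3` while `h` is near `1`.
  have h2B : (2 : ℝ) ∈ UB := by
    have hζ2 : ζ 2 = 2 := clamp_of_mem (by norm_num)
    obtain ⟨-, -, hf⟩ := hfam 2 (by norm_num)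
    obtain ⟨-, -, -, -, w, v, hw, hv, e1, e2⟩ := hf q₁ hmem
    simp only [UB, mem_iUnion, mem_ofPred_eq]
    refine ⟨s₀, le_refl s₀, ?_⟩
    rw [(hz₀ 2).1, (hz₀ 2).2, hζ2, e1, e2]
    have ea : Sonic.α₀ (2 : ℝ) = 0 := by norm_num [Sonic.α₀]
    have eφ : Sonic.φ₀ (2 : ℝ) = 1 / 2 := by norm_num [Sonic.φ₀]
    rw [ea, eφ]
    rw [abs_le] at hw hv
    constructor <;> nlinarith
  have h3A : (3 : ℝ) ∈ UA := by
    have hζ3 : ζ 3 = 3 := clamp_of_mem (by norm_num)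
    obtain ⟨-, -, hf⟩ := hfam 3 (by norm_num)
    obtain ⟨-, -, -, -, w, v, hw, hv, e1, e2⟩ := hf q₁ hmem
    simp only [UA, mem_iUnion, mem_ofPred_eq]
    refine ⟨s₀, le_refl s₀, ?_⟩
    rw [(hz₀ 3).1, (hz₀ 3).2, hζ3, e1, e2]
    have ea : Sonic.α₀ (3 : ℝ) = 3 / 4 := by norm_num [Sonic.α₀]
    have eφ : Sonic.φ₀ (3 : ℝ) = 1 / 3 := by norm_num [Sonic.φ₀]
    rw [ea, eφ]
    rw [abs_le] at hw hv
    constructor <;> nlinarith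
  obtain ⟨z, hz, hzA, hzB⟩ : ∃ z ∈ Icc (2 : ℝ) 3, z ∉ UA ∧ z ∉ UB := by
    by_contra! hcon
    refine hdisj (isPreconnected_Icc UA UB hUA hUB (fun z hz => ?_) ⟨3, by norm_num, h3A⟩
      ⟨2, by norm_num, h2B⟩)
    by_cases hzA : z ∈ UA
    · exact Or.inl hzA
    · exact Or.inr (hcon z hz hzA)
  have hzo : z ∈ Ioo (2 : ℝ) 3 := by
    refine ⟨lt_of_le_of_ne hz.1 ?_, lt_of_le_of_ne hz.2 ?_⟩
    · rintro rfl; exact hzB h2B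
    · rintro rfl; exact hzA h3A
  obtain ⟨hA1, hH1, hf⟩ := hfam z hz
  have hα := Sonic.α₀_mem hz
  have hφ := Sonic.φ₀_mem hz
  -- The last clause keeps the corner away: `a ≥ 3` this close to `q = 1` forces `z` near `3`, and
  -- then `h` is near `z - 2`.
  have hleft : ∀ q ∈ Ioc (1 - r) 1, 3 / 2 < A₀ z q ∧ H₀ z q < A₀ z q - 1 ∧
      (3 ≤ A₀ z q → 0 < H₀ z q) := by
    intro q hq
    obtain ⟨-, -, -, -, w, v, hw, hv, e1, e2⟩ := hf q ⟨hq.1, by linarith [hq.2]⟩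
    rw [abs_le] at hw hv
    have x0 : 0 ≤ 1 - q := by linarith [hq.2]
    have x1 : 1 - q ≤ 1 / 4 := by linarith [hq.1]
    rw [e1, e2]
    refine ⟨?_, ?_, fun h3 => ?_⟩
    · nlinarith [hα.1, hz.1]
    · nlinarith [hφ.1]
    · nlinarith [hα.1, hα.2, hφ.2, hz.1, hz.2]
  have hright : ∀ q ∈ Ioo 1 (1 + r), 3 / 2 < A₀ z q ∧ A₀ z q < 3 ∧ 0 < H₀ z q ∧
      H₀ z q < A₀ z q - 1 ∧ A₀ z q - 2 < H₀ z q := by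
    intro q hq
    obtain ⟨-, -, -, -, w, v, hw, hv, e1, e2⟩ := hf q ⟨by linarith [hq.1], hq.2⟩
    rw [abs_le] at hw hv
    obtain ⟨ξ, rfl⟩ : ∃ ξ, q = 1 + ξ := ⟨q - 1, by ring⟩
    have x0 : 0 < ξ := by linarith [hq.1]
    have x1 : ξ ≤ 1 / 4 := by linarith [hq.2]
    have ex : 1 - (1 + ξ) = -ξ := by ring
    rw [e1, e2, ex]
    refine ⟨?_, ?_, ?_, ?_, ?_⟩
    · nlinarith [hα.2, hz.1, hz.2]
    -- For `z ≤ 9/4` there is room below `3`; for larger `z` the coefficient `α₀ ≥ 1/8` absorbs `w`,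
    -- so `a` does not exceed `z`.
    · rcases le_total z (9 / 4) with h | h
      · nlinarith [hα.1, hz.1]
      · have : 0 ≤ Sonic.α₀ z + w := by linarith [hα.1]
        nlinarith [hzo.2]
    · nlinarith [hα.2, hφ.1, hzo.1, mul_pos x0 (by linarith [hzo.1] : 0 < z - 2)]
    · nlinarith [hφ.2]
    · nlinarith [mul_pos x0 (by linarith [hφ.1] : 0 < Sonic.φ₀ z + v)]
  have hζz : ζ z = z := clamp_of_mem hz
  obtain ⟨hz1, hz2⟩ := hz₀ z
  rw [hζz] at hz1 hz2
  have hq₁mem : q₁ ∈ Ioc (1 - r) 1 := ⟨hmem.1, hq₁1.le⟩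
  obtain ⟨l1, l2, l3⟩ := hleft q₁ hq₁mem
  have hcrit : ∀ s, s₀ ≤ s → 3 / 2 < Φ (u z) s ∧ Φ (u z) s < 3 ∧ 0 < Ψ (u z) s ∧
      Ψ (u z) s < Φ (u z) s - 1 := fun s hs =>
    (hT z).critical hes₀ (by rw [hz1]; exact l1) (by rw [hz1, hz2]; linarith)
      (by rw [hz1, hz2]; exact l3)
      (fun s hs h => hzA (mem_iUnion₂.2 ⟨s, hs, h⟩)) (fun s hs h => hzB (mem_iUnion₂.2 ⟨s, hs, h⟩)) hs
  let AL : ℝ → ℝ := fun q => Φ (u z) (-Real.log q)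
  let HL : ℝ → ℝ := fun q => Ψ (u z) (-Real.log q)
  have hlog : ∀ q ∈ Ioc 0 q₁, s₀ ≤ -Real.log q := fun q hq => by
    rw [hs₀]
    exact neg_le_neg (Real.log_le_log hq.1 hq.2)
  have hLb : ∀ q ∈ Ioc 0 q₁, 3 / 2 < AL q ∧ AL q < 3 ∧ 0 < HL q ∧ HL q < AL q - 1 :=
    fun q hq => hcrit _ (hlog q hq)
  have hLd : ∀ q ∈ Ioc 0 q₁, HasDerivAt AL (slopeA q (AL q) (HL q)) q ∧
      HasDerivAt HL (slopeH q (AL q) (HL q)) q := by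
    intro q hq
    have hl : HasDerivAt (fun q => -Real.log q) (-q⁻¹) q := (Real.hasDerivAt_log hq.1.ne').neg
    have b := hLb q hq
    have hA := (hΦ (u z) (-Real.log q)).comp q hl
    have hH := (hΨ (u z) (-Real.log q)).comp q hl
    rw [neg_neg, Real.exp_log hq.1] at hH
    have c1 : clamp 0 q₁ q = q := clamp_of_mem ⟨hq.1.le, hq.2⟩
    have c2 : clamp (3 / 2) 3 (Φ (u z) (-Real.log q)) = AL q :=
      clamp_of_mem ⟨b.1.le, b.2.1.le⟩
    have c3 : clamp (-1 / 2) 2 (Ψ (u z) (-Real.log q)) = HL q :=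
      clamp_of_mem (x := HL q) ⟨by linarith, by linarith⟩
    rw [c2, c3] at hA
    rw [c1, c2, c3] at hH
    have n1 : 1 + HL q ≠ 0 := by linarith
    have n2 : q ≠ 0 := hq.1.ne'
    have n3 : 1 - q ≠ 0 := by linarith [hq.2]
    constructor
    · refine hA.congr_deriv ?_
      rw [fieldA, slopeA]
      field_simp
    · refine hH.congr_deriv ?_
      rw [fieldH, slopeH]
      field_simp
      ring
  let A : ℝ → ℝ := fun q => if q ≤ q₁ then AL q else A₀ z q
  let H : ℝ → ℝ := fun q => if q ≤ q₁ then HL q else H₀ z q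
  have hAgt : ∀ q, q₁ < q → A q = A₀ z q ∧ H q = H₀ z q := fun q hq =>
    ⟨if_neg (not_le.2 hq), if_neg (not_le.2 hq)⟩
  have hAle : ∀ q, q ≤ q₁ → A q = AL q ∧ H q = HL q := fun q hq => ⟨if_pos hq, if_pos hq⟩
  have hgtev : ∀ q, q₁ < q → A =ᶠ[𝓝 q] A₀ z ∧ H =ᶠ[𝓝 q] H₀ z := fun q hq =>
    ⟨by filter_upwards [lt_mem_nhds hq] with x hx using (hAgt x hx).1,
      by filter_upwards [lt_mem_nhds hq] with x hx using (hAgt x hx).2⟩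
  have hderiv : ∀ q ∈ Ioo 0 (1 + r), HasDerivAt A (slopeA q (A q) (H q)) q ∧
      (q ≠ 1 → HasDerivAt H (slopeH q (A q) (H q)) q) := by
    intro q hq
    rcases lt_trichotomy q q₁ with h | h | h
    · have hd := hLd q ⟨hq.1, h.le⟩
      rw [(hAle q h.le).1, (hAle q h.le).2]
      refine ⟨hd.1.congr_of_eventuallyEq ?_, fun _ => hd.2.congr_of_eventuallyEq ?_⟩
      · filter_upwards [gt_mem_nhds h] with x hx using (hAle x (le_of_lt hx)).1
      · filter_upwards [gt_mem_nhds h] with x hx using (hAle x (le_of_lt hx)).2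
    · subst h
      have hd := hLd q₁ ⟨hq.1, le_rfl⟩
      obtain ⟨-, -, d1, d2, -⟩ := hf q₁ hmem
      have e1 : AL q₁ = A₀ z q₁ := hz1
      have e2 : HL q₁ = H₀ z q₁ := hz2
      rw [(hAle q₁ le_rfl).1, (hAle q₁ le_rfl).2]
      rw [e1, e2] at hd ⊢
      exact ⟨hd.1.glue d1 e1, fun hne => hd.2.glue (d2 hne) e2⟩
    · obtain ⟨-, -, d1, d2, -⟩ := hf q ⟨by linarith, hq.2⟩
      rw [(hAgt q h).1, (hAgt q h).2]
      exact ⟨d1.congr_of_eventuallyEq (hgtev q h).1,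
        fun hne => (d2 hne).congr_of_eventuallyEq (hgtev q h).2⟩
  -- Between `q₁` and `1` the solution is the local one, so the strict inequalities at `q₁` are
  -- carried forward in `q` by a barrier. The barrier stops short of `q = 1`, where `a = z` and `h =
  -- z - 2` are used instead.
  have hmid : ∀ q ∈ Icc q₁ 1, 0 < H₀ z q ∧ A₀ z q < 3 := by
    have hlt : ∀ q₂, q₁ ≤ q₂ → q₂ < 1 → ∀ q ∈ Icc q₁ q₂, 0 < H₀ z q ∧ A₀ z q < 3 := by
      intro q₂ h12 h2 q hq
      have hb := hLb q₁ ⟨hq₁0, le_rfl⟩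
      rw [show AL q₁ = A₀ z q₁ from hz1, show HL q₁ = H₀ z q₁ from hz2] at hb
      have hd : ∀ q ∈ Icc q₁ q₂, HasDerivAt (A₀ z) (slopeA q (A₀ z q) (H₀ z q)) q ∧
          HasDerivAt (H₀ z) (slopeH q (A₀ z q) (H₀ z q)) q := fun q hq => by
        obtain ⟨-, -, d1, d2, -⟩ := hf q ⟨by linarith [hq.1], by linarith [hq.2]⟩
        exact ⟨d1, d2 (by linarith [hq.2])⟩
      have key := forall_pos_of_barrier (ι := Fin 2) (g := ![H₀ z, fun q => 3 - A₀ z q])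
        (t₀ := q₁) (t₁ := q₂) (by
          intro i
          fin_cases i
          · exact fun x hx => (hd x hx).2.continuousAt.continuousWithinAt
          · exact fun x hx => ((hd x hx).1.const_sub 3).continuousAt.continuousWithinAt) (by
          intro i
          fin_cases i
          · exact hb.2.2.1
          · exact sub_pos.2 hb.2.1) (by
          intro x hx hnn i hi
          have n0 : 0 ≤ H₀ z x := hnn 0
          have n1 : 0 ≤ 3 - A₀ z x := hnn 1
          have hx' : x ∈ Icc q₁ q₂ := ⟨hx.1.le, hx.2⟩
          have hx0 : 0 < x := by linarith [hx.1]
          obtain ⟨m1, m2, m3⟩ := hleft x ⟨by linarith [hx.1], by linarith [hx.2]⟩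
          fin_cases i
          · have hi : H₀ z x = 0 := hi
            refine ⟨_, ?_, (hd x hx').2⟩
            have : A₀ z x < 3 := by
              by_contra! hcon
              linarith [m3 hcon]
            rw [slopeH, hi]
            have k1 : 0 < (A₀ z x - 1) * (3 - A₀ z x) := mul_pos (by linarith) (by linarith)
            simp only [zero_mul, zero_div, sub_zero, add_zero, mul_one]
            positivity
          · have hi : 3 - A₀ z x = 0 := hi
            refine ⟨_, ?_, (hd x hx').1.const_sub 3⟩
            have hH := m3 (by linarith)
            have hA : 0 < A₀ z x := by linarith
            rw [slopeA, neg_div, neg_neg]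
            positivity) q hq
      have k0 := key 0
      have k1 := key 1
      exact ⟨k0, sub_pos.1 k1⟩
    intro q hq
    rcases eq_or_lt_of_le hq.2 with h | h
    · rw [h, hA1, hH1]
      exact ⟨by linarith [hzo.1], hzo.2⟩
    · exact hlt q hq.1 h q ⟨hq.1, le_rfl⟩
  have hbound : ∀ q ∈ Ioc (0 : ℝ) 1, 3 / 2 < A q ∧ A q < 3 ∧ 0 < H q ∧ H q < A q - 1 := by
    intro q hq
    rcases le_or_gt q q₁ with h | h
    · rw [(hAle q h).1, (hAle q h).2]
      exact hLb q ⟨hq.1, h⟩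
    · rw [(hAgt q h).1, (hAgt q h).2]
      obtain ⟨m1, m2, -⟩ := hleft q ⟨by linarith, hq.2⟩
      obtain ⟨m3, m4⟩ := hmid q ⟨h.le, hq.2⟩
      exact ⟨m1, m4, m3, m2⟩
  refine ⟨z, hzo, r, hr, A, H, ?_, ?_, fun q hq => ?_, hbound, fun q hq => ?_⟩
  · rw [(hAgt 1 hq₁1).1, hA1]
  · rw [(hAgt 1 hq₁1).2, hH1]
  · refine and_assoc.1 ⟨?_, hderiv q hq⟩
    rcases le_or_gt q q₁ with h | h
    · have hq1 : q < 1 := by linarith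
      have hev : ∀ᶠ x in 𝓝 q, x ∈ Ioo (0 : ℝ) 1 := isOpen_Ioo.mem_nhds ⟨hq.1, hq1⟩
      refine analyticAt_of_slope hq.1.ne' hq1.ne (by linarith [(hbound q ⟨hq.1, hq1.le⟩).2.2.1]) ?_ ?_
      · filter_upwards [hev] with x hx using (hderiv x ⟨hx.1, by linarith [hx.2]⟩).1
      · filter_upwards [hev] with x hx using (hderiv x ⟨hx.1, by linarith [hx.2]⟩).2 hx.2.ne
    · obtain ⟨a1, a2, -⟩ := hf q ⟨by linarith, hq.2⟩
      exact ⟨a1.congr (hgtev q h).1.symm, a2.congr (hgtev q h).2.symm⟩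
  · rw [(hAgt q (by linarith [hq.1])).1, (hAgt q (by linarith [hq.1])).2]
    exact hright q hq

end Inner

/-! ### The supersonic side: trapping and behaviour at infinity in `σ = log q`. -/

theorem MonotoneOn.exists_tendsto_atTop {f : ℝ → ℝ} {q₀ B : ℝ} (hf : MonotoneOn f (Ici q₀))
    (hB : ∀ q, q₀ ≤ q → f q ≤ B) :
    ∃ l, Tendsto f atTop (𝓝 l) ∧ ∀ q, q₀ ≤ q → f q ≤ l := by
  have hm : Monotone fun q => f (max q q₀) := fun x y hxy =>
    hf (mem_Ici.2 (le_max_right _ _)) (mem_Ici.2 (le_max_right _ _)) (max_le_max hxy le_rfl)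
  have hb : BddAbove (range fun q => f (max q q₀)) :=
    ⟨B, by rintro _ ⟨q, rfl⟩; exact hB _ (le_max_right _ _)⟩
  refine ⟨_, (tendsto_atTop_ciSup hm hb).congr' ?_, fun q hq => ?_⟩
  · filter_upwards [eventually_ge_atTop q₀] with q hq
    rw [max_eq_left hq]
  · have := le_ciSup hb q
    simpa [max_eq_left hq] using this

theorem monotoneOn_Ici_of_hasDerivAt {f f' : ℝ → ℝ} {q₀ : ℝ}
    (hf : ∀ q, q₀ ≤ q → HasDerivAt f (f' q) q) (hf' : ∀ q, q₀ ≤ q → 0 ≤ f' q) :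
    MonotoneOn f (Ici q₀) := by
  refine monotoneOn_of_deriv_nonneg (convex_Ici _)
    (fun q hq => (hf q hq).continuousAt.continuousWithinAt)
    (fun q hq => (hf q (interior_subset hq)).differentiableAt.differentiableWithinAt) fun q hq => ?_
  rw [(hf q (interior_subset hq)).deriv]
  exact hf' q (interior_subset hq)

namespace Outer

/-- `da/dσ` with `σ = log q`. -/
noncomputable def fieldA (a h : ℝ) : ℝ := -(a * h) / (2 * (1 + h))

/-- `dh/dσ` with `σ = log q`, as a function of `p = 1 / q`. -/
noncomputable def fieldH (p a h : ℝ) : ℝ :=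
  ((a - 1) * (3 - a) + h * ((p + (2 * a - 5 - 2 * h)) / (1 - p))) / (2 * (1 + h))

theorem contDiffOn_fieldA {p₁ : ℝ} :
    ContDiffOn ℝ 1 (fun p : ℝ × ℝ × ℝ => fieldA p.2.1 p.2.2)
      (Icc 0 p₁ ×ˢ Icc 1 3 ×ˢ Icc (-1 / 2) 2) := by
  unfold fieldA
  refine ContDiffOn.div (by fun_prop) (by fun_prop) fun p hp => ?_
  have := hp.2.2.1
  intro h
  linarith

theorem contDiffOn_fieldH {p₁ : ℝ} (hp₁ : p₁ < 1) :
    ContDiffOn ℝ 1 (fun p : ℝ × ℝ × ℝ => fieldH p.1 p.2.1 p.2.2)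
      (Icc 0 p₁ ×ˢ Icc 1 3 ×ˢ Icc (-1 / 2) 2) := by
  unfold fieldH
  refine ContDiffOn.div (ContDiffOn.add (by fun_prop) (ContDiffOn.mul (by fun_prop)
    (ContDiffOn.div (by fun_prop) (by fun_prop) fun p hp => ?_))) (by fun_prop) fun p hp => ?_
  · have := hp.1.2
    intro h
    linarith
  · have := hp.2.2.1
    intro h
    linarith

/-- The field points inwards on the faces `h = 0`, `θ = 0`, `θ = 1/2` and `a = 3`. The level `a = 1`
is not reached in finite `σ`: `a - 1` decays at rate at most `3/2`, since `h ≤ a - 1`, and the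
weight with rate `2` beats this. -/
theorem trapping {p₁ σ₀ : ℝ} {a h : ℝ → ℝ} (hp₁ : p₁ < 1) (hσ₀ : Real.exp (-σ₀) = p₁)
    (dA : ∀ s, HasDerivAt a (fieldA (clamp 1 3 (a s)) (clamp (-1 / 2) 2 (h s))) s)
    (dH : ∀ s, HasDerivAt h (fieldH (clamp 0 p₁ (Real.exp (-s))) (clamp 1 3 (a s))
      (clamp (-1 / 2) 2 (h s))) s)
    (h3 : a σ₀ < 3) (h0 : 0 < h σ₀) (hθ : h σ₀ < a σ₀ - 1)
    (hθ' : a σ₀ - 2 < h σ₀) {s : ℝ} (hs : σ₀ ≤ s) :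
    1 < a s ∧ a s < 3 ∧ 0 < h s ∧ h s < a s - 1 ∧ a s - 2 < h s := by
  have ca : Continuous a := continuous_iff_continuousAt.2 fun s => (dA s).continuousAt
  have ch : Continuous h := continuous_iff_continuousAt.2 fun s => (dH s).continuousAt
  set c := (a σ₀ - 1) / 2 * Real.exp (2 * σ₀) with hc
  have hc0 : 0 < c := mul_pos (by linarith) (Real.exp_pos _)
  have hw : ∀ τ, 0 < c * Real.exp (-2 * τ) := fun τ => mul_pos hc0 (Real.exp_pos _)
  have key := forall_pos_of_barrier (ι := Fin 5) (g := ![h, fun s => a s - 1 - h s,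
    fun s => h s - a s + 2, fun s => 3 - a s, fun s => a s - 1 - c * Real.exp (-2 * s)])
    (t₀ := σ₀) (t₁ := s)
    (by
      intro i
      fin_cases i <;> simp <;> fun_prop) (by
      intro i
      fin_cases i
      · exact h0
      · exact show 0 < a σ₀ - 1 - h σ₀ by linarith
      · exact show 0 < h σ₀ - a σ₀ + 2 by linarith
      · exact show 0 < 3 - a σ₀ by linarith
      · have := Inner.exp_weight_lt (x := a σ₀ - 1) (D := 2) (t := σ₀) (by linarith)
        exact show 0 < a σ₀ - 1 - c * Real.exp (-2 * σ₀) by rw [hc]; linarith) (by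
      intro τ hτ hnn i hz
      have n0 : 0 ≤ h τ := hnn 0
      have n1 : 0 ≤ a τ - 1 - h τ := hnn 1
      have n2 : 0 ≤ h τ - a τ + 2 := hnn 2
      have n3 : 0 ≤ 3 - a τ := hnn 3
      have n4 : 0 ≤ a τ - 1 - c * Real.exp (-2 * τ) := hnn 4
      have hwτ := hw τ
      have hp : Real.exp (-τ) ∈ Icc 0 p₁ := by
        refine ⟨(Real.exp_pos _).le, ?_⟩
        rw [← hσ₀]
        exact Real.exp_le_exp.2 (by linarith [hτ.1])
      have dA' := dA τ
      have dH' := dH τ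
      rw [clamp_of_mem (x := a τ) ⟨by linarith, by linarith⟩,
        clamp_of_mem (x := h τ) ⟨by linarith, by linarith⟩] at dA' dH'
      rw [clamp_of_mem hp] at dH'
      have hp0 := Real.exp_pos (-τ)
      have hp1 : 0 < 1 - Real.exp (-τ) := by linarith [hp.2]
      generalize Real.exp (-τ) = p at *
      fin_cases i
      · have hz : h τ = 0 := hz
        refine ⟨_, ?_, dH'⟩
        rw [fieldH, hz]
        have : 0 < (a τ - 1) * (3 - a τ) := mul_pos (by linarith) (by linarith)
        simp only [zero_mul, add_zero, mul_one]
        positivity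
      · have hz : a τ - 1 - h τ = 0 := hz
        refine ⟨_, ?_, (dA'.sub_const 1).sub dH'⟩
        have hh : h τ = a τ - 1 := by linarith
        have e : fieldA (a τ) (h τ) - fieldH p (a τ) (h τ) =
            (a τ - 1) * p / (a τ * (1 - p)) := by
          rw [fieldA, fieldH, hh]
          have : a τ ≠ 0 := by linarith
          have e0 : 1 + (a τ - 1) = a τ := by ring
          rw [e0]
          field_simp
          ring
        rw [e]
        exact div_pos (mul_pos (by linarith) hp0) (mul_pos (by linarith) hp1)
      · have hz : h τ - a τ + 2 = 0 := hz
        refine ⟨_, ?_, (dH'.sub dA').add_const 2⟩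
        have hh : h τ = a τ - 2 := by linarith
        have e : fieldH p (a τ) (h τ) - fieldA (a τ) (h τ) = 1 / 2 := by
          rw [fieldA, fieldH, hh]
          have : a τ - 1 ≠ 0 := by linarith
          have e0 : 1 + (a τ - 2) = a τ - 1 := by ring
          rw [e0]
          field_simp
          ring
        rw [e]
        norm_num
      · have hz : 3 - a τ = 0 := hz
        refine ⟨_, ?_, dA'.const_sub 3⟩
        have h1 : 0 < h τ := by linarith
        have h2 : 0 < a τ := by linarith
        rw [fieldA, neg_div, neg_neg]
        positivity
      · have hz : a τ - 1 - c * Real.exp (-2 * τ) = 0 := hz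
        refine ⟨_, ?_, (dA'.sub_const 1).sub (Inner.hasDerivAt_exp_weight c 2 τ)⟩
        have h2 : a τ * h τ / (2 * (1 + h τ)) ≤ 3 / 2 * (a τ - 1) := by
          rw [div_le_iff₀ (by linarith)]
          nlinarith [mul_nonneg n3 n0, mul_nonneg n0 (by linarith : 0 ≤ a τ - 1)]
        rw [fieldA, neg_div]
        linarith)
  have hI : s ∈ Icc σ₀ s := ⟨hs, le_rfl⟩
  have k0 : 0 < h s := key s hI 0
  have k1 : 0 < a s - 1 - h s := key s hI 1
  have k2 : 0 < h s - a s + 2 := key s hI 2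
  have k3 : 0 < 3 - a s := key s hI 3
  exact ⟨by linarith, by linarith, k0, by linarith, by linarith⟩

/-- The outer solution. -/
theorem exists_solution {q₀ a₀ h₀ : ℝ} (hq₀ : 1 < q₀) (h3 : a₀ < 3) (h0 : 0 < h₀)
    (hθ : h₀ < a₀ - 1) (hθ' : a₀ - 2 < h₀) :
    ∃ A H : ℝ → ℝ, A q₀ = a₀ ∧ H q₀ = h₀ ∧ ∀ q, q₀ ≤ q →
      HasDerivAt A (slopeA q (A q) (H q)) q ∧ HasDerivAt H (slopeH q (A q) (H q)) q ∧
      1 < A q ∧ A q < 3 ∧ 0 < H q ∧ H q < A q - 1 ∧ A q - 2 < H q := by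
  have hq₀0 : 0 < q₀ := by linarith
  have hp₁ : q₀⁻¹ < 1 := inv_lt_one_of_one_lt₀ hq₀
  obtain ⟨Φ, Ψ, hΦ0, hΦ, hΨ, -⟩ := exists_clamped_flow (q₀ := 0) (q₁ := q₀⁻¹) (a₀ := 1)
    (a₁ := 3) (b₀ := -1 / 2) (b₁ := 2) (by positivity) (by norm_num) (by norm_num)
    (f₁ := fun _ a h => fieldA a h) (f₂ := fieldH) (κ := fun s => Real.exp (-s)) (by fun_prop)
    contDiffOn_fieldA (contDiffOn_fieldH hp₁) (Real.log q₀)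
  have hσ₀ : Real.exp (-Real.log q₀) = q₀⁻¹ := by rw [Real.exp_neg, Real.exp_log hq₀0]
  obtain ⟨i1, i2⟩ := hΦ0 (a₀, h₀)
  have htrap : ∀ s, Real.log q₀ ≤ s → _ := fun s hs =>
    trapping hp₁ hσ₀ (hΦ (a₀, h₀)) (hΨ (a₀, h₀)) (by rw [i1]; exact h3)
      (by rw [i2]; exact h0) (by rw [i1, i2]; exact hθ) (by rw [i1, i2]; exact hθ') hs
  refine ⟨fun q => Φ (a₀, h₀) (Real.log q), fun q => Ψ (a₀, h₀) (Real.log q), i1, i2,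
    fun q hq => ?_⟩
  have hq0 : 0 < q := by linarith
  have b := htrap (Real.log q) (Real.log_le_log hq₀0 hq)
  have hl := Real.hasDerivAt_log hq0.ne'
  have hA := (hΦ (a₀, h₀) (Real.log q)).comp q hl
  have hH := (hΨ (a₀, h₀) (Real.log q)).comp q hl
  rw [Real.exp_neg, Real.exp_log hq0] at hH
  have c1 : clamp 0 q₀⁻¹ q⁻¹ = q⁻¹ :=
    clamp_of_mem ⟨by positivity, inv_anti₀ hq₀0 hq⟩
  have c2 : clamp 1 3 (Φ (a₀, h₀) (Real.log q)) = Φ (a₀, h₀) (Real.log q) :=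
    clamp_of_mem ⟨b.1.le, b.2.1.le⟩
  have c3 : clamp (-1 / 2) 2 (Ψ (a₀, h₀) (Real.log q)) = Ψ (a₀, h₀) (Real.log q) :=
    clamp_of_mem ⟨by linarith, by linarith⟩
  rw [c2, c3] at hA
  rw [c1, c2, c3] at hH
  have n1 : 1 + Ψ (a₀, h₀) (Real.log q) ≠ 0 := by linarith
  have n3 : 1 - q ≠ 0 := by linarith
  have n4 : q - 1 ≠ 0 := by linarith
  refine ⟨hA.congr_deriv ?_, hH.congr_deriv ?_, b⟩
  · rw [fieldA, slopeA]
    field_simp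
  · rw [fieldH, slopeH]
    have e : 1 - q⁻¹ = (q - 1) / q := by field_simp
    have e2 : 1 - q = -(q - 1) := by ring
    rw [e, e2]
    field_simp
    ring

/-- Behaviour of the outer solution at infinity. -/
theorem asymptotics {A H : ℝ → ℝ} {q₀ : ℝ} (hq₀ : 1 < q₀)
    (hs : ∀ q, q₀ ≤ q →
      HasDerivAt A (slopeA q (A q) (H q)) q ∧ HasDerivAt H (slopeH q (A q) (H q)) q ∧
      1 < A q ∧ A q < 3 ∧ 0 < H q ∧ H q < A q - 1 ∧ A q - 2 < H q) :
    Tendsto A atTop (𝓝 1) ∧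
    ∃ k, 0 < k ∧ Tendsto (fun q => (1 - (A q - 1 - H q) / 2 * (1 - q)) * A q) atTop (𝓝 k) := by
  -- The constant that turns `1/(q - 1)` into a multiple of `1/q`, which has an elementary primitive
  -- in `log q`.
  set C := q₀ / (q₀ - 1) with hC
  have hCq : ∀ q, q₀ ≤ q → 1 / (q - 1) ≤ C / q := fun q hq => by
    rw [hC, div_div, div_le_div_iff₀ (by linarith) (mul_pos (by linarith) (by linarith))]
    nlinarith
  -- The damping `q θ' ≤ C/q - θ/2` lets `2θ + 2C/q` serve as a Lyapunov correction that pays for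
  -- error terms of size `θ`. It uses `θ < 1/2`, through `3 - a + 2h ≥ 1 + h`.
  let θ : ℝ → ℝ := fun q => (A q - 1 - H q) / 2
  have hθd : ∀ q, q₀ ≤ q → ∃ d, HasDerivAt θ d q ∧ q * d ≤ C / q - θ q / 2 ∧
      (q - 1) * d = ((A q - 1) * (1 - θ q) - θ q * q * (3 - A q + 2 * H q)) /
        (2 * q * (1 + H q)) := by
    intro q hq
    obtain ⟨dA, dH, b1, b2, b3, b4, b5⟩ := hs q hq
    have n0 : q ≠ 0 := by linarith
    have n1 : 1 + H q ≠ 0 := by linarith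
    have n3 : 1 - q ≠ 0 := by linarith
    have n4 : 0 < q - 1 := by linarith
    have e : (q - 1) * ((slopeA q (A q) (H q) - slopeH q (A q) (H q)) / 2) =
        ((A q - 1) * (1 - θ q) - θ q * q * (3 - A q + 2 * H q)) / (2 * q * (1 + H q)) := by
      simp only [slopeA, slopeH, θ]
      field_simp
      ring
    refine ⟨_, ((dA.sub_const 1).sub dH).div_const 2, ?_, e⟩
    have h2 : q * ((slopeA q (A q) (H q) - slopeH q (A q) (H q)) / 2) =
        ((A q - 1) * (1 - θ q) - θ q * q * (3 - A q + 2 * H q)) /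
          ((q - 1) * (2 * (1 + H q))) := by
      rw [eq_div_iff (mul_ne_zero n4.ne' (mul_ne_zero two_ne_zero n1))]
      rw [eq_div_iff (mul_ne_zero (mul_ne_zero two_ne_zero n0) n1)] at e
      linear_combination e
    have h3 : ((A q - 1) * (1 - θ q) - θ q * q * (3 - A q + 2 * H q)) /
        ((q - 1) * (2 * (1 + H q))) ≤ 1 / (q - 1) - θ q / 2 := by
      have : 1 / (q - 1) - θ q / 2 = (2 - θ q * (q - 1)) / ((q - 1) * 2) := by
        field_simp
      rw [this, div_le_div_iff₀ (mul_pos n4 (by linarith)) (mul_pos n4 two_pos)]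
      have t0 : 0 < θ q := by simp only [θ]; linarith
      have t1 : θ q < 1 / 2 := by simp only [θ]; linarith
      have t2 : A q = 1 + H q + 2 * θ q := by simp only [θ]; ring
      have t3 : (A q - 1) * (1 - θ q) - θ q * q * (3 - A q + 2 * H q) ≤
          (2 - θ q * (q - 1)) * (1 + H q) := by
        have m1 : (A q - 1) * (1 - θ q) ≤ 2 := by nlinarith
        have m2 : θ q * q * (1 + H q) ≤ θ q * q * (3 - A q + 2 * H q) :=
          mul_le_mul_of_nonneg_left (by linarith) (mul_nonneg t0.le (by linarith))
        have m3 : 0 ≤ θ q * (1 + H q) := mul_nonneg t0.le (by linarith)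
        nlinarith
      have := mul_le_mul_of_nonneg_left t3 (mul_nonneg n4.le zero_le_two)
      linarith
    rw [h2]
    linarith [hCq q hq]
  choose! d hd hd1 hd2 using hθd
  have hinv : ∀ q, q₀ ≤ q → HasDerivAt (fun q : ℝ => 2 * C / q) (-(2 * C) / q ^ 2) q := fun q hq => by
    have := (hasDerivAt_inv (x := q) (by linarith)).const_mul (2 * C)
    refine this.congr_deriv ?_
    ring
  have hAanti : AntitoneOn A (Ici q₀) := by
    have := monotoneOn_Ici_of_hasDerivAt (f := fun q => -A q) (q₀ := q₀)
      (fun q hq => (hs q hq).1.neg) (fun q hq => by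
        obtain ⟨-, -, b1, b2, b3, b4, b5⟩ := hs q hq
        rw [slopeA, neg_div, neg_neg]
        have : 0 < A q := by linarith
        have : 0 < q := by linarith
        positivity)
    simpa using this.neg
  constructor
  · obtain ⟨l, hl, hle⟩ := (hAanti.neg).exists_tendsto_atTop (B := -1)
      (fun q hq => by simpa using (hs q hq).2.2.1.le)
    have hAl : Tendsto A atTop (𝓝 (-l)) := by simpa using hl.neg
    have hl1 : 1 ≤ -l := ge_of_tendsto hAl (by
      filter_upwards [eventually_ge_atTop q₀] with q hq using (hs q hq).2.2.1.le)
    rcases eq_or_lt_of_le hl1 with h | h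
    · rwa [← h] at hAl
    · exfalso
      -- If the limit `-l` of `a` exceeded `1`, then `q a' ≤ -h/2` with `h = a - 1 - 2θ` would drive
      -- `a` down logarithmically, once the `θ` is paid for by the correction; this contradicts `a >
      -- 1`.
      have hV : AntitoneOn (fun q => A q - 1 + 2 * θ q + 2 * C / q + (-l - 1) / 2 * Real.log q)
          (Ici q₀) := by
        have := monotoneOn_Ici_of_hasDerivAt
          (f := fun q => -(A q - 1 + 2 * θ q + 2 * C / q + (-l - 1) / 2 * Real.log q)) (q₀ := q₀)
          (fun q hq => (((((hs q hq).1.sub_const 1).add ((hd q hq).const_mul 2)).add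
            (hinv q hq)).add ((Real.hasDerivAt_log (by linarith)).const_mul ((-l - 1) / 2))).neg)
          (fun q hq => by
            obtain ⟨-, -, b1, b2, b3, b4, b5⟩ := hs q hq
            have q0 : 0 < q := by linarith
            have e1 := hd1 q hq
            have e2 : -l ≤ A q := by
              have := hle q hq
              linarith
            have e3 : q * slopeA q (A q) (H q) ≤ -(H q / 2) := by
              have : q * slopeA q (A q) (H q) = -(A q * H q / (2 * (1 + H q))) := by
                rw [slopeA]; field_simp
              rw [this, neg_le_neg_iff, div_le_div_iff₀ two_pos (by linarith)]
              nlinarith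
            have e4 : θ q = (A q - 1 - H q) / 2 := rfl
            have e5 : q * (-(slopeA q (A q) (H q) + 2 * d q + -(2 * C) / q ^ 2 +
                (-l - 1) / 2 * q⁻¹)) = -(q * slopeA q (A q) (H q)) - 2 * (q * d q) +
                2 * (C / q) - (-l - 1) / 2 := by
              field_simp
              ring
            refine nonneg_of_mul_nonneg_right (a := q) ?_ q0
            rw [e5]
            linarith)
        simpa using this.neg
      have hlog : Tendsto (fun q => (-l - 1) / 2 * Real.log q) atTop atTop :=
        Real.tendsto_log_atTop.const_mul_atTop (by linarith)
      obtain ⟨q, hq1, hq2⟩ := ((hlog.eventually_gt_atTop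
        (A q₀ - 1 + 2 * θ q₀ + 2 * C / q₀ + (-l - 1) / 2 * Real.log q₀)).and
        (eventually_ge_atTop q₀)).exists
      have h1 := hV (le_refl q₀) hq2 hq2
      obtain ⟨-, -, b1, b2, b3, b4, b5⟩ := hs q hq2
      have h2 : 0 ≤ θ q := by simp only [θ]; linarith
      have h3 : 0 ≤ 2 * C / q := by
        have : 0 < C := div_pos (by linarith) (by linarith)
        have : 0 < q := by linarith
        positivity
      linarith
  -- `X` is `y²R`. Its logarithmic derivative in `log q` is `θ/(1 + h)`, which lies between `0` and
  -- `θ`: so `X` increases, and the same correction bounds `log X` from above.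
  · let X : ℝ → ℝ := fun q => (1 - θ q * (1 - q)) * A q
    have hX1 : ∀ q, q₀ ≤ q → 0 < X q := fun q hq => by
      obtain ⟨-, -, b1, b2, b3, b4, b5⟩ := hs q hq
      have t0 : 0 < θ q := by simp only [θ]; linarith
      have : 0 ≤ θ q * (q - 1) := mul_nonneg t0.le (by linarith)
      exact mul_pos (by linarith) (by linarith)
    have hXd : ∀ q, q₀ ≤ q → HasDerivAt X (X q * (θ q / (q * (1 + H q)))) q := by
      intro q hq
      obtain ⟨dA, -, b1, b2, b3, b4, b5⟩ := hs q hq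
      have hl : HasDerivAt (fun q : ℝ => 1 - q) (-1) q := by
        simpa using (hasDerivAt_id q).const_sub 1
      refine ((((hd q hq).mul hl).const_sub 1).mul dA).congr_deriv ?_
      have e := hd2 q hq
      have q0 : q ≠ 0 := by linarith
      have n1 : 1 + H q ≠ 0 := by linarith
      have e' : d q * (1 - q) = -(((A q - 1) * (1 - θ q) - θ q * q * (3 - A q + 2 * H q)) /
        (2 * q * (1 + H q))) := by linear_combination -e
      have e4 : A q = 1 + H q + 2 * θ q := by simp only [θ]; ring
      simp only [X, Pi.mul_apply]
      rw [e', slopeA]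
      generalize A q = h at *
      subst e4
      field_simp
      ring
    have hmono : MonotoneOn X (Ici q₀) :=
      monotoneOn_Ici_of_hasDerivAt hXd fun q hq => by
        obtain ⟨-, -, b1, b2, b3, b4, b5⟩ := hs q hq
        have t0 : 0 < θ q := by simp only [θ]; linarith
        have := hX1 q hq
        have : 0 < q := by linarith
        positivity
    have hY : AntitoneOn (fun q => Real.log (X q) + 2 * θ q + 2 * C / q) (Ici q₀) := by
      have := monotoneOn_Ici_of_hasDerivAt
        (f := fun q => -(Real.log (X q) + 2 * θ q + 2 * C / q)) (q₀ := q₀)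
        (fun q hq => ((((hXd q hq).log (hX1 q hq).ne').add ((hd q hq).const_mul 2)).add
          (hinv q hq)).neg)
        (fun q hq => by
          obtain ⟨-, -, b1, b2, b3, b4, b5⟩ := hs q hq
          have q0 : 0 < q := by linarith
          have e1 := hd1 q hq
          have t0 : 0 < θ q := by simp only [θ]; linarith
          have x0 := (hX1 q hq).ne'
          have e3 : θ q / (1 + H q) ≤ θ q := div_le_self t0.le (by linarith)
          have e5 : q * (-(X q * (θ q / (q * (1 + H q))) / X q + 2 * d q + -(2 * C) / q ^ 2)) =
              -(θ q / (1 + H q)) - 2 * (q * d q) + 2 * (C / q) := by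
            have n1 : 1 + H q ≠ 0 := by linarith
            field_simp
            ring
          refine nonneg_of_mul_nonneg_right (a := q) ?_ q0
          rw [e5]
          linarith)
      simpa using this.neg
    obtain ⟨k, hk, hkle⟩ := hmono.exists_tendsto_atTop
      (B := Real.exp (Real.log (X q₀) + 2 * θ q₀ + 2 * C / q₀)) (fun q hq => by
        rw [← Real.log_le_iff_le_exp (hX1 q hq)]
        have h1 := hY (le_refl q₀) hq hq
        obtain ⟨-, -, b1, b2, b3, b4, b5⟩ := hs q hq
        have h2 : 0 ≤ θ q := by simp only [θ]; linarith
        have h3 : 0 ≤ 2 * C / q := by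
          have : 0 < C := div_pos (by linarith) (by linarith)
          have : 0 < q := by linarith
          positivity
        simp only at h1
        linarith)
    exact ⟨k, (hX1 q₀ le_rfl).trans_le (hkle q₀ le_rfl), hk⟩

end Outer

/-! ### Analytic continuation to the centre `q = 0`. -/

namespace Center

section Definitions

variable {K : Type*} [Field K]

/-- `(3 - a) / q` in terms of the remainders `u = P - z` and `v = (3 - a) / q - 6 (P - 1) / 5`. -/
def β (z u v : K) : K := v + 6 / 5 * (z + u - 1)

/-- `(1 - θ) / q` in terms of the remainders. -/
def ψ (z q u : K) : K := (z + u - 1) / (1 - q)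

/-- `1 + h` in terms of the remainders. -/
def k (z q u v : K) : K := 1 + q * (2 * ψ z q u - β z u v)

/-- The derivative of `P`. -/
def g₁ (z q u v : K) : K := (z + u) * (β z u v - 4 * ψ z q u) / (2 * k z q u v)

/-- Nonlinearity in `q v' + 5 v / 2 = q g₂`. -/
def g₂ (z q u v : K) : K :=
  3 * ψ z q u + (2 * ψ z q u - β z u v) * (β z u v - 3 * ψ z q u) / k z q u v -
    6 / 5 * g₁ z q u v

end Definitions

/-- `k` is `1 + h`. With `N = z + ρ + 1` its perturbation of `1` has norm at most `7N · 1/(16N) <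
1`, which accounts for the radius. -/
theorem k_ne_zero {z ρ : ℝ} (hz : 0 ≤ z) (hρ : 0 ≤ ρ) {q u v : ℂ}
    (hq : ‖q‖ ≤ 1 / (16 * (z + ρ + 1))) (hu : ‖u‖ ≤ ρ) (hv : ‖v‖ ≤ ρ) :
    1 - q ≠ 0 ∧ k (z : ℂ) q u v ≠ 0 := by
  set N := z + ρ + 1 with hN
  have hN1 : 1 ≤ N := by linarith
  rw [le_div_iff₀ (by linarith)] at hq
  have hq' : ‖q‖ ≤ 1 / 2 := by nlinarith [norm_nonneg q]
  have h1q : 1 / 2 ≤ ‖1 - q‖ := by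
    have := norm_sub_norm_le (1 : ℂ) q
    rw [norm_one] at this
    linarith
  have n1 : ‖(z : ℂ) + u - 1‖ ≤ N := by
    have e1 := norm_sub_le ((z : ℂ) + u) 1
    have e2 := norm_add_le (z : ℂ) u
    rw [Complex.norm_real, Real.norm_eq_abs, abs_of_nonneg hz] at e2
    rw [norm_one] at e1
    linarith
  have n2 : ‖ψ (z : ℂ) q u‖ ≤ 2 * N := by
    rw [ψ, norm_div, div_le_iff₀ (by linarith)]
    nlinarith
  have n3 : ‖β (z : ℂ) u v‖ ≤ 3 * N := by
    rw [β]
    have e1 := norm_add_le v (6 / 5 * ((z : ℂ) + u - 1))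
    rw [norm_mul] at e1
    have e2 : ‖(6 / 5 : ℂ)‖ = 6 / 5 := by norm_num
    rw [e2] at e1
    linarith
  have n4 : ‖2 * ψ (z : ℂ) q u - β (z : ℂ) u v‖ ≤ 7 * N := by
    have e1 := norm_sub_le (2 * ψ (z : ℂ) q u) (β (z : ℂ) u v)
    rw [norm_mul, Complex.norm_ofNat] at e1
    linarith
  constructor
  · intro h
    rw [h, norm_zero] at h1q
    norm_num at h1q
  · intro h
    have e : q * (2 * ψ (z : ℂ) q u - β (z : ℂ) u v) = -1 := by
      rw [k] at h
      linear_combination h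
    have e2 := congrArg norm e
    rw [norm_mul, norm_neg, norm_one] at e2
    have : ‖q‖ * ‖2 * ψ (z : ℂ) q u - β (z : ℂ) u v‖ ≤ ‖q‖ * (7 * N) :=
      mul_le_mul_of_nonneg_left n4 (norm_nonneg _)
    linarith

theorem contDiffAt {z q u v : ℂ} (h1 : 1 - q ≠ 0) (hk : k z q u v ≠ 0) :
    ContDiffAt ℂ 1 (fun p : ℂ × ℂ × ℂ × ℂ => g₁ p.1 p.2.1 p.2.2.1 p.2.2.2) (z, q, u, v) ∧
    ContDiffAt ℂ 1 (fun p : ℂ × ℂ × ℂ × ℂ => g₂ p.1 p.2.1 p.2.2.1 p.2.2.2) (z, q, u, v) := by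
  have hβ : ContDiffAt ℂ 1 (fun p : ℂ × ℂ × ℂ × ℂ => β p.1 p.2.2.1 p.2.2.2) (z, q, u, v) := by
    unfold β
    fun_prop
  have hψ : ContDiffAt ℂ 1 (fun p : ℂ × ℂ × ℂ × ℂ => ψ p.1 p.2.1 p.2.2.1) (z, q, u, v) := by
    unfold ψ
    exact ContDiffAt.div (by fun_prop) (by fun_prop) h1
  have hkc : ContDiffAt ℂ 1 (fun p : ℂ × ℂ × ℂ × ℂ => k p.1 p.2.1 p.2.2.1 p.2.2.2)
      (z, q, u, v) := by
    unfold k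
    fun_prop
  have hg : ContDiffAt ℂ 1 (fun p : ℂ × ℂ × ℂ × ℂ => g₁ p.1 p.2.1 p.2.2.1 p.2.2.2)
      (z, q, u, v) := by
    unfold g₁
    exact ContDiffAt.div (by fun_prop) (by fun_prop) (mul_ne_zero two_ne_zero hk)
  refine ⟨hg, ?_⟩
  unfold g₂
  exact ContDiffAt.sub (ContDiffAt.add (by fun_prop) (ContDiffAt.div (by fun_prop) (by fun_prop)
    hk)) (by fun_prop)

/-- The ratio `P = R / ω` along a profile. -/
noncomputable def ratio (A H : ℝ → ℝ) (q : ℝ) : ℝ := (1 - (A q - 1 - H q) / 2 * (1 - q)) / q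

/-- The quotient by `1 - q` in `slopeH` cancels, because `θ` enters `P` multiplied by `1 - q`. -/
theorem hasDerivAt_ratio {A H : ℝ → ℝ} {q : ℝ} (hq : q ≠ 0) (hq1 : 1 - q ≠ 0) (hH : 1 + H q ≠ 0)
    (dA : HasDerivAt A (slopeA q (A q) (H q)) q) (dH : HasDerivAt H (slopeH q (A q) (H q)) q) :
    HasDerivAt (ratio A H)
      (ratio A H q * (2 * (A q - 1 - H q) - A q - 1) / (2 * q * (1 + H q))) q := by
  have hl : HasDerivAt (fun q : ℝ => 1 - q) (-1) q := by
    simpa using (hasDerivAt_id q).const_sub 1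
  refine ((((((dA.sub_const 1).sub dH).div_const 2).mul hl).const_sub 1).div (hasDerivAt_id q)
    hq).congr_deriv ?_
  simp only [ratio, slopeA, slopeH, Pi.sub_apply, Pi.mul_apply, id]
  field_simp
  ring

variable {A H : ℝ → ℝ}

/-- `P` decreases in `q` since its logarithmic derivative is `-(3 - a + 2h)/(2q(1 + h))`.
Boundedness near `0` holds because this singular rate is dominated by a multiple of the derivative
of `qP`, and `qP` stays nonnegative. -/
theorem exists_limit
    (hs : ∀ q ∈ Ioo (0 : ℝ) 1, HasDerivAt A (slopeA q (A q) (H q)) q ∧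
      HasDerivAt H (slopeH q (A q) (H q)) q)
    (hb : ∀ q ∈ Ioo (0 : ℝ) 1, 3 / 2 < A q ∧ A q < 3 ∧ 0 < H q ∧ H q < A q - 1) :
    ∃ P₀, Tendsto (ratio A H) (𝓝[>] 0) (𝓝 P₀) ∧
      ∀ q ∈ Ioc (0 : ℝ) (1 / 2), 1 < ratio A H q ∧ ratio A H q ≤ P₀ := by
  have hI : ∀ q ∈ Ioc (0 : ℝ) (1 / 2), q ∈ Ioo (0 : ℝ) 1 := fun q hq =>
    ⟨hq.1, by linarith [hq.2]⟩
  have hP1 : ∀ q ∈ Ioc (0 : ℝ) (1 / 2), 1 < ratio A H q := by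
    intro q hq
    obtain ⟨b1, b2, b3, b4⟩ := hb q (hI q hq)
    rw [ratio, lt_div_iff₀ hq.1]
    nlinarith [hq.2]
  have hd : ∀ q ∈ Ioc (0 : ℝ) (1 / 2), HasDerivAt (ratio A H)
      (ratio A H q * (2 * (A q - 1 - H q) - A q - 1) / (2 * q * (1 + H q))) q := by
    intro q hq
    obtain ⟨b1, b2, b3, b4⟩ := hb q (hI q hq)
    exact hasDerivAt_ratio hq.1.ne' (by linarith [hq.2]) (by linarith) (hs q (hI q hq)).1
      (hs q (hI q hq)).2
  have hanti : AntitoneOn (ratio A H) (Ioc 0 (1 / 2)) := by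
    refine antitoneOn_of_deriv_nonpos (convex_Ioc _ _)
      (fun q hq => (hd q hq).continuousAt.continuousWithinAt)
      (fun q hq => (hd q (interior_subset hq)).differentiableAt.differentiableWithinAt)
      fun q hq => ?_
    have hq := interior_subset hq
    obtain ⟨b1, b2, b3, b4⟩ := hb q (hI q hq)
    have hp := hP1 q hq
    rw [(hd q hq).deriv]
    refine div_nonpos_of_nonpos_of_nonneg ?_ (mul_nonneg (by linarith [hq.1]) (by linarith))
    exact mul_nonpos_of_nonneg_of_nonpos (by linarith) (by linarith)
  -- The derivative of `qP` is `P(a - 1)/(2(1 + h))`, with `a - 1 ≥ 1/2` and `qP ≥ (3 - a + h)/2` on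
  -- this interval; `48` is more than enough to compensate.
  have hmono : MonotoneOn (fun q => Real.log (ratio A H q) + 48 * (q * ratio A H q))
      (Ioc 0 (1 / 2)) := by
    have hd' : ∀ q ∈ Ioc (0 : ℝ) (1 / 2), ∃ d, 0 ≤ d ∧
        HasDerivAt (fun q => Real.log (ratio A H q) + 48 * (q * ratio A H q)) d q := by
      intro q hq
      obtain ⟨b1, b2, b3, b4⟩ := hb q (hI q hq)
      have hp := hP1 q hq
      refine ⟨_, ?_, ((hd q hq).log (by linarith)).add
        (((hasDerivAt_id q).mul (hd q hq)).const_mul 48)⟩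
      have q0 := hq.1
      have q0' := hq.1.ne'
      have n1 : 0 < 1 + H q := by linarith
      have n1' := n1.ne'
      have p0 : ratio A H q ≠ 0 := by linarith
      have eP : q * ratio A H q = 1 - (A q - 1 - H q) / 2 * (1 - q) := by
        rw [ratio, mul_div_cancel₀ _ q0']
      have e : ratio A H q * (2 * (A q - 1 - H q) - A q - 1) / (2 * q * (1 + H q)) /
          ratio A H q + 48 * (1 * ratio A H q + id q * (ratio A H q *
          (2 * (A q - 1 - H q) - A q - 1) / (2 * q * (1 + H q)))) =
          ((2 * (A q - 1 - H q) - A q - 1) + 48 * (q * ratio A H q) * (A q - 1)) /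
            (2 * q * (1 + H q)) := by
        simp only [id]
        field_simp
        ring
      rw [e]
      refine div_nonneg ?_ (by positivity)
      have m1 : (3 - A q + H q) * (1 / 2) ≤ q * ratio A H q := by
        have : (3 - A q + H q) * q ≥ 0 := mul_nonneg (by linarith) q0.le
        rw [eP]
        nlinarith [hq.2]
      have m2 : q * ratio A H q * (1 / 2) ≤ q * ratio A H q * (A q - 1) :=
        mul_le_mul_of_nonneg_left (by linarith) (mul_nonneg q0.le (by linarith))
      nlinarith
    refine monotoneOn_of_deriv_nonneg (convex_Ioc _ _) (fun q hq => ?_) (fun q hq => ?_)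
      fun q hq => ?_
    · obtain ⟨d, -, h⟩ := hd' q hq
      exact h.continuousAt.continuousWithinAt
    · obtain ⟨d, -, h⟩ := hd' q (interior_subset hq)
      exact h.differentiableAt.differentiableWithinAt
    · obtain ⟨d, h0, h⟩ := hd' q (interior_subset hq)
      rw [h.deriv]
      exact h0
  have hinv : ∀ t ∈ Ici (2 : ℝ), t⁻¹ ∈ Ioc (0 : ℝ) (1 / 2) := fun t ht => by
    have ht' : (2 : ℝ) ≤ t := ht
    refine ⟨by positivity, ?_⟩
    rw [one_div]
    exact inv_anti₀ two_pos ht'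
  have hm : MonotoneOn (fun t : ℝ => ratio A H t⁻¹) (Ici 2) := by
    intro s hs' t ht hst
    have h2 : (0 : ℝ) < s := lt_of_lt_of_le two_pos hs'
    exact hanti (hinv t ht) (hinv s hs') (inv_anti₀ h2 hst)
  obtain ⟨P₀, hP₀, hle⟩ := hm.exists_tendsto_atTop
    (B := Real.exp (Real.log (ratio A H (1 / 2)) + 48 * (1 / 2 * ratio A H (1 / 2))))
    (fun t ht => by
      have hI' := hinv t ht
      have h1 := hP1 _ hI'
      rw [← Real.log_le_iff_le_exp (by linarith)]
      have h2 := hmono hI' (right_mem_Ioc.2 (by norm_num)) hI'.2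
      have h3 : 0 ≤ t⁻¹ * ratio A H t⁻¹ := mul_nonneg hI'.1.le (by linarith)
      simp only at h2
      linarith)
  refine ⟨P₀, ?_, fun q hq => ⟨hP1 q hq, ?_⟩⟩
  · have := hP₀.comp tendsto_inv_nhdsGT_zero
    refine this.congr fun q => ?_
    simp
  · have h2 : (2 : ℝ) ≤ q⁻¹ := by
      rw [le_inv_comm₀ two_pos hq.1]
      simpa using hq.2
    simpa using hle q⁻¹ h2

/-- With `b = (3 - a)/q` and `s = (P - 1)/(1 - q)` the equation reads `q b' + 5b/2 = 3s + O(q)`.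
Since `3 = 5/2 · 6/5`, subtracting `6(P - 1)/5` from `b` leaves a right-hand side divisible by `q`.
-/
theorem slope_v_identity {q a h P : ℝ} (hq : q ≠ 0) (hq1 : 1 - q ≠ 0) (hh : 1 + h ≠ 0)
    (hP : q * P = 1 - (a - 1 - h) / 2 * (1 - q)) :
    let b := (3 - a) / q
    let s := (P - 1) / (1 - q)
    h = q * (2 * s - b) ∧
    P * (2 * (a - 1 - h) - a - 1) / (2 * q * (1 + h)) = P * (b - 4 * s) / (2 * (1 + h)) ∧
    q * ((-slopeA q a h * q - (3 - a)) / q ^ 2 -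
        6 / 5 * (P * (b - 4 * s) / (2 * (1 + h)))) + 5 / 2 * (b - 6 / 5 * (P - 1)) =
      q * (3 * s + (2 * s - b) * (b - 3 * s) / (1 + h) - 6 / 5 * (P * (b - 4 * s) / (2 * (1 + h)))) := by
  intro b s
  have hb : a = 3 - q * b := by simp only [b]; field_simp; ring
  have hs : P = 1 + (1 - q) * s := by simp only [s]; field_simp; ring
  clear_value b s
  have hh2 : h = q * (2 * s - b) := by
    have : (1 - q) * (h - q * (2 * s - b)) = 0 := by
      rw [hb, hs] at hP
      linear_combination -2 * hP
    rcases mul_eq_zero.1 this with h | h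
    · exact absurd h hq1
    · linarith
  refine ⟨hh2, ?_, ?_⟩
  · have e : 2 * (a - 1 - h) - a - 1 = q * (b - 4 * s) := by rw [hb, hh2]; ring
    rw [e]
    field_simp
  · have e1 : (-slopeA q a h * q - (3 - a)) / q ^ 2 = (a * h / (2 * (1 + h)) - q * b) / q ^ 2 := by
      rw [slopeA, hb]
      field_simp
      ring
    rw [e1]
    have e2 : a * h / (2 * (1 + h)) = q * ((3 - q * b) * (2 * s - b) / (2 * (1 + h))) := by
      rw [hb]
      nth_rewrite 1 [hh2]
      ring
    have e3 : (3 - q * b) * (2 * s - b) / (2 * (1 + h)) =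
        3 / 2 * (2 * s - b) + q * ((2 * s - b) * (b - 3 * s) / (1 + h)) := by
      have : (3 - q * b) = 3 * (1 + h) + 2 * q * (b - 3 * s) := by rw [hh2]; ring
      rw [this]
      field_simp
    rw [e2, e3]
    generalize (2 * s - b) * (b - 3 * s) / (1 + h) = X
    generalize P * (b - 4 * s) / (2 * (1 + h)) = Y
    rw [hs]
    field_simp
    ring

/-- A profile that stays in the trapping region down to `q = 0` extends analytically to `q = 0`. -/
theorem exists_analytic_extension
    (hs : ∀ q ∈ Ioo (0 : ℝ) 1, HasDerivAt A (slopeA q (A q) (H q)) q ∧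
      HasDerivAt H (slopeH q (A q) (H q)) q)
    (hb : ∀ q ∈ Ioo (0 : ℝ) 1, 3 / 2 < A q ∧ A q < 3 ∧ 0 < H q ∧ H q < A q - 1) :
    ∃ r > 0, ∃ a P : ℝ → ℝ, AnalyticAt ℝ a 0 ∧ AnalyticAt ℝ P 0 ∧ a 0 = 3 ∧ 0 < P 0 ∧
      ∀ q ∈ Ioo 0 r, A q = a q ∧ ratio A H q = P q := by
  obtain ⟨P₀, hlim, hP⟩ := exists_limit hs hb
  have hP₀ : 1 < P₀ := by
    obtain ⟨h1, h2⟩ := hP (1 / 2) (by norm_num)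
    linarith
  -- A radius large enough to contain the given profile, not only the analytic solution, so that the
  -- Lipschitz estimate applies to both.
  set ρ := 6 * P₀ with hρ
  let μ : ℝ → Fin 2 → ℝ := fun _ => ![0, 5 / 2]
  let G : ℂ → ℂ → (Fin 2 → ℂ) → Fin 2 → ℂ := fun z x w =>
    ![g₁ z x (w 0) (w 1), g₂ z x (w 0) (w 1)]
  let gR : ℝ → ℝ → (Fin 2 → ℝ) → Fin 2 → ℝ := fun z x w =>
    ![g₁ z x (w 0) (w 1), g₂ z x (w 0) (w 1)]
  have hR : 0 < 1 / (16 * (P₀ + ρ + 1)) := div_pos one_pos (by linarith)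
  obtain ⟨r, M, L, hr, hrR, hL, hrL, hlip, y, -, hy⟩ := BriotBouquet.exists_analytic_solution
    (c := P₀) (d := P₀) (R := 1 / (16 * (P₀ + ρ + 1))) (ρ := ρ) hR (by linarith) μ (by
      intro z hz i
      fin_cases i <;> norm_num [μ]) (fun i => continuousOn_const) G gR (by
      intro z hz x hx w hw
      rw [mem_closedBall_zero_iff] at hx hw
      obtain rfl : z = P₀ := le_antisymm hz.2 hz.1
      obtain ⟨k1, k2⟩ := k_ne_zero (by linarith) (by linarith) hx ((norm_le_pi_norm w 0).trans hw)
        ((norm_le_pi_norm w 1).trans hw)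
      obtain ⟨c1, c2⟩ := contDiffAt k1 k2
      have hs : ContDiffAt ℂ 1 (fun p : ℂ × ℂ × (Fin 2 → ℂ) => (p.1, p.2.1, p.2.2 0, p.2.2 1))
          ((z : ℂ), x, w) := by
        have k0 : ContDiff ℂ 1 fun p : ℂ × ℂ × (Fin 2 → ℂ) => p.2.2 0 :=
          (contDiff_apply ℂ ℂ (0 : Fin 2)).comp (contDiff_snd.comp contDiff_snd)
        have k1 : ContDiff ℂ 1 fun p : ℂ × ℂ × (Fin 2 → ℂ) => p.2.2 1 :=
          (contDiff_apply ℂ ℂ (1 : Fin 2)).comp (contDiff_snd.comp contDiff_snd)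
        exact (contDiff_fst.prodMk ((contDiff_fst.comp contDiff_snd).prodMk
          (k0.prodMk k1))).contDiffAt
      refine contDiffAt_pi.2 fun i => ?_
      fin_cases i
      · exact ContDiffAt.comp ((z : ℂ), x, w)
          (f := fun p : ℂ × ℂ × (Fin 2 → ℂ) => (p.1, p.2.1, p.2.2 0, p.2.2 1)) c1 hs
      · exact ContDiffAt.comp ((z : ℂ), x, w)
          (f := fun p : ℂ × ℂ × (Fin 2 → ℂ) => (p.1, p.2.1, p.2.2 0, p.2.2 1)) c2 hs) (by
      intro z _ x _ w _ i
      fin_cases i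
      · simp [G, gR, g₁, k, β, ψ]
      · simp [G, gR, g₂, g₁, k, β, ψ])
  have hzP : P₀ ∈ Icc P₀ P₀ := ⟨le_rfl, le_rfl⟩
  obtain ⟨hy0, hya, hyd⟩ := hy P₀ hzP
  have h0r : (0 : ℝ) ∈ Ioo (-r) r := ⟨by linarith, hr⟩
  have hrhalf : r ≤ 1 / 2 := by
    refine hrR.trans ?_
    exact one_div_le_one_div_of_le two_pos (by linarith)
  let w : ℝ → Fin 2 → ℝ := fun q =>
    ![ratio A H q - P₀, (3 - A q) / q - 6 / 5 * (ratio A H q - 1)]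
  have hI : ∀ q ∈ Ioo 0 r, q ∈ Ioc (0 : ℝ) (1 / 2) ∧ q ∈ Ioo (0 : ℝ) 1 ∧ q ∈ Ioo (-r) r :=
    fun q hq => ⟨⟨hq.1, by linarith [hq.2]⟩, ⟨hq.1, by linarith [hq.2]⟩,
      ⟨by linarith [hq.1], hq.2⟩⟩
  have hident : ∀ q ∈ Ioo 0 r, _ := fun q hq =>
    slope_v_identity (a := A q) (h := H q) (P := ratio A H q) hq.1.ne'
      (by linarith [hq.2]) (by linarith [(hb q (hI q hq).2.1).2.2.1])
      (by rw [ratio, mul_div_cancel₀ _ hq.1.ne'])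
  -- Here `h > 0` is decisive: as `h = q(2s - b)`, it bounds `b = (3 - a)/q` by `2s`, and `s` is
  -- bounded through `P ≤ P₀`.
  have hwρ : ∀ q ∈ Ioo 0 r, ‖w q‖ ≤ ρ := by
    intro q hq
    obtain ⟨i1, i2, -⟩ := hI q hq
    obtain ⟨b1, b2, b3, b4⟩ := hb q i2
    obtain ⟨p1, p2⟩ := hP q i1
    have hh := (hident q hq).1
    have q0 := hq.1
    have s1 : (ratio A H q - 1) / (1 - q) ≤ 2 * (P₀ - 1) := by
      rw [div_le_iff₀ (by linarith [i2.2])]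
      nlinarith [i1.2]
    have b0 : 0 ≤ (3 - A q) / q := div_nonneg (by linarith) q0.le
    have b5 : 0 < 2 * ((ratio A H q - 1) / (1 - q)) - (3 - A q) / q := by
      refine pos_of_mul_pos_right (a := q) ?_ q0.le
      rw [← hh]
      exact b3
    refine (pi_norm_le_iff_of_nonneg (by linarith)).2 fun i => ?_
    fin_cases i
    · change |ratio A H q - P₀| ≤ ρ
      rw [abs_le]
      constructor <;> linarith
    · change |(3 - A q) / q - 6 / 5 * (ratio A H q - 1)| ≤ ρ
      rw [abs_le]
      constructor <;> linarith
  have hwd : ∀ q ∈ Ioo 0 r, ∀ i, ∃ d, HasDerivAt (fun y => w y i) d q ∧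
      q * d + μ P₀ i * w q i = q * gR P₀ q (w q) i := by
    intro q hq
    obtain ⟨i1, i2, -⟩ := hI q hq
    obtain ⟨b1, b2, b3, b4⟩ := hb q i2
    obtain ⟨dA, dH⟩ := hs q i2
    have q0 := hq.1.ne'
    have dP := hasDerivAt_ratio q0 (by linarith [i2.2]) (by linarith) dA dH
    obtain ⟨hh, hu, hv⟩ := hident q hq
    rw [hu] at dP
    have eβ : β P₀ (ratio A H q - P₀) ((3 - A q) / q - 6 / 5 * (ratio A H q - 1)) =
        (3 - A q) / q := by rw [β]; ring
    have eψ : ψ P₀ q (ratio A H q - P₀) = (ratio A H q - 1) / (1 - q) := by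
      rw [ψ]; congr 1; ring
    have ek : k P₀ q (ratio A H q - P₀) ((3 - A q) / q - 6 / 5 * (ratio A H q - 1)) =
        1 + H q := by rw [k, eβ, eψ, ← hh]
    have eg : g₁ P₀ q (ratio A H q - P₀) ((3 - A q) / q - 6 / 5 * (ratio A H q - 1)) =
        ratio A H q * ((3 - A q) / q - 4 * ((ratio A H q - 1) / (1 - q))) / (2 * (1 + H q)) := by
      rw [g₁, ek, eβ, eψ]
      congr 2
      ring
    intro i
    fin_cases i
    · refine ⟨_, dP.sub_const P₀, ?_⟩
      change _ + 0 * _ = q * g₁ P₀ q (ratio A H q - P₀)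
        ((3 - A q) / q - 6 / 5 * (ratio A H q - 1))
      rw [eg]
      ring
    · refine ⟨_, (((dA.const_sub 3).div (hasDerivAt_id q) q0).sub
        ((dP.sub_const 1).const_mul (6 / 5))), ?_⟩
      change _ + 5 / 2 * ((3 - A q) / q - 6 / 5 * (ratio A H q - 1)) =
        q * g₂ P₀ q (ratio A H q - P₀) ((3 - A q) / q - 6 / 5 * (ratio A H q - 1))
      rw [g₂, eg, ek, eβ, eψ, ← hv]
      simp only [id, mul_one]
  have hzero := BriotBouquet.eq_zero_of_bounded (μ := μ P₀) (f := fun q => w q - y P₀ q)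
    (e := fun q => gR P₀ q (w q) - gR P₀ q (y P₀ q)) (r := r) (L := L) (B := ρ + ρ) hL hrL (by
      intro i
      fin_cases i <;> norm_num [μ]) (fun q hq => (norm_sub_le _ _).trans
        (add_le_add (hwρ q hq) (hyd q (hI q hq).2.2).1.le)) (fun q hq i => by
      obtain ⟨d, hd, e⟩ := hwd q hq i
      obtain ⟨d', hd', e'⟩ := (hyd q (hI q hq).2.2).2.2 i
      refine ⟨d - d', hd.sub hd', ?_⟩
      simp only [Pi.sub_apply]
      linear_combination e - e') (fun q hq i => (hlip P₀ hzP q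
        ((abs_lt.2 (hI q hq).2.2).le.trans hrR) _ (hwρ q hq) _ (hyd q (hI q hq).2.2).1.le i).2) (by
      intro i
      fin_cases i
      -- The component with exponent `0` has no damping weight; convergence of `P` to `P₀` supplies
      -- its vanishing limit.
      · refine Or.inr ?_
        have h1 : Tendsto (fun q => y P₀ q 0) (𝓝[>] 0) (𝓝 0) := by
          have := (continuousAt_pi.1 (hya 0 h0r).continuousAt 0).tendsto
          rw [hy0] at this
          exact this.mono_left nhdsWithin_le_nhds
        have h2 := (hlim.sub_const P₀).sub h1
        simpa [w] using h2
      · exact Or.inl (by norm_num [μ]))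
  have hyi : ∀ i, AnalyticAt ℝ (fun q => y P₀ q i) 0 := analyticAt_pi_iff.1 (hya 0 h0r)
  have a0 := hyi 0
  have a1 := hyi 1
  refine ⟨r, hr, fun q => 3 - q * (y P₀ q 1 + 6 / 5 * (P₀ + y P₀ q 0 - 1)),
    fun q => P₀ + y P₀ q 0, ?_, analyticAt_const.add a0, by simp, ?_, fun q hq => ?_⟩
  · exact analyticAt_const.sub (analyticAt_id.mul (a1.add (analyticAt_const.mul
      ((analyticAt_const.add a0).sub analyticAt_const))))
  · simp only [hy0, Pi.zero_apply]
    linarith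
  · have h := hzero q hq
    have e0 : ratio A H q - P₀ = y P₀ q 0 := sub_eq_zero.1 (congrFun h 0)
    have e1 : (3 - A q) / q - 6 / 5 * (ratio A H q - 1) = y P₀ q 1 := sub_eq_zero.1 (congrFun h 1)
    constructor
    · simp only [← e0, ← e1]
      have := hq.1.ne'
      field_simp
      ring
    · simp only [← e0]
      ring

end Center

end ShootingArgument

/-! ### The global profile on `q ≥ 0`. -/

namespace Profile

open Set Center

/-- The local solution past `q = 1` already lies strictly in the outer trapping region, so it can be
continued by the outer solution from any point of its domain beyond the sonic one. -/
theorem exists_solution : ∃ z ∈ Ioo (2 : ℝ) 3, ∃ A H : ℝ → ℝ, A 1 = z ∧ H 1 = z - 2 ∧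
    (∀ q, 0 < q → AnalyticAt ℝ A q ∧ AnalyticAt ℝ H q ∧ HasDerivAt A (slopeA q (A q) (H q)) q ∧
      (q ≠ 1 → HasDerivAt H (slopeH q (A q) (H q)) q)) ∧
    (∀ q, 0 < q → 1 < A q ∧ A q < 3 ∧ 0 < H q ∧ H q < A q - 1) ∧
    (∀ q ∈ Ioo (0 : ℝ) 1, 3 / 2 < A q) ∧ Tendsto A atTop (𝓝 1) ∧
    ∃ k, 0 < k ∧ Tendsto (fun q => (1 - (A q - 1 - H q) / 2 * (1 - q)) * A q) atTop (𝓝 k) := by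
  obtain ⟨z, hz, r, hr, A₁, H₁, hA1, hH1, hd₁, hb₁, hb₁'⟩ := Inner.exists_solution
  set c := 1 + r / 2 with hc
  have hc1 : 1 < c := by linarith
  obtain ⟨m1, m2, m3, m4, m5⟩ := hb₁' c ⟨hc1, by linarith⟩
  obtain ⟨A₂, H₂, eA, eH, hs₂⟩ := Outer.exists_solution hc1 m2 m3 m4 m5
  obtain ⟨lim1, k, hk, lim2⟩ := Outer.asymptotics hc1 hs₂
  let A : ℝ → ℝ := fun q => if q ≤ c then A₁ q else A₂ q
  let H : ℝ → ℝ := fun q => if q ≤ c then H₁ q else H₂ q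
  have leA : ∀ q, q ≤ c → A q = A₁ q := fun q h => if_pos h
  have leH : ∀ q, q ≤ c → H q = H₁ q := fun q h => if_pos h
  have gtA : ∀ q, c < q → A q = A₂ q := fun q h => if_neg h.not_ge
  have gtH : ∀ q, c < q → H q = H₂ q := fun q h => if_neg h.not_ge
  have evl : ∀ q, q < c → A =ᶠ[𝓝 q] A₁ ∧ H =ᶠ[𝓝 q] H₁ := fun q h =>
    ⟨(eventually_lt_nhds h).mono fun x hx => leA x hx.le,
      (eventually_lt_nhds h).mono fun x hx => leH x hx.le⟩
  have evg : ∀ q, c < q → A =ᶠ[𝓝 q] A₂ ∧ H =ᶠ[𝓝 q] H₂ := fun q h =>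
    ⟨(eventually_gt_nhds h).mono fun x hx => gtA x hx,
      (eventually_gt_nhds h).mono fun x hx => gtH x hx⟩
  have hd : ∀ q, 0 < q → HasDerivAt A (slopeA q (A q) (H q)) q ∧
      (q ≠ 1 → HasDerivAt H (slopeH q (A q) (H q)) q) := by
    intro q hq
    rcases lt_trichotomy q c with h | rfl | h
    · obtain ⟨-, -, d1, d2⟩ := hd₁ q ⟨hq, by linarith⟩
      rw [leA q h.le, leH q h.le]
      exact ⟨d1.congr_of_eventuallyEq (evl q h).1,
        fun h1 => (d2 h1).congr_of_eventuallyEq (evl q h).2⟩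
    · obtain ⟨-, -, d1, d2⟩ := hd₁ c ⟨hq, by linarith⟩
      obtain ⟨e1, e2, -⟩ := hs₂ c le_rfl
      rw [leA c le_rfl, leH c le_rfl]
      rw [eA, eH] at e1 e2
      exact ⟨d1.glue e1 eA.symm, fun h1 => (d2 h1).glue e2 eH.symm⟩
    · obtain ⟨e1, e2, -⟩ := hs₂ q h.le
      rw [gtA q h, gtH q h]
      exact ⟨e1.congr_of_eventuallyEq (evg q h).1,
        fun _ => e2.congr_of_eventuallyEq (evg q h).2⟩
  have hb : ∀ q, 0 < q → 1 < A q ∧ A q < 3 ∧ 0 < H q ∧ H q < A q - 1 := by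
    intro q hq
    rcases le_or_gt q c with h | h
    · rw [leA q h, leH q h]
      rcases le_or_gt q 1 with h1 | h1
      · obtain ⟨n1, n2, n3, n4⟩ := hb₁ q ⟨hq, h1⟩
        exact ⟨by linarith, n2, n3, n4⟩
      · obtain ⟨n1, n2, n3, n4, -⟩ := hb₁' q ⟨h1, by linarith⟩
        exact ⟨by linarith, n2, n3, n4⟩
    · obtain ⟨-, -, n1, n2, n3, n4, -⟩ := hs₂ q h.le
      rw [gtA q h, gtH q h]
      exact ⟨n1, n2, n3, n4⟩
  refine ⟨z, hz, A, H, by rw [leA 1 hc1.le, hA1], by rw [leH 1 hc1.le, hH1], fun q hq => ?_, hb,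
    fun q hq => ?_, lim1.congr' ?_, k, hk, lim2.congr' ?_⟩
  · have han : AnalyticAt ℝ A q ∧ AnalyticAt ℝ H q := by
      rcases lt_or_ge q c with h | h
      · obtain ⟨n1, n2, -⟩ := hd₁ q ⟨hq, by linarith⟩
        exact ⟨n1.congr (evl q h).1.symm, n2.congr (evl q h).2.symm⟩
      · have h1 : 1 < q := hc1.trans_le h
        refine analyticAt_of_slope hq.ne' h1.ne' (by linarith [(hb q hq).2.2.1]) ?_ ?_
        · filter_upwards [lt_mem_nhds h1] with x hx using (hd x (one_pos.trans hx)).1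
        · filter_upwards [lt_mem_nhds h1] with x hx using (hd x (one_pos.trans hx)).2 hx.ne'
    exact ⟨han.1, han.2, hd q hq⟩
  · rw [leA q (by linarith [hq.2])]
    exact (hb₁ q ⟨hq.1, hq.2.le⟩).1
  · filter_upwards [eventually_gt_atTop c] with q h using (gtA q h).symm
  · filter_upwards [eventually_gt_atTop c] with q h
    rw [gtA q h, gtH q h]

/-- The profile in the variable `q = y² ω²`, extended analytically to the centre `q = 0`:
`a = 1/ω` and `P = 2πρ/ω`. -/
theorem exists_analytic_profile : ∃ z ∈ Ioo (2 : ℝ) 3, ∃ a P H : ℝ → ℝ,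
    AnalyticOnNhd ℝ a (Ici 0) ∧ AnalyticOnNhd ℝ P (Ici 0) ∧ a 0 = 3 ∧ a 1 = z ∧ H 1 = z - 2 ∧
    (∀ q, 0 ≤ q → 0 < P q) ∧
    (∀ q, 0 < q → 1 < a q ∧ 0 < H q ∧ HasDerivAt a (slopeA q (a q) (H q)) q ∧
      HasDerivAt P (P q * (2 * (a q - 1 - H q) - a q - 1) / (2 * q * (1 + H q))) q ∧
      q * P q = 1 - (a q - 1 - H q) / 2 * (1 - q)) ∧
    Tendsto a atTop (𝓝 1) ∧
    ∃ k, 0 < k ∧ Tendsto (fun q => q * P q * a q) atTop (𝓝 k) := by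
  obtain ⟨z, hz, A, H, hA1, hH1, hd, hb, hin, lim1, k, hk, lim2⟩ := exists_solution
  obtain ⟨r, hr, a₀, P₀, ha₀, hP₀, h3, hpos, heq⟩ := Center.exists_analytic_extension
    (A := A) (H := H)
    (fun q hq => ⟨(hd q hq.1).2.2.1, (hd q hq.1).2.2.2 hq.2.ne⟩)
    (fun q hq => ⟨hin q hq, (hb q hq.1).2⟩)
  -- Values at `q ≤ 0` are taken from the analytic extension, as analyticity at `0` concerns a full
  -- neighbourhood.
  let a : ℝ → ℝ := fun q => if q ≤ 0 then a₀ q else A q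
  let P : ℝ → ℝ := fun q => if q ≤ 0 then P₀ q else ratio A H q
  have ea : ∀ q, 0 < q → a q = A q := fun q h => if_neg h.not_ge
  have eP : ∀ q, 0 < q → P q = ratio A H q := fun q h => if_neg h.not_ge
  have ea0 : a 0 = a₀ 0 := if_pos le_rfl
  have eP0 : P 0 = P₀ 0 := if_pos le_rfl
  have eva : ∀ q, 0 < q → a =ᶠ[𝓝 q] A := fun q h => (eventually_gt_nhds h).mono ea
  have evP : ∀ q, 0 < q → P =ᶠ[𝓝 q] ratio A H := fun q h => (eventually_gt_nhds h).mono eP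
  have ev0 : a =ᶠ[𝓝 0] a₀ ∧ P =ᶠ[𝓝 0] P₀ := by
    constructor
    all_goals
      filter_upwards [eventually_lt_nhds hr] with q hq
      rcases le_or_gt q 0 with h | h
      · exact if_pos h
    · rw [ea q h, (heq q ⟨h, hq⟩).1]
    · rw [eP q h, (heq q ⟨h, hq⟩).2]
  have hm : ∀ q, 0 < q → q * ratio A H q = 1 - (A q - 1 - H q) / 2 * (1 - q) := fun q h => by
    rw [ratio, mul_div_cancel₀ _ h.ne']
  refine ⟨z, hz, a, P, H, fun q hq => ?_, fun q hq => ?_, by rw [ea0, h3],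
    by rw [ea 1 one_pos, hA1], hH1, fun q hq => ?_, fun q hq => ?_,
    lim1.congr' ((eventually_gt_atTop 0).mono fun q h => (ea q h).symm), k, hk,
    lim2.congr' ((eventually_gt_atTop 0).mono fun q h => ?_)⟩
  · rcases (mem_Ici.1 hq).eq_or_lt with rfl | h
    · exact ha₀.congr ev0.1.symm
    · exact (hd q h).1.congr (eva q h).symm
  · rcases (mem_Ici.1 hq).eq_or_lt with rfl | h
    · exact hP₀.congr ev0.2.symm
    · have h1 := (hd q h).1
      have h2 := (hd q h).2.1
      refine AnalyticAt.congr ?_ (evP q h).symm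
      exact (analyticAt_const.sub (((((h1.sub analyticAt_const).sub h2)).div
        analyticAt_const two_ne_zero).mul (analyticAt_const.sub analyticAt_id))).div
          analyticAt_id h.ne'
  · rcases hq.eq_or_lt with rfl | h
    · rwa [eP0]
    · rw [eP q h]
      obtain ⟨b1, b2, b3, b4⟩ := hb q h
      refine pos_of_mul_pos_right (a := q) ?_ h.le
      rw [hm q h]
      have : 0 < (A q - 1 - H q) * q := mul_pos (by linarith) h
      linarith
  · obtain ⟨b1, b2, b3, b4⟩ := hb q hq
    obtain ⟨-, han, dA, dH⟩ := hd q hq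
    rw [ea q hq, eP q hq]
    refine ⟨b1, b3, dA.congr_of_eventuallyEq (eva q hq),
      HasDerivAt.congr_of_eventuallyEq ?_ (evP q hq), hm q hq⟩
    rcases eq_or_ne q 1 with rfl | h1
    -- At `q = 1` any value of the derivative of `H` will do: it is multiplied by `1 - q = 0`.
    · have dH := han.differentiableAt.hasDerivAt
      have key := (((((dA.sub_const 1).sub dH).div_const 2).mul
        ((hasDerivAt_id (1 : ℝ)).const_sub 1)).const_sub 1).div (hasDerivAt_id (1 : ℝ)) one_ne_zero
      refine key.congr_deriv ?_
      simp only [ratio, id, hA1, hH1, slopeA]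
      have : 1 + (z - 2) ≠ 0 := by linarith [hz.1]
      simp only [Pi.sub_apply]
      field_simp
      simp [hA1, hH1]
      ring
    · exact hasDerivAt_ratio hq.ne' (sub_ne_zero.2 h1.symm) (by linarith) dA (dH h1)
  · simp only
    rw [ea q h, eP q h, hm q h]

end Profile

/-! ### Analytic inversion on a closed half-line. -/

section Inverse

open Set

/-- An analytic function on `[0, ∞)` with positive derivative, vanishing at `0` and unbounded, has
an inverse which is analytic on `[0, ∞)`, the end point included. -/
theorem AnalyticOnNhd.exists_inverse_Ici {f : ℝ → ℝ} (hf : AnalyticOnNhd ℝ f (Ici 0))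
    (h0 : f 0 = 0) (hd : ∀ x, 0 ≤ x → 0 < deriv f x) (ht : Tendsto f atTop atTop) :
    ∃ g : ℝ → ℝ, AnalyticOnNhd ℝ g (Ici 0) ∧ g 0 = 0 ∧ (∀ x, 0 < x → 0 < g x) ∧
      (∀ x, 0 ≤ x → f (g x) = x) ∧ (∀ x, 0 ≤ x → g (f x) = x) ∧ Tendsto g atTop atTop := by
  have hmono : StrictMonoOn f (Ici 0) := strictMonoOn_of_deriv_pos (convex_Ici 0)
    (fun x hx => (hf x hx).continuousAt.continuousWithinAt)
    fun x hx => hd x (interior_subset hx)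
  have hsurj : ∀ x, 0 ≤ x → ∃ q, 0 ≤ q ∧ f q = x := by
    intro x hx
    have := intermediate_value_Ici (a := (0 : ℝ))
      (fun x hx => (hf x hx).continuousAt.continuousWithinAt) ht
    rw [h0] at this
    exact this hx
  choose! G hG0 hG using hsurj
  have hGf : ∀ x, 0 ≤ x → G (f x) = x := by
    intro x hx
    have hfx : 0 ≤ f x := by
      rw [← h0]
      exact hmono.monotoneOn self_mem_Ici hx hx
    exact hmono.injOn (hG0 _ hfx) hx (hG _ hfx)
  have hloc : ∀ q, 0 ≤ q → ∃ k : ℝ → ℝ, AnalyticAt ℝ k (f q) ∧ k (f q) = q ∧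
      (∀ᶠ x in 𝓝 (f q), f (k x) = x) ∧ 0 < deriv k (f q) := by
    intro q hq
    have hs := (hf q hq).hasStrictDerivAt
    refine ⟨hs.localInverse _ _ _ (hd q hq).ne', (hf q hq).analyticAt_localInverse (hd q hq).ne',
      HasStrictFDerivAt.localInverse_apply_image _, hs.eventually_right_inverse (hd q hq).ne', ?_⟩
    rw [(hs.to_localInverse (hd q hq).ne').hasDerivAt.deriv]
    exact inv_pos.2 (hd q hq)
  obtain ⟨k₀, ka, k0, kr, kd⟩ := hloc 0 le_rfl
  rw [h0] at ka k0 kr kd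
  -- The local inverse at `0` continues `g` to negative arguments. Its derivative is positive, so
  -- just right of `0` it takes positive values and injectivity of `f` on `[0, ∞)` identifies it
  -- with `G`.
  let g : ℝ → ℝ := fun x => if x ≤ 0 then k₀ x else G x
  have gpos : ∀ x, 0 < x → g x = G x := fun x h => if_neg h.not_ge
  have g0 : g 0 = 0 := (if_pos le_rfl).trans k0
  have Gpos : ∀ x, 0 < x → 0 < G x := by
    intro x hx
    refine (hG0 x hx.le).lt_of_ne fun h => hx.ne ?_
    rw [← hG x hx.le, ← h, h0]
  have gG : ∀ x, 0 ≤ x → g x = G x := by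
    intro x hx
    rcases hx.eq_or_lt with rfl | h
    · rw [g0]
      have := hGf 0 le_rfl
      rw [h0] at this
      exact this.symm
    · exact gpos x h
  refine ⟨g, fun x hx => ?_, g0, fun x hx => by rw [gpos x hx]; exact Gpos x hx,
    fun x hx => by rw [gG x hx, hG x hx], fun x hx => ?_, ?_⟩
  · rcases (mem_Ici.1 hx).eq_or_lt with rfl | hx
    · refine ka.congr ?_
      have h1 : ∀ᶠ x in 𝓝[>] (0 : ℝ), k₀ 0 < k₀ x :=
        ka.differentiableAt.hasDerivAt.eventually_lt_right kd
      filter_upwards [eventually_nhdsWithin_iff.1 h1, kr] with x h2 h3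
      rcases le_or_gt x 0 with h | h
      · exact (if_pos h).symm
      · have h4 := h2 h
        rw [k0] at h4
        rw [gpos x h, ← hGf (k₀ x) h4.le, h3]
    · obtain ⟨k, k1, k2, k3, -⟩ := hloc (G x) (hG0 x hx.le)
      rw [hG x hx.le] at k1 k2 k3
      refine k1.congr ?_
      have h1 : ∀ᶠ t in 𝓝 x, 0 < k t :=
        k1.continuousAt.eventually (lt_mem_nhds (by rw [k2]; exact Gpos x hx))
      filter_upwards [h1, k3, lt_mem_nhds hx] with t h2 h3 h4
      rw [gpos t h4, ← hGf (k t) h2.le, h3]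
  · rw [gG _ ?_, hGf x hx]
    rw [← h0]
    exact hmono.monotoneOn self_mem_Ici hx hx
  · refine tendsto_atTop.2 fun b => ?_
    filter_upwards [eventually_ge_atTop (f (max b 0)), eventually_gt_atTop 0] with x h1 h2
    rw [gpos x h2]
    by_contra! h
    have := hmono (hG0 x h2.le) (le_max_right b 0) (h.trans_le (le_max_left b 0))
    rw [hG x h2.le] at this
    linarith

end Inverse

/-! ### Return to the radial variable `y`. -/

namespace Profile

open Set

/-- The profile in the self-similar variable `y`, in terms of `w = 1/ω` and `R = 2πρ`; here
`Q y = y² ω²`. -/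
theorem exists_profile_of_radius : ∃ z ∈ Ioo (2 : ℝ) 3, ∃ w R Q h : ℝ → ℝ,
    AnalyticOnNhd ℝ w (Ici 0) ∧ AnalyticOnNhd ℝ R (Ici 0) ∧ (∀ y, 0 ≤ y → 0 < R y) ∧
    w 0 = 3 ∧ (∀ y, 0 ≤ y → w y ^ 2 * Q y = y ^ 2 ∧ 1 ≤ w y ∧ (Q y = 1 ↔ y = z)) ∧
    w z = z ∧ h z = z - 2 ∧ R z = 1 / z ∧
    (∀ y, 0 < y → 1 < w y ∧ Q y * (R y * w y) = 1 - (w y - 1 - h y) / 2 * (1 - Q y) ∧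
      HasDerivAt w (-(w y * h y) / y) y ∧ HasDerivAt R (R y * (w y - 3 - h y) / y) y) ∧
    Tendsto w atTop (𝓝 1) ∧
    ∃ k, 0 < k ∧ Tendsto (fun y => y ^ 2 * R y) atTop (𝓝 k) := by
  obtain ⟨z, hz, a, P, H, ana, anP, a0, a1, H1, Ppos, hs, lim, k, hk, hlim⟩ :=
    exists_analytic_profile
  have hz0 : 0 < z := by linarith [hz.1]
  have apos : ∀ q, 0 ≤ q → 1 < a q := by
    intro q hq
    rcases hq.eq_or_lt with rfl | h
    · rw [a0]; norm_num
    · exact (hs q h).1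
  -- `η` is `y²` as a function of `q`. Composing its inverse with `y ↦ y²` keeps analyticity at the
  -- centre, where `√η` would not be smooth in `q`.
  let η : ℝ → ℝ := fun q => a q ^ 2 * q
  have ηan : AnalyticOnNhd ℝ η (Ici 0) := fun q hq => ((ana q hq).pow 2).mul analyticAt_id
  have ηd : ∀ q, 0 < q → HasDerivAt η (a q ^ 2 / (1 + H q)) q := by
    intro q hq
    obtain ⟨-, b2, d, -⟩ := hs q hq
    refine ((d.pow 2).mul (hasDerivAt_id q)).congr_deriv ?_
    have : 1 + H q ≠ 0 := by linarith
    simp only [slopeA, id, Pi.pow_apply]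
    field_simp
    ring
  have η0 : η 0 = 0 := mul_zero _
  have ηpos : ∀ q, 0 ≤ q → 0 < deriv η q := by
    intro q hq
    rcases hq.eq_or_lt with rfl | h
    · have := (((ana 0 self_mem_Ici).differentiableAt.hasDerivAt.pow 2).mul
        (hasDerivAt_id (0 : ℝ))).deriv
      change deriv η 0 = _ at this
      rw [this]
      simp [a0]
    · rw [(ηd q h).deriv]
      obtain ⟨b1, b2, -⟩ := hs q h
      exact div_pos (by positivity) (by linarith)
  have ηtop : Tendsto η atTop atTop := by
    refine tendsto_atTop_mono' _ ?_ tendsto_id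
    filter_upwards [eventually_ge_atTop 0] with q hq
    exact le_mul_of_one_le_left hq (one_le_pow₀ (apos q hq).le)
  obtain ⟨g, gan, g0, gpos, hr, hl, gtop⟩ := ηan.exists_inverse_Ici η0 ηpos ηtop
  have gnn : ∀ x, 0 ≤ x → 0 ≤ g x := by
    intro x hx
    rcases hx.eq_or_lt with rfl | h
    · exact g0.ge
    · exact (gpos x h).le
  have sqan : AnalyticOnNhd ℝ (fun y : ℝ => g (y ^ 2)) (Ici 0) := fun y _ =>
    (gan (y ^ 2) (sq_nonneg y)).comp (f := fun y : ℝ => y ^ 2) (analyticAt_id.pow 2)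
  have wan : AnalyticOnNhd ℝ (fun y : ℝ => a (g (y ^ 2))) (Ici 0) := fun y hy =>
    (ana _ (gnn _ (sq_nonneg y))).comp (f := fun y : ℝ => g (y ^ 2)) (sqan y hy)
  have Pan : AnalyticOnNhd ℝ (fun y : ℝ => P (g (y ^ 2))) (Ici 0) := fun y hy =>
    (anP _ (gnn _ (sq_nonneg y))).comp (f := fun y : ℝ => g (y ^ 2)) (sqan y hy)
  have gz : g (z ^ 2) = 1 := by
    rw [← hl 1 zero_le_one]
    simp [η, a1]
  have sqtop : Tendsto (fun y : ℝ => g (y ^ 2)) atTop atTop :=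
    gtop.comp (tendsto_pow_atTop two_ne_zero)
  have eη : ∀ y : ℝ, a (g (y ^ 2)) ^ 2 * g (y ^ 2) = y ^ 2 := fun y => hr (y ^ 2) (sq_nonneg y)
  have a0' : ∀ y : ℝ, a (g (y ^ 2)) ≠ 0 := fun y => by
    linarith [apos _ (gnn _ (sq_nonneg y))]
  have P1 : P 1 = 1 := by
    have := (hs 1 one_pos).2.2.2.2
    linarith
  refine ⟨z, hz, fun y => a (g (y ^ 2)), fun y => P (g (y ^ 2)) / a (g (y ^ 2)),
    fun y => g (y ^ 2), fun y => H (g (y ^ 2)), wan, fun y hy => (Pan y hy).div (wan y hy) (a0' y),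
    fun y hy => ?_, ?_, fun y hy => ⟨eη y, (apos _ (gnn _ (sq_nonneg y))).le, fun h => ?_, ?_⟩,
    ?_, ?_, ?_, fun y hy => ?_, lim.comp sqtop, k, hk, (hlim.comp sqtop).congr fun y => ?_⟩
  · exact div_pos (Ppos _ (gnn _ (sq_nonneg y))) (by linarith [apos _ (gnn _ (sq_nonneg y))])
  · simp [g0, a0]
  · have := eη y
    simp only at h
    rw [h, a1, mul_one] at this
    exact (pow_left_inj₀ hy hz0.le two_ne_zero).1 this.symm
  · rintro rfl
    exact gz
  · simp [gz, a1]
  · simp [gz, H1]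
  · simp [gz, a1, P1]
  · have hy2 : 0 < y ^ 2 := by positivity
    have hq := gpos _ hy2
    obtain ⟨b1, b2, dA, dP, e⟩ := hs _ hq
    have b0 := a0' y
    have b3 : 1 + H (g (y ^ 2)) ≠ 0 := by linarith
    have dg : HasDerivAt g (a (g (y ^ 2)) ^ 2 / (1 + H (g (y ^ 2))))⁻¹ (y ^ 2) :=
      (ηd _ hq).of_local_left_inverse (gan _ hy2.le).continuousAt
        (div_ne_zero (pow_ne_zero 2 b0) b3)
        ((eventually_gt_nhds hy2).mono fun x hx => hr x hx.le)
    -- In logarithmic form, `d log q / d log y = 2(1 + h)`; the factor `1 + h` cancels against the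
    -- denominators of the slopes.
    have dq : HasDerivAt (fun y : ℝ => g (y ^ 2)) (2 * g (y ^ 2) * (1 + H (g (y ^ 2))) / y) y := by
      refine (dg.comp (h := fun y : ℝ => y ^ 2) y (hasDerivAt_pow 2 y)).congr_deriv ?_
      have := eη y
      push_cast
      field_simp
      linear_combination -this
    have dw := dA.comp y dq
    have dP := dP.comp y dq
    refine ⟨b1, ?_, dw.congr_deriv ?_, (dP.div dw b0).congr_deriv ?_⟩
    · simp only
      rw [div_mul_cancel₀ _ b0, e]
    · rw [slopeA]
      have := hq.ne'
      field_simp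
    · rw [slopeA]
      have := hq.ne'
      simp only [Function.comp]
      field_simp
      ring
  · have := eη y
    have b0 := a0' y
    simp only [Function.comp]
    field_simp
    linear_combination P (g (y ^ 2)) * this

end Profile

/-! ### The Larson-Penston solution in the original unknowns. -/

theorem theoremT :
    ∃ (ρ ω : ℝ → ℝ) (z : ℝ),
      z ∈ Set.Icc (2 : ℝ) 3 ∧
      IsLarsonPenstonSolution ρ ω z ∧
      FriedmanCondition ρ ω ∧
      FarFieldCondition ρ ω := by
  obtain ⟨z, hz, w, R, Q, h, wan, Ran, Rpos, w0, hQ, wz, hhz, Rz, hs, wlim, k, hk, hlim⟩ :=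
    Profile.exists_profile_of_radius
  have hz0 : 0 < z := by linarith [hz.1]
  have hπ := Real.pi_pos
  have hπ' := hπ.ne'
  have wpos : ∀ y, 0 ≤ y → 0 < w y := fun y hy => one_pos.trans_le (hQ y hy).2.1
  have eQ : ∀ y, 0 ≤ y → y ^ 2 * (1 / w y) ^ 2 = Q y := by
    intro y hy
    have := (wpos y hy).ne'
    rw [← (hQ y hy).1]
    field_simp
  have hsonic : ∀ y, IsSonicPoint (fun y => 1 / w y) y ↔ y = z := by
    intro y
    constructor
    · rintro ⟨hy, e⟩
      rw [eQ y hy] at e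
      exact (hQ y hy).2.2.1 (by linarith)
    · rintro rfl
      refine ⟨hz0.le, ?_⟩
      rw [eQ y hz0.le, (hQ y hz0.le).2.2.2 rfl, sub_self]
  have dω : ∀ y, 0 < y → HasDerivAt (fun y => 1 / w y) (1 / w y * h y / y) y := by
    intro y hy
    have hw := (wpos y hy.le).ne'
    refine ((hasDerivAt_const y (1 : ℝ)).div (hs y hy).2.2.1 hw).congr_deriv ?_
    field_simp
    ring
  refine ⟨fun y => R y / (2 * Real.pi), fun y => 1 / w y, z, ⟨hz.1.le, hz.2.le⟩,
    ⟨fun y hy => (Ran y hy).div analyticAt_const (by positivity),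
      fun y hy => analyticAt_const.div (wan y hy) (wpos y hy).ne',
      fun y hy => div_pos (Rpos y hy) (by positivity), fun y hy hns => ?_, hsonic,
      ⟨?_, ?_, ?_, ?_⟩, fun y hy => ?_⟩, ⟨div_pos (Rpos 0 le_rfl) (by positivity), ?_⟩,
    ⟨k / (2 * Real.pi), by positivity, ?_⟩, ?_⟩
  · obtain ⟨hw1, e, dw, dR⟩ := hs y hy
    have hw := (wpos y hy.le).ne'
    have hq : 1 - Q y ≠ 0 := fun h => hns ⟨hy.le, by rw [eQ y hy.le, h]⟩
    -- Both equations contain the quotient `(ω - R)ω y²/(1 - q)`, and the relation defining `h`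
    -- evaluates it as `(w - 3 - h)/2`, free of the sonic denominator.
    have key : (1 / w y - 2 * Real.pi * (R y / (2 * Real.pi))) * y ^ 2 / (w y * (1 - Q y)) =
        (w y - 3 - h y) / 2 := by
      have h1 := (hQ y hy.le).1
      field_simp
      rw [← h1]
      linear_combination -2 * w y ^ 2 * e
    constructor
    · refine (dR.div_const _).congr_deriv ?_
      have e1 : 2 * y * (R y / (2 * Real.pi)) * (1 / w y) *
          (1 / w y - 2 * Real.pi * (R y / (2 * Real.pi))) / (1 - y ^ 2 * (1 / w y) ^ 2) =
          2 * (R y / (2 * Real.pi)) / y *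
          ((1 / w y - 2 * Real.pi * (R y / (2 * Real.pi))) * y ^ 2 / (w y * (1 - Q y))) := by
        rw [eQ y hy.le]
        field_simp
      rw [e1, key]
      field_simp
    · refine (dω y hy).congr_deriv ?_
      have e1 : 2 * y * (1 / w y) ^ 2 *
          (1 / w y - 2 * Real.pi * (R y / (2 * Real.pi))) / (1 - y ^ 2 * (1 / w y) ^ 2) =
          2 * (1 / w y) / y *
          ((1 / w y - 2 * Real.pi * (R y / (2 * Real.pi))) * y ^ 2 / (w y * (1 - Q y))) := by
        rw [eQ y hy.le]
        field_simp
      rw [e1, key]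
      field_simp
      ring
  · simp only
    rw [mul_div_cancel₀ _ (by positivity), Rz]
  · simp only
    rw [wz]
  · have d := (hs z hz0).2.2.2
    have e : (fun y => 2 * Real.pi * (R y / (2 * Real.pi))) = R := by
      funext y
      field_simp
    rw [e]
    refine d.congr_deriv ?_
    rw [Rz, wz, hhz]
    field_simp
    ring
  · refine (dω z hz0).congr_deriv ?_
    rw [wz, hhz]
    field_simp
  · obtain ⟨hw1, -⟩ := hs y hy
    refine mul_neg_of_pos_of_neg hy (sub_neg.2 ?_)
    rw [div_lt_one (by linarith)]
    exact hw1
  · simp only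
    rw [w0]
  · refine (hlim.div_const (2 * Real.pi)).congr fun y => ?_
    ring
  · have := wlim.inv₀ one_ne_zero
    simpa using this
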